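/- Let $R$ be a division ring with $|R|\neq 2$ and let $M$ be an infinite right $R$-module, regarded as a first-order structure in the language $\langle +,-,0,\{\cdot_r : r\in R\}\rangle$ of right $R$-modules, where $\cdot_r$ is the unary function symbol for $x\mapsto xr$. For $n\geq 1$ let $\Omega^n_n$ be the group, under composition, of definable automorphisms of $M^n$, i.e. of all bijections $f:M^n\to M^n$ whose graph $\{(x,f(x)) : x\in M^n\}\subseteq M^{2n}$ is first-order definable with parameters from $M$. For a group $G$ let $G^{ab}=G/[G,G]$ denote its abelianization, let $GL_i(R)$ be the group of invertible $i\times i$ matrices over $R$ (so that $GL_0(R)$ is trivial), and let $\mathbb Z_2=\mathbb Z/2\mathbb Z$. Then for each $n\geq 1$ there are isomorphisms of abelian groups $$(\Omega^n_n)^{ab}\;\cong\;GL_n(R)^{ab}\oplus\bigoplus_{i=0}^{n-1}\left(GL_i(R)^{ab}\oplus\mathbb Z_2\right)\;\cong\;\frac{R^\times}{[R^\times,R^\times]}\oplus\bigoplus_{i=1}^{n-1}\left(\frac{R^\times}{[R^\times,R^\times]}\oplus\mathbb Z_2\right)\oplus\mathbb Z_2 .$$ -/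

import Mathlib

universe u v w

/-- The function symbols of the language `⟨+, -, 0, {·r | r ∈ R}⟩` of right `R`-modules. -/
inductive RightModuleFunc (R : Type u) : ℕ → Type u
  | add : RightModuleFunc R 2
  | neg : RightModuleFunc R 1
  | zero : RightModuleFunc R 0
  | smul (r : R) : RightModuleFunc R 1

/-- The first-order language of right `R`-modules; it has no relation symbol besides equality. -/
def rightModuleLanguage (R : Type u) : FirstOrder.Language.{u, 0} where
  Functions := RightModuleFunc R
  Relations := fun _ => Empty

/-- A right `R`-module, that is, a left module over the opposite ring, as a first-order structure;
the symbol `smul r` is read as `x ↦ x · r`. -/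
instance rightModuleStructure (R : Type u) (M : Type v) [Ring R] [AddCommGroup M]
    [Module Rᵐᵒᵖ M] : (rightModuleLanguage R).Structure M where
  funMap := fun f x =>
    match f, x with
    | .add, x => x 0 + x 1
    | .neg, x => - x 0
    | .zero, _ => 0
    | .smul r, x => MulOpposite.op r • x 0
  RelMap := fun r _ => nomatch r

/-- The graph of `f : M ^ n → M ^ n` as a subset of `M ^ n × M ^ n = M ^ (n + n)`. -/
def graphSet {M : Type v} {n : ℕ} (f : (Fin n → M) → (Fin n → M)) :
    Set (Fin n ⊕ Fin n → M) :=
  {p | f (fun i => p (Sum.inl i)) = fun i => p (Sum.inr i)}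

theorem graphSet_id_definable (L : FirstOrder.Language.{u, w}) (M : Type v) [L.Structure M]
    (n : ℕ) : (Set.univ : Set M).Definable L (graphSet (id : (Fin n → M) → (Fin n → M))) := by
  have h : graphSet (id : (Fin n → M) → (Fin n → M)) =
      ⋂ i : Fin n, {p : Fin n ⊕ Fin n → M | p (Sum.inl i) = p (Sum.inr i)} := by
    ext p
    simp [graphSet, funext_iff]
  rw [h]
  refine Set.definable_iInter_of_finite fun i => ?_
  refine ⟨FirstOrder.Language.Term.equal (FirstOrder.Language.Term.var (Sum.inl i))
    (FirstOrder.Language.Term.var (Sum.inr i)), ?_⟩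
  ext p
  simp [FirstOrder.Language.Formula.realize_equal]

theorem graphSet_comp_definable {L : FirstOrder.Language.{u, w}} {M : Type v} [L.Structure M]
    {n : ℕ} {f g : (Fin n → M) → (Fin n → M)}
    (hf : (Set.univ : Set M).Definable L (graphSet f))
    (hg : (Set.univ : Set M).Definable L (graphSet g)) :
    (Set.univ : Set M).Definable L (graphSet (f ∘ g)) := by
  let a : Fin n ⊕ Fin n → (Fin n ⊕ Fin n) ⊕ Fin n :=
    Sum.elim (fun i => Sum.inl (Sum.inl i)) (fun i => Sum.inr i)
  let b : Fin n ⊕ Fin n → (Fin n ⊕ Fin n) ⊕ Fin n :=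
    Sum.elim (fun i => Sum.inr i) (fun i => Sum.inl (Sum.inr i))
  have key := ((hg.preimage_comp a).inter (hf.preimage_comp b)).image_comp
    (Sum.inl : Fin n ⊕ Fin n → (Fin n ⊕ Fin n) ⊕ Fin n)
  convert key using 1
  ext p
  constructor
  · intro hp
    refine ⟨Sum.elim p (g fun i => p (Sum.inl i)), ⟨?_, ?_⟩, ?_⟩
    · simp [graphSet, a]
    · simpa [graphSet, b] using hp
    · ext i
      simp
  · rintro ⟨q, ⟨h1, h2⟩, rfl⟩
    simp only [graphSet, a, b, Set.mem_preimage, Set.mem_ofPred_eq, Function.comp_apply,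
      Sum.elim_inl, Sum.elim_inr] at h1 h2 ⊢
    rw [h1, h2]

theorem graphSet_symm_definable {L : FirstOrder.Language.{u, w}} {M : Type v} [L.Structure M]
    {n : ℕ} {f : Equiv.Perm (Fin n → M)}
    (hf : (Set.univ : Set M).Definable L (graphSet f)) :
    (Set.univ : Set M).Definable L (graphSet f.symm) := by
  convert hf.preimage_comp (Sum.swap : Fin n ⊕ Fin n → Fin n ⊕ Fin n) using 1
  ext p
  simp only [graphSet, Set.mem_preimage, Set.mem_ofPred_eq, Function.comp_apply, Sum.swap_inl,
    Sum.swap_inr]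
  rw [Equiv.symm_apply_eq]
  exact eq_comm

/-- The group of definable automorphisms of `M ^ n`: the bijections of `M ^ n` onto itself whose
graph is definable with parameters from `M`. -/
def definableAut (L : FirstOrder.Language.{u, w}) (M : Type v) [L.Structure M] (n : ℕ) :
    Subgroup (Equiv.Perm (Fin n → M)) where
  carrier := {f | (Set.univ : Set M).Definable L (graphSet f)}
  one_mem' := by
    exact graphSet_id_definable L M n
  mul_mem' := by
    intro f g hf hg
    exact graphSet_comp_definable (f := f) (g := g) hf hg
  inv_mem' := by
    intro f hf
    exact graphSet_symm_definable (f := f) hf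

/-!
The definable automorphisms of `M ^ n` are the piecewise affine permutations, because `M` has
quantifier elimination up to Boolean combinations of affine hyperplanes (`mem_definableAut_iff`).
They are filtered by the dimension of their support: `thinSupport R M n d` is the normal subgroup of
those that are the identity off a set of dimension less than `d`. It is trivial for `d = 0` and the
whole group for `d = n + 1`.

An automorphism carries each `d`-dimensional flat to another one, up to sets of smaller dimension, so
that the group acts on flats and on frames (flats with affine coordinates). An automorphism whose
support has dimension at most `d` moves only finitely many `d`-flats. It therefore has two characters:
the product over all `d`-flats of the classes of its affine restrictions in the abelianization of
`GL_d` (`transitionProd`), and the sign of its permutation of the `d`-flats (`finitarySign` of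
`flatPerm`). For `d = n` there is a single flat, and the sign is trivial. Modulo automorphisms of
smaller support these characters are complete, since that subquotient is generated by automorphisms
supported on a single flat and by swaps of two flats (`map_eq_one_of_characters`).

The crucial point is that a conjugation invariant character of a step of the filtration extends to
the whole group (`IsInvariantHom.exists_extension`). To go from one step to the next, conjugate the
automorphism so that the flats that it moves become disjoint, and divide by the "tidy" automorphism
that permutes these flats in the same way and is the identity elsewhere. The quotient has smaller
support, and its character does not depend on the choices, because an automorphism that maps a
disjoint family of flats to a disjoint family can be straightened on these flats by an automorphism
of smaller support (`exists_thinSupport_mul_eqOn`). The extended characters of all dimensions together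
are an isomorphism from the abelianization to the product of their targets, by a descent along the
filtration (`abelianizationEquiv`).

Since `R` has an element `u` different from `0` and `1`, translations are commutators in the affine
group, and elementary matrices in the general linear group. Hence the affine group of `M ^ d` and
`GL_d` have the same abelianization, and for `d ≥ 1` the Dieudonné determinant, constructed by Artin's
recursion (`dieudonne`), identifies it with that of the unit group (`abelianizationGLEquiv`).
-/

set_option linter.unusedSectionVars false

namespace DefAut

open MulOpposite

variable {R : Type u} {M : Type v} [DivisionRing R] [AddCommGroup M] [Module Rᵐᵒᵖ M]

/-! ### Affine maps, constructible sets and piecewise affine maps -/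

section Affine

variable (R) in
/-- An affine functional `x ↦ ∑ i, x i · r i + c` on a finite power of the right `R`-module `M`. -/
def IsAffineFunctional {ι : Type*} [Fintype ι] (φ : (ι → M) → M) : Prop :=
  ∃ (r : ι → R) (c : M), ∀ x, φ x = ∑ i, op (r i) • x i + c

variable (R) in
/-- A map between finite powers of `M` is affine if its coordinates are affine functionals. -/
def IsAffine {ι κ : Type*} [Fintype ι] (f : (ι → M) → (κ → M)) : Prop :=
  ∀ k, IsAffineFunctional R fun x => f x k

variable {ι κ μ : Type*} [Fintype ι]

theorem IsAffineFunctional.const (c : M) : IsAffineFunctional R fun _ : ι → M => c :=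
  ⟨0, c, by simp⟩

theorem IsAffineFunctional.coord (i : ι) : IsAffineFunctional R fun x : ι → M => x i := by
  classical
  refine ⟨Pi.single i 1, 0, fun x => ?_⟩
  rw [Finset.sum_eq_single i] <;> simp +contextual

theorem IsAffineFunctional.add {φ ψ : (ι → M) → M} (hφ : IsAffineFunctional R φ)
    (hψ : IsAffineFunctional R ψ) : IsAffineFunctional R fun x => φ x + ψ x := by
  obtain ⟨r, c, h⟩ := hφ
  obtain ⟨s, d, k⟩ := hψ
  refine ⟨r + s, c + d, fun x => ?_⟩
  simp only [h, k, Pi.add_apply, op_add, add_smul, Finset.sum_add_distrib]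
  abel

theorem IsAffineFunctional.smul {φ : (ι → M) → M} (hφ : IsAffineFunctional R φ) (s : R) :
    IsAffineFunctional R fun x => op s • φ x := by
  obtain ⟨r, c, h⟩ := hφ
  refine ⟨fun i => r i * s, op s • c, fun x => ?_⟩
  simp only [h, smul_add, Finset.smul_sum, op_mul, mul_smul]

theorem IsAffineFunctional.neg {φ : (ι → M) → M} (hφ : IsAffineFunctional R φ) :
    IsAffineFunctional R fun x => - φ x := by
  simpa using hφ.smul (-1)

theorem IsAffineFunctional.sub {φ ψ : (ι → M) → M} (hφ : IsAffineFunctional R φ)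
    (hψ : IsAffineFunctional R ψ) : IsAffineFunctional R fun x => φ x - ψ x := by
  simpa [sub_eq_add_neg] using hφ.add hψ.neg

theorem IsAffineFunctional.sum {μ : Type*} (s : Finset μ) {φ : μ → (ι → M) → M}
    (hφ : ∀ i ∈ s, IsAffineFunctional R (φ i)) :
    IsAffineFunctional R fun x => ∑ i ∈ s, φ i x := by
  classical
  induction s using Finset.induction_on with
  | empty => simpa using IsAffineFunctional.const (R := R) (ι := ι) (0 : M)
  | insert a s ha ih =>
    simp only [Finset.sum_insert ha]
    exact (hφ a (by simp)).add (ih fun i hi => hφ i (by simp [hi]))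

theorem IsAffineFunctional.comp [Fintype κ] {φ : (κ → M) → M} (hφ : IsAffineFunctional R φ)
    {f : (ι → M) → (κ → M)} (hf : IsAffine R f) : IsAffineFunctional R fun x => φ (f x) := by
  obtain ⟨r, c, h⟩ := hφ
  simp only [h]
  exact (IsAffineFunctional.sum _ fun i _ => (hf i).smul _).add (.const c)

theorem IsAffine.comp [Fintype κ] {g : (κ → M) → (μ → M)} {f : (ι → M) → (κ → M)} (hg : IsAffine R g)
    (hf : IsAffine R f) : IsAffine R (g ∘ f) := fun k => (hg k).comp hf

theorem IsAffine.id : IsAffine R (id : (ι → M) → (ι → M)) := fun i => .coord i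

variable (R) in
/-- A set is constructible if membership of a point depends only on which members of a fixed finite
set of affine functionals vanish at it; equivalently, it is a Boolean combination of affine
hyperplanes. -/
def Constr (S : Set (ι → M)) : Prop :=
  ∃ Φ : Set ((ι → M) → M), Φ.Finite ∧ (∀ φ ∈ Φ, IsAffineFunctional R φ) ∧
    ∀ x y, (∀ φ ∈ Φ, φ x = 0 ↔ φ y = 0) → x ∈ S → y ∈ S

theorem Constr.empty : Constr R (∅ : Set (ι → M)) := ⟨∅, by simp⟩

theorem Constr.univ : Constr R (Set.univ : Set (ι → M)) := ⟨∅, by simp⟩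

theorem Constr.compl {S : Set (ι → M)} (hS : Constr R S) : Constr R Sᶜ := by
  obtain ⟨Φ, h1, h2, h3⟩ := hS
  exact ⟨Φ, h1, h2, fun x y hxy hx hy => hx (h3 y x (fun φ hφ => (hxy φ hφ).symm) hy)⟩

theorem Constr.inter {S T : Set (ι → M)} (hS : Constr R S) (hT : Constr R T) :
    Constr R (S ∩ T) := by
  obtain ⟨Φ, h1, h2, h3⟩ := hS
  obtain ⟨Ψ, k1, k2, k3⟩ := hT
  refine ⟨Φ ∪ Ψ, h1.union k1, ?_, fun x y hxy hx => ⟨?_, ?_⟩⟩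
  · rintro φ (h | h)
    exacts [h2 φ h, k2 φ h]
  · exact h3 x y (fun φ hφ => hxy φ (.inl hφ)) hx.1
  · exact k3 x y (fun φ hφ => hxy φ (.inr hφ)) hx.2

theorem Constr.union {S T : Set (ι → M)} (hS : Constr R S) (hT : Constr R T) :
    Constr R (S ∪ T) := by
  rw [← compl_compl (S ∪ T), Set.compl_union]
  exact (hS.compl.inter hT.compl).compl

theorem Constr.biUnion {μ : Type*} {s : Set μ} (hs : s.Finite) {S : μ → Set (ι → M)}
    (hS : ∀ i ∈ s, Constr R (S i)) : Constr R (⋃ i ∈ s, S i) := by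
  induction s, hs using Set.Finite.induction_on with
  | empty => simpa using Constr.empty
  | insert _ _ ih =>
    rw [Set.biUnion_insert]
    exact (hS _ (by simp)).union (ih fun i hi => hS i (by simp [hi]))

theorem Constr.biInter {μ : Type*} {s : Set μ} (hs : s.Finite) {S : μ → Set (ι → M)}
    (hS : ∀ i ∈ s, Constr R (S i)) : Constr R (⋂ i ∈ s, S i) := by
  rw [← compl_compl (⋂ i ∈ s, S i), Set.compl_iInter₂]
  exact (Constr.biUnion hs fun i hi => (hS i hi).compl).compl

theorem Constr.preimage [Fintype κ] {S : Set (κ → M)} (hS : Constr R S) {f : (ι → M) → (κ → M)}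
    (hf : IsAffine R f) : Constr R (f ⁻¹' S) := by
  obtain ⟨Φ, h1, h2, h3⟩ := hS
  refine ⟨(fun φ x => φ (f x)) '' Φ, h1.image _, ?_, fun x y hxy hx => h3 (f x) (f y) ?_ hx⟩
  · rintro _ ⟨φ, hφ, rfl⟩
    exact (h2 φ hφ).comp hf
  · exact fun φ hφ => hxy _ ⟨φ, hφ, rfl⟩

theorem Constr.zeroLocus {φ : (ι → M) → M} (hφ : IsAffineFunctional R φ) :
    Constr R {x | φ x = 0} :=
  ⟨{φ}, by simp, by simpa using hφ, fun x y h hx => (h φ rfl).1 hx⟩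

theorem Constr.eqLocus [Finite κ] {f g : (ι → M) → (κ → M)} (hf : IsAffine R f) (hg : IsAffine R g) :
    Constr R {x | f x = g x} := by
  have : {x | f x = g x} = ⋂ k ∈ (Set.univ : Set κ), {x | f x k - g x k = 0} := by
    ext x; simp [funext_iff, sub_eq_zero]
  rw [this]
  exact Constr.biInter Set.finite_univ fun k _ => Constr.zeroLocus ((hf k).sub (hg k))

/-- Quantifier elimination: constructible sets are stable under projection. A functional restricted
to a fibre is constant or vanishes at exactly one point, and since `M` is infinite a fibre has
points avoiding any finite number of these zeros. -/
theorem Constr.forall_fibre [Fintype κ] [Infinite M] {S : Set (ι → M)} (hS : Constr R S)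
    (E : (κ → M) → M → (ι → M))
    (hE : ∀ φ : (ι → M) → M, IsAffineFunctional R φ → ∃ ψ : (κ → M) → M,
      IsAffineFunctional R ψ ∧ ∃ r : R, ∀ z m, φ (E z m) = ψ z + op r • m) :
    Constr R {z | ∀ m, E z m ∈ S} := by
  classical
  obtain ⟨Φ, h1, h2, h3⟩ := hS
  choose! ψ hψ r hr using fun φ => hE φ
  let θ : ((ι → M) → M) → (κ → M) → M := fun φ z => op (-(r φ)⁻¹) • ψ φ z
  have hθ : ∀ φ ∈ Φ, r φ ≠ 0 → ∀ z m, φ (E z m) = 0 ↔ m = θ φ z := by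
    intro φ hφ h0 z m
    rw [hr φ (h2 φ hφ) z m]
    constructor
    · intro h
      have h' : ψ φ z = - (op (r φ) • m) := eq_neg_of_add_eq_zero_left h
      simp only [θ, h', smul_neg, ← mul_smul, ← op_mul]
      simp [h0]
    · rintro rfl
      simp only [θ, ← mul_smul, ← op_mul]
      simp [h0]
  refine ⟨ψ '' Φ ∪ (fun p : ((ι → M) → M) × ((ι → M) → M) => fun z => θ p.1 z - θ p.2 z) ''
    (Φ ×ˢ Φ), (h1.image _).union ((h1.prod h1).image _), ?_, ?_⟩
  · rintro _ (⟨φ, hφ, rfl⟩ | ⟨⟨φ, φ'⟩, ⟨hφ, hφ'⟩, rfl⟩)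
    · exact hψ φ (h2 φ hφ)
    · exact ((hψ φ (h2 φ hφ)).smul _).sub ((hψ φ' (h2 φ' hφ')).smul _)
  · intro z z' hzz hz m'
    have e1 : ∀ φ ∈ Φ, ψ φ z = 0 ↔ ψ φ z' = 0 := fun φ hφ => hzz _ (.inl ⟨φ, hφ, rfl⟩)
    have e2 : ∀ φ ∈ Φ, ∀ φ' ∈ Φ, θ φ z = θ φ' z ↔ θ φ z' = θ φ' z' := fun φ hφ φ' hφ' => by
      simpa [sub_eq_zero] using hzz _ (.inr ⟨(φ, φ'), ⟨hφ, hφ'⟩, rfl⟩)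
    have e0 : ∀ φ ∈ Φ, r φ = 0 → ∀ z m, φ (E z m) = ψ φ z := fun φ hφ h0 z m => by
      simp [hr φ (h2 φ hφ) z m, h0]
    by_cases hm : ∃ φ ∈ Φ, r φ ≠ 0 ∧ m' = θ φ z'
    · obtain ⟨φ₀, hφ₀, h0, rfl⟩ := hm
      refine h3 (E z (θ φ₀ z)) _ (fun φ hφ => ?_) (hz _)
      by_cases h : r φ = 0
      · rw [e0 φ hφ h, e0 φ hφ h, e1 φ hφ]
      · rw [hθ φ hφ h, hθ φ hφ h, e2 φ₀ hφ₀ φ hφ]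
    · push Not at hm
      obtain ⟨m, hm'⟩ := ((h1.image fun φ => θ φ z).infinite_compl).nonempty
      refine h3 (E z m) _ (fun φ hφ => ?_) (hz _)
      by_cases h : r φ = 0
      · rw [e0 φ hφ h, e0 φ hφ h, e1 φ hφ]
      · rw [hθ φ hφ h, hθ φ hφ h]
        exact iff_of_false (fun e => hm' ⟨φ, hφ, e.symm⟩) (hm φ hφ h)

variable (R) in
/-- A map is piecewise affine if its source is covered by finitely many constructible sets on each
of which it agrees with an affine map. -/
def PiecewiseAffine (h : (ι → M) → (κ → M)) : Prop :=
  ∃ C : Set (Set (ι → M) × ((ι → M) → (κ → M))), C.Finite ∧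
    (∀ p ∈ C, Constr R p.1 ∧ IsAffine R p.2 ∧ ∀ x ∈ p.1, h x = p.2 x) ∧ ∀ x, ∃ p ∈ C, x ∈ p.1

theorem IsAffine.piecewiseAffine {h : (ι → M) → (κ → M)} (hh : IsAffine R h) :
    PiecewiseAffine R h :=
  ⟨{(Set.univ, h)}, by simp, by simpa using ⟨Constr.univ, hh⟩, by simp⟩

theorem PiecewiseAffine.ite {f g : (ι → M) → (κ → M)} (hf : PiecewiseAffine R f)
    (hg : PiecewiseAffine R g) {S : Set (ι → M)} (hS : Constr R S) [DecidablePred (· ∈ S)] :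
    PiecewiseAffine R fun x => if x ∈ S then f x else g x := by
  obtain ⟨C, h1, h2, h3⟩ := hf
  obtain ⟨D, k1, k2, k3⟩ := hg
  refine ⟨(fun p => (p.1 ∩ S, p.2)) '' C ∪ (fun p => (p.1 ∩ Sᶜ, p.2)) '' D,
    (h1.image _).union (k1.image _), ?_, fun x => ?_⟩
  · rintro _ (⟨p, hp, rfl⟩ | ⟨p, hp, rfl⟩)
    · obtain ⟨a, b, c⟩ := h2 p hp
      exact ⟨a.inter hS, b, fun x hx => by simp [hx.2, c x hx.1]⟩
    · obtain ⟨a, b, c⟩ := k2 p hp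
      exact ⟨a.inter hS.compl, b, fun x hx => by simp [show x ∉ S from hx.2, c x hx.1]⟩
  · by_cases hx : x ∈ S
    · obtain ⟨p, hp, hxp⟩ := h3 x
      exact ⟨_, .inl ⟨p, hp, rfl⟩, hxp, hx⟩
    · obtain ⟨p, hp, hxp⟩ := k3 x
      exact ⟨_, .inr ⟨p, hp, rfl⟩, hxp, hx⟩

theorem PiecewiseAffine.comp_affine [Fintype κ] {h : (κ → M) → (μ → M)} (hh : PiecewiseAffine R h)
    {f : (ι → M) → (κ → M)} (hf : IsAffine R f) : PiecewiseAffine R (h ∘ f) := by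
  obtain ⟨C, h1, h2, h3⟩ := hh
  refine ⟨(fun p => (f ⁻¹' p.1, p.2 ∘ f)) '' C, h1.image _, ?_, fun x => ?_⟩
  · rintro _ ⟨p, hp, rfl⟩
    obtain ⟨a, b, c⟩ := h2 p hp
    exact ⟨a.preimage hf, b.comp hf, fun x hx => c (f x) hx⟩
  · obtain ⟨p, hp, hxp⟩ := h3 (f x)
    exact ⟨_, ⟨p, hp, rfl⟩, hxp⟩

end Affine

/-! ### Definable sets are the constructible sets -/

section Definable

open FirstOrder Language

variable {α : Type*} [Fintype α]

theorem isAffineFunctional_term_realize (t : ((rightModuleLanguage R)[[(Set.univ : Set M)]]).Term α) :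
    IsAffineFunctional R fun x : α → M => t.realize x := by
  induction t with
  | var i => exact .coord i
  | func f ts ih =>
    rename_i l
    rcases f with f | f
    · have key : ∀ x : α → M, (Term.func (Sum.inl f) ts :
          ((rightModuleLanguage R)[[(Set.univ : Set M)]]).Term α).realize x =
          Structure.funMap (L := rightModuleLanguage R) f fun i => (ts i).realize x :=
        fun x => rfl
      simp only [key]
      cases f with
      | add => exact (ih 0).add (ih 1)
      | neg => exact (ih 0).neg
      | zero => exact .const 0
      | smul r => exact (ih 0).smul r
    · cases l with
      | zero =>
        have key : ∀ x : α → M, (Term.func (Sum.inr f) ts :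
          ((rightModuleLanguage R)[[(Set.univ : Set M)]]).Term α).realize x =
          Structure.funMap (L := constantsOn (Set.univ : Set M)) f
            default := fun x =>
            congrArg (Structure.funMap (L := constantsOn (Set.univ : Set M)) f)
              (Subsingleton.elim (fun i => (ts i).realize x) default)
        simp only [key]
        exact .const _
      | succ l => exact isEmptyElim f

/-- Free and bound variables are kept together as coordinates of `M ^ (α ⊕ Fin k)`, so that a
universal quantifier becomes a condition on the fibres of a coordinate projection. -/
theorem constr_boundedFormula_realize [Infinite M] {k : ℕ}
    (φ : ((rightModuleLanguage R)[[(Set.univ : Set M)]]).BoundedFormula α k) :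
    Constr R {z : α ⊕ Fin k → M | φ.Realize (fun a => z (.inl a)) fun i => z (.inr i)} := by
  induction φ with
  | falsum => simpa [BoundedFormula.Realize] using Constr.empty
  | equal t₁ t₂ =>
    simp only [BoundedFormula.Realize]
    convert Constr.zeroLocus ((isAffineFunctional_term_realize t₁).sub
      (isAffineFunctional_term_realize t₂)) using 1
    ext z
    have : Sum.elim (fun a => z (.inl a)) (fun i => z (.inr i)) = z := Sum.elim_comp_inl_inr z
    simp [this, sub_eq_zero]
  | rel r ts =>
    rcases r with r | r <;> exact r.elim
  | imp φ ψ ih1 ih2 =>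
    convert ih1.compl.union ih2 using 1
    ext z
    simp [BoundedFormula.Realize, imp_iff_not_or]
  | @all l φ ih =>
    convert Constr.forall_fibre ih (κ := α ⊕ Fin l)
      (fun z m => Sum.elim (fun a => z (.inl a)) (Fin.snoc (fun i => z (.inr i)) m)) ?_ using 1
    · ext z
      simp [BoundedFormula.realize_all]
    rintro φ ⟨r, c, h⟩
    refine ⟨fun z => ∑ i, op (r (.inl i)) • z (.inl i) +
      ∑ i : Fin l, op (r (.inr i.castSucc)) • z (.inr i) + c,
      ((IsAffineFunctional.sum _ fun i _ => (IsAffineFunctional.coord _).smul _).add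
        (IsAffineFunctional.sum _ fun i _ => (IsAffineFunctional.coord _).smul _)).add
        (.const c), r (.inr (Fin.last l)), fun z m => ?_⟩
    simp only [h, Fintype.sum_sum_type, Sum.elim_inl, Sum.elim_inr, Fin.sum_univ_castSucc,
      Fin.snoc_castSucc, Fin.snoc_last]
    abel

theorem constr_of_definable [Infinite M] {S : Set (α → M)}
    (hS : (Set.univ : Set M).Definable (rightModuleLanguage R) S) : Constr R S := by
  obtain ⟨φ, rfl⟩ := hS
  have := (constr_boundedFormula_realize φ).preimage (ι := α)
    (f := fun x => Sum.elim x Fin.elim0) (by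
      rintro (a | i)
      · exact .coord a
      · exact i.elim0)
  convert this using 1
  ext x
  simp only [Set.mem_preimage]
  exact iff_of_eq (congrArg (BoundedFormula.Realize φ x) (Subsingleton.elim _ _))

theorem definable_zeroLocus {φ : (α → M) → M} (hφ : IsAffineFunctional R φ) :
    (Set.univ : Set M).Definable (rightModuleLanguage R) {x | φ x = 0} := by
  classical
  -- every affine functional is the value of a term with parameters
  suffices h : ∃ t : ((rightModuleLanguage R)[[(Set.univ : Set M)]]).Term α,
      ∀ x : α → M, t.realize x = φ x by
    obtain ⟨t, ht⟩ := h
    let z : ((rightModuleLanguage R)[[(Set.univ : Set M)]]).Term α :=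
      Term.func (L := (rightModuleLanguage R)[[(Set.univ : Set M)]])
        (Sum.inl RightModuleFunc.zero) default
    have hz : ∀ x : α → M, z.realize x = 0 := fun x => rfl
    refine ⟨t.equal z, ?_⟩
    ext x
    simp [Formula.realize_equal, ht, hz]
  obtain ⟨r, c, h⟩ := hφ
  have hadd : ∀ s t : ((rightModuleLanguage R)[[(Set.univ : Set M)]]).Term α, ∃ u :
      ((rightModuleLanguage R)[[(Set.univ : Set M)]]).Term α,
      ∀ x : α → M, u.realize x = s.realize x + t.realize x := fun s t =>
    ⟨Functions.apply₂ (L := (rightModuleLanguage R)[[(Set.univ : Set M)]])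
      (Sum.inl RightModuleFunc.add) s t, fun x => rfl⟩
  have hc : ∀ c : M, ∃ u : ((rightModuleLanguage R)[[(Set.univ : Set M)]]).Term α,
      ∀ x : α → M, u.realize x = c := fun c =>
    ⟨((rightModuleLanguage R).con (⟨c, trivial⟩ : (Set.univ : Set M))).term, fun x => by simp⟩
  have hs : ∀ s : Finset α, ∃ u : ((rightModuleLanguage R)[[(Set.univ : Set M)]]).Term α,
      ∀ x : α → M, u.realize x = ∑ i ∈ s, op (r i) • x i := by
    intro s
    induction s using Finset.induction_on with
    | empty => simpa using hc 0
    | insert a s ha ih =>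
      obtain ⟨t, ht⟩ := ih
      obtain ⟨u, hu⟩ := hadd (Functions.apply₁
        (L := (rightModuleLanguage R)[[(Set.univ : Set M)]])
        (Sum.inl (RightModuleFunc.smul (r a))) (Term.var a)) t
      refine ⟨u, fun x => ?_⟩
      rw [hu, ht, Finset.sum_insert ha]
      rfl
  obtain ⟨t, ht⟩ := hs Finset.univ
  obtain ⟨d, hd⟩ := hc c
  obtain ⟨u, hu⟩ := hadd t d
  exact ⟨u, fun x => by rw [hu, ht, hd, h]⟩

theorem definable_of_constr {S : Set (α → M)} (hS : Constr R S) :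
    (Set.univ : Set M).Definable (rightModuleLanguage R) S := by
  classical
  obtain ⟨Φ, h1, h2, h3⟩ := hS
  -- the set of points with vanishing pattern `P`
  let D : Set ((α → M) → M) → Set (α → M) := fun P =>
    ⋂ φ ∈ h1.toFinset, if φ ∈ P then {x | φ x = 0} else {x | φ x = 0}ᶜ
  have hD : ∀ P, (Set.univ : Set M).Definable (rightModuleLanguage R) (D P) := by
    intro P
    have : D P = ⋂ φ : h1.toFinset, if φ.1 ∈ P then {x | φ.1 x = 0} else {x | φ.1 x = 0}ᶜ := by
      ext x; simp [D]
    rw [this]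
    refine Set.definable_iInter_of_finite fun φ => ?_
    have hφ := definable_zeroLocus (h2 φ.1 (h1.mem_toFinset.1 φ.2))
    split_ifs
    exacts [hφ, hφ.compl]
  have hDm : ∀ P x, x ∈ D P ↔ ∀ φ ∈ Φ, φ x = 0 ↔ φ ∈ P := by
    intro P x
    simp only [D, Set.Finite.mem_toFinset, Set.mem_iInter]
    refine forall₂_congr fun φ _ => ?_
    split_ifs with h <;> simp [h]
  have hS : S = ⋃ P : {P // P ∈ Φ.powerset ∧ D P ⊆ S}, D P.1 := by
    ext x
    simp only [Set.mem_iUnion]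
    constructor
    · intro hx
      refine ⟨⟨{φ ∈ Φ | φ x = 0}, fun φ h => h.1, fun y hy => ?_⟩, ?_⟩
      · rw [hDm] at hy
        exact h3 x y (fun φ hφ => by rw [hy φ hφ]; simp [hφ]) hx
      · rw [hDm]
        intro φ hφ
        simp [hφ]
    · rintro ⟨P, hP⟩
      exact P.2.2 hP
  rw [hS]
  have : Finite {P // P ∈ Φ.powerset ∧ D P ⊆ S} :=
    (h1.finite_subsets.subset fun P hP => hP.1).to_subtype
  exact Set.definable_iUnion_of_finite fun P => hD _

/-- At every point a definable map agrees with one of finitely many affine maps: otherwise a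
coordinate of its value could be varied without changing any vanishing pattern. -/
theorem piecewiseAffine_of_definable [Infinite M] {n : ℕ} {f : (Fin n → M) → (Fin n → M)}
    (hf : (Set.univ : Set M).Definable (rightModuleLanguage R) (graphSet f)) :
    PiecewiseAffine R f := by
  classical
  have hcoord : ∀ i : Fin n, ∃ Ψ : Set ((Fin n → M) → M), Ψ.Finite ∧
      (∀ ψ ∈ Ψ, IsAffineFunctional R ψ) ∧ ∀ x, ∃ ψ ∈ Ψ, f x i = ψ x := by
    intro i
    have hG := constr_of_definable
      (hf.image_comp (Sum.elim (fun j => Sum.inl j) (fun _ : Unit => Sum.inr i)))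
    obtain ⟨Φ, h1, h2, h3⟩ := hG
    have hmem : ∀ z : Fin n ⊕ Unit → M, z ∈ (fun g : Fin n ⊕ Fin n → M =>
        g ∘ Sum.elim (fun j => Sum.inl j) (fun _ : Unit => Sum.inr i)) '' graphSet f ↔
        f (fun j => z (.inl j)) i = z (.inr ()) := by
      intro z
      constructor
      · rintro ⟨g, hg, rfl⟩
        exact congrFun hg i
      · intro h
        refine ⟨Sum.elim (fun j => z (.inl j)) (f fun j => z (.inl j)), rfl, ?_⟩
        ext (j | j)
        · rfl
        · exact h
    simp only [hmem] at h3
    choose! r c hr using h2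
    refine ⟨(fun φ x => op (-(r φ (.inr ()))⁻¹) • (∑ j, op (r φ (.inl j)) • x j + c φ)) '' Φ,
      h1.image _, ?_, fun x => ?_⟩
    · rintro _ ⟨φ, hφ, rfl⟩
      exact ((IsAffineFunctional.sum _ fun i _ => (IsAffineFunctional.coord _).smul _).add
        (.const _)).smul _
    · by_contra hcon
      push Not at hcon
      -- a second value with the same vanishing pattern
      obtain ⟨m, hm⟩ := (((h1.image fun φ =>
        op (-(r φ (.inr ()))⁻¹) • (∑ j, op (r φ (.inl j)) • x j + c φ)).union
          (Set.finite_singleton (f x i))).infinite_compl).nonempty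
      have hz : ∀ φ ∈ Φ, ∀ a : M, φ (Sum.elim x fun _ => a) = 0 ↔
          (r φ (.inr ()) = 0 ∧ ∑ j, op (r φ (.inl j)) • x j + c φ = 0) ∨
          (r φ (.inr ()) ≠ 0 ∧
            a = op (-(r φ (.inr ()))⁻¹) • (∑ j, op (r φ (.inl j)) • x j + c φ)) := by
        intro φ hφ a
        rw [hr φ hφ]
        simp only [Fintype.sum_sum_type, Sum.elim_inl, Sum.elim_inr, Finset.univ_unique,
          Finset.sum_singleton, PUnit.default_eq_unit]
        by_cases h0 : r φ (.inr ()) = 0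
        · simp [h0]
        · simp only [h0, false_and, false_or, ne_eq, not_false_eq_true, true_and]
          rw [add_right_comm]
          constructor
          · intro h
            rw [eq_neg_of_add_eq_zero_left h, smul_neg, ← mul_smul, ← op_mul]
            simp [h0]
          · rintro rfl
            rw [← mul_smul, ← op_mul, neg_mul, inv_mul_cancel₀ h0, op_neg, op_one, neg_one_smul,
              add_neg_cancel]
      have := h3 (Sum.elim x fun _ => f x i) (Sum.elim x fun _ => m) (fun φ hφ => ?_) rfl
      · simp only [Sum.elim_inl, Sum.elim_inr] at this
        exact hm (.inr (by simp [← this]))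
      · rw [hz φ hφ, hz φ hφ]
        have e1 := hcon _ ⟨φ, hφ, rfl⟩
        have e2 : m ≠ op (-(r φ (.inr ()))⁻¹) • (∑ j, op (r φ (.inl j)) • x j + c φ) :=
          fun h => hm (.inl ⟨φ, hφ, h.symm⟩)
        simp only [e1, e2]
  choose Ψ hΨ1 hΨ2 hΨ3 using hcoord
  have hgraph := constr_of_definable hf
  let A : Set ((Fin n → M) → (Fin n → M)) :=
    (fun t x i => t i x) '' (Set.pi Set.univ Ψ)
  have hAaff : ∀ α ∈ A, IsAffine R α := by
    rintro _ ⟨t, ht, rfl⟩ k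
    exact hΨ2 k _ (ht k trivial)
  refine ⟨(fun α => ({x | f x = α x}, α)) '' A, ((Set.Finite.pi' hΨ1).subset ?_).image _ |>.image _,
    ?_, fun x => ?_⟩
  · intro t ht i
    exact ht i trivial
  · rintro _ ⟨α, hα, rfl⟩
    refine ⟨?_, hAaff α hα, fun x hx => hx⟩
    exact hgraph.preimage (ι := Fin n) (f := fun x => Sum.elim x (α x)) (by
      rintro (j | j)
      · exact .coord j
      · exact hAaff α hα j)
  · choose t ht1 ht2 using fun i => hΨ3 i x
    exact ⟨_, ⟨_, ⟨t, fun i _ => ht1 i, rfl⟩, rfl⟩, funext ht2⟩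

theorem definable_of_piecewiseAffine {n : ℕ} {f : (Fin n → M) → (Fin n → M)}
    (hf : PiecewiseAffine R f) :
    (Set.univ : Set M).Definable (rightModuleLanguage R) (graphSet f) := by
  obtain ⟨C, h1, h2, h3⟩ := hf
  refine definable_of_constr ?_
  have hl : IsAffine R fun p : Fin n ⊕ Fin n → M => fun i => p (Sum.inl i) := fun i => .coord _
  have hr : IsAffine R fun p : Fin n ⊕ Fin n → M => fun i => p (Sum.inr i) := fun i => .coord _
  have : graphSet f = ⋃ q ∈ C, ((fun p i => p (Sum.inl i)) ⁻¹' q.1 ∩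
      {p | q.2 (fun i => p (Sum.inl i)) = fun i => p (Sum.inr i)}) := by
    ext p
    simp only [graphSet, Set.mem_iUnion, exists_prop]
    constructor
    · intro hp
      obtain ⟨q, hq, hx⟩ := h3 fun i => p (Sum.inl i)
      exact ⟨q, hq, hx, ((h2 q hq).2.2 _ hx).symm.trans hp⟩
    · rintro ⟨q, hq, hx, h⟩
      exact ((h2 q hq).2.2 _ hx).trans h
  rw [this]
  exact Constr.biUnion h1 fun q hq =>
    ((h2 q hq).1.preimage hl).inter (Constr.eqLocus ((h2 q hq).2.1.comp hl) hr)

/-- The definable automorphisms are the piecewise affine permutations. -/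
theorem mem_definableAut_iff [Infinite M] {n : ℕ} {f : Equiv.Perm (Fin n → M)} :
    f ∈ definableAut (rightModuleLanguage R) M n ↔ PiecewiseAffine R f :=
  ⟨piecewiseAffine_of_definable, definable_of_piecewiseAffine⟩

end Definable

/-! ### Thin sets and generic behaviour -/

section Thin

variable {a b d e : ℕ}

variable (R) in
/-- A subset of `M ^ a` is `d`-thin if it is covered by finitely many images of affine maps from
powers `M ^ e` with `e < d`, that is, if its dimension is less than `d`. -/
inductive Thin (d : ℕ) {a : ℕ} : Set (Fin a → M) → Prop
  | empty : Thin d ∅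
  | range {e : ℕ} (he : e < d) {τ : (Fin e → M) → (Fin a → M)} (hτ : IsAffine R τ) :
      Thin d (Set.range τ)
  | union {S T : Set (Fin a → M)} : Thin d S → Thin d T → Thin d (S ∪ T)
  | mono {S T : Set (Fin a → M)} : S ⊆ T → Thin d T → Thin d S

theorem Thin.biUnion {μ : Type*} {s : Set μ} (hs : s.Finite) {S : μ → Set (Fin a → M)}
    (hS : ∀ i ∈ s, Thin R d (S i)) : Thin R d (⋃ i ∈ s, S i) := by
  induction s, hs using Set.Finite.induction_on with
  | empty => simpa using Thin.empty
  | insert _ _ ih =>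
    rw [Set.biUnion_insert]
    exact (hS _ (by simp)).union (ih fun i hi => hS i (by simp [hi]))

theorem Thin.of_le (hde : d ≤ e) {S : Set (Fin a → M)} (hS : Thin R d S) : Thin R e S := by
  induction hS with
  | empty => exact .empty
  | range he hτ => exact .range (he.trans_le hde) hτ
  | union _ _ h1 h2 => exact h1.union h2
  | mono h _ ih => exact ih.mono h

theorem Thin.image {S : Set (Fin a → M)} (hS : Thin R d S) {f : (Fin a → M) → (Fin b → M)}
    (hf : IsAffine R f) : Thin R d (f '' S) := by
  induction hS with
  | empty => simpa using Thin.empty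
  | range he hτ => rw [← Set.range_comp]; exact .range he (hf.comp hτ)
  | union _ _ h1 h2 => rw [Set.image_union]; exact h1.union h2
  | mono h _ ih => exact ih.mono (Set.image_mono h)

theorem Thin.image_piecewiseAffine {S : Set (Fin a → M)} (hS : Thin R d S)
    {f : (Fin a → M) → (Fin b → M)} (hf : PiecewiseAffine R f) : Thin R d (f '' S) := by
  obtain ⟨C, h1, h2, h3⟩ := hf
  refine (Thin.biUnion h1 (S := fun p => p.2 '' S) fun p hp => hS.image (h2 p hp).2.1).mono ?_
  rintro _ ⟨x, hx, rfl⟩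
  obtain ⟨p, hp, hxp⟩ := h3 x
  exact Set.mem_biUnion hp ⟨x, hx, ((h2 p hp).2.2 x hxp).symm⟩

theorem thin_zero {S : Set (Fin a → M)} : Thin R 0 S ↔ S = ∅ := by
  constructor
  · intro h
    induction h with
    | empty => rfl
    | range he hτ => exact absurd he (Nat.not_lt_zero _)
    | union _ _ h1 h2 => rw [h1, h2, Set.union_empty]
    | mono h _ ih => exact Set.subset_eq_empty h ih
  · rintro rfl
    exact .empty

theorem thin_of_lt (h : a < d) (S : Set (Fin a → M)) : Thin R d S :=
  (Thin.range h IsAffine.id).mono fun x _ => Set.mem_range_self x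

/-- The zero locus of an affine functional that is not identically zero is thin. -/
theorem thin_zeroLocus {φ : (Fin a → M) → M} (hφ : IsAffineFunctional R φ)
    (h0 : ∃ x, φ x ≠ 0) : Thin R a {x | φ x = 0} := by
  obtain ⟨r, c, hr⟩ := hφ
  by_cases h : ∀ i, r i = 0
  · have hc : ∀ x, φ x = c := fun x => by simp [hr, h]
    obtain ⟨x, hx⟩ := h0
    refine Thin.empty.mono fun y hy => hx ?_
    rw [hc, ← hc y]; exact hy
  · push Not at h
    obtain ⟨j, hj⟩ := h
    cases a with
    | zero => exact j.elim0
    | succ a =>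
      -- solve for the coordinate `j`
      refine (Thin.range (Nat.lt_succ_self a) (τ := fun y => j.insertNth
        (op (-(r j)⁻¹) • (∑ i, op (r (j.succAbove i)) • y i + c)) y) ?_).mono ?_
      · intro k
        rcases Fin.eq_self_or_eq_succAbove j k with rfl | ⟨i, rfl⟩
        · simp only [Fin.insertNth_apply_same]
          exact ((IsAffineFunctional.sum _ fun i _ => (IsAffineFunctional.coord _).smul _).add
            (.const _)).smul _
        · simp only [Fin.insertNth_apply_succAbove]
          exact .coord i
      · intro x hx
        refine ⟨fun i => x (j.succAbove i), ?_⟩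
        have hx' : φ x = 0 := hx
        rw [hr, Fin.sum_univ_succAbove _ j, add_assoc] at hx'
        ext k
        rcases Fin.eq_self_or_eq_succAbove j k with rfl | ⟨i, rfl⟩
        · beta_reduce
          rw [Fin.insertNth_apply_same, ← neg_eq_of_add_eq_zero_right hx', smul_neg, ← mul_smul,
            ← op_mul, mul_neg, mul_inv_cancel₀ hj]
          simp
        · beta_reduce
          rw [Fin.insertNth_apply_succAbove]

/-- A constructible set or its complement is thin. -/
theorem Constr.thin_or_thin_compl {S : Set (Fin a → M)} (hS : Constr R S) :
    Thin R a S ∨ Thin R a Sᶜ := by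
  obtain ⟨Φ, h1, h2, h3⟩ := hS
  have hZ : Thin R a (⋃ φ ∈ {φ ∈ Φ | ∃ x, φ x ≠ 0}, {x : Fin a → M | φ x = 0}) :=
    Thin.biUnion (h1.subset fun φ h => h.1) fun φ hφ => thin_zeroLocus (h2 φ hφ.1) hφ.2
  by_cases h : ∃ x ∈ S, x ∉ ⋃ φ ∈ {φ ∈ Φ | ∃ x, φ x ≠ 0}, {x : Fin a → M | φ x = 0}
  · right
    obtain ⟨x, hx, hxZ⟩ := h
    refine hZ.mono fun y hy => ?_
    by_contra hyZ
    refine hy (h3 x y (fun φ hφ => ?_) hx)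
    simp only [Set.mem_iUnion, not_exists] at hxZ hyZ
    by_cases h0 : ∃ x, φ x ≠ 0
    · exact iff_of_false (hxZ φ ⟨hφ, h0⟩) (hyZ φ ⟨hφ, h0⟩)
    · push Not at h0
      simp [h0]
  · left
    push Not at h
    exact hZ.mono h

/-- The linear part of an affine map either kills a nonzero vector with entries in `R`, or it has
a left inverse. -/
theorem IsAffine.exists_leftInverse_or [Infinite M] {τ : (Fin a → M) → (Fin b → M)}
    (hτ : IsAffine R τ) :
    (∃ ρ : (Fin b → M) → (Fin a → M), IsAffine R ρ ∧ ∀ y, ρ (τ y) = y) ∨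
      ∃ v : Fin a → R, v ≠ 0 ∧ ∀ y m, τ (fun i => y i + op (v i) • m) = τ y := by
  choose r c hr using hτ
  -- the action of the linear part on vectors with entries in `R`
  let L : (Fin a → R) →ₗ[R] (Fin b → R) := Matrix.vecMulLinear (Matrix.of fun j i => r i j)
  have hL : ∀ v i, L v i = ∑ j, v j * r i j := fun v i => by
    simp [L, Matrix.vecMul, dotProduct]
  by_cases hinj : Function.Injective L
  · left
    obtain ⟨G, hG⟩ := LinearMap.exists_leftInverse_of_injective L (LinearMap.ker_eq_bot.2 hinj)
    let B : Fin b → Fin a → R := fun i k => G (Pi.single i 1) k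
    have hGB : ∀ w k, G w k = ∑ i, w i * B i k := by
      intro w k
      conv_lhs => rw [← Finset.univ_sum_single w, map_sum, Finset.sum_apply]
      refine Finset.sum_congr rfl fun i _ => ?_
      rw [show Pi.single i (w i) = w i • (Pi.single i 1 : Fin b → R) by
        rw [← Pi.single_smul]; simp, map_smul]
      rfl
    have hrB : ∀ j k, ∑ i, r i j * B i k = if j = k then 1 else 0 := by
      intro j k
      have := congrFun (LinearMap.congr_fun hG (Pi.single j 1)) k
      rw [LinearMap.comp_apply, hGB] at this
      simp only [hL, Pi.single_apply, ite_mul, one_mul, zero_mul, Finset.sum_ite_eq',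
        Finset.mem_univ, if_true, LinearMap.id_apply] at this
      rw [this]
      simp [eq_comm]
    refine ⟨fun x k => ∑ i, op (B i k) • (x i - c i), fun k =>
      IsAffineFunctional.sum _ fun i _ => ((IsAffineFunctional.coord i).sub (.const _)).smul _,
      fun y => ?_⟩
    ext k
    simp only [hr, add_sub_cancel_right, Finset.smul_sum, ← mul_smul, ← op_mul]
    rw [Finset.sum_comm]
    simp only [← Finset.sum_smul, ← Finset.op_sum, hrB]
    rw [Finset.sum_eq_single k]
    · rw [if_pos rfl, op_one, one_smul]
    · intro i _ hi
      rw [if_neg hi, op_zero, zero_smul]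
    · simp
  · right
    rw [← LinearMap.ker_eq_bot, ← ne_eq, Submodule.ne_bot_iff] at hinj
    obtain ⟨v, hv, hv0⟩ := hinj
    refine ⟨v, hv0, fun y m => ?_⟩
    ext i
    have : ∑ j, v j * r i j = 0 := by rw [← hL, LinearMap.mem_ker.1 hv]; rfl
    simp only [hr, smul_add, Finset.sum_add_distrib, ← mul_smul, ← op_mul]
    rw [← Finset.sum_smul, ← Finset.op_sum, this]
    simp

theorem IsAffine.exists_leftInverse [Infinite M] {τ : (Fin a → M) → (Fin b → M)}
    (hτ : IsAffine R τ) (hinj : Function.Injective τ) :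
    ∃ ρ : (Fin b → M) → (Fin a → M), IsAffine R ρ ∧ ∀ y, ρ (τ y) = y := by
  refine hτ.exists_leftInverse_or.resolve_right ?_
  rintro ⟨v, hv, h⟩
  obtain ⟨m, hm⟩ := exists_ne (0 : M)
  refine hv (funext fun i => ?_)
  have := congrFun (hinj (h 0 m)) i
  simpa [hm] using this

theorem IsAffine.injective_or_thin_range [Infinite M] {τ : (Fin a → M) → (Fin b → M)}
    (hτ : IsAffine R τ) : Function.Injective τ ∨ Thin R a (Set.range τ) := by
  rcases hτ.exists_leftInverse_or with ⟨ρ, -, h⟩ | ⟨v, hv, h⟩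
  · exact .inl (Function.LeftInverse.injective h)
  · right
    obtain ⟨j, hj⟩ := Function.ne_iff.1 hv
    have hj : v j ≠ 0 := hj
    -- every value is attained on the hyperplane where the coordinate `j` vanishes
    have hH : Thin R a {x : Fin a → M | x j = 0} := by
      obtain ⟨m, hm⟩ := exists_ne (0 : M)
      exact thin_zeroLocus (.coord j) ⟨fun _ => m, hm⟩
    refine (hH.image hτ).mono ?_
    rintro _ ⟨y, rfl⟩
    refine ⟨fun i => y i + op (v i) • (op (-(v j)⁻¹) • y j), ?_, h y _⟩
    simp only [Set.mem_ofPred_eq, ← mul_smul, ← op_mul, neg_mul, inv_mul_cancel₀ hj]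
    simp

/-- The full space `M ^ a` is not `a`-thin: thin sets lie in finite unions of cosets of subgroups
of infinite index, and by B. H. Neumann's lemma such cosets do not cover `M ^ a`. -/
theorem not_thin_univ [Infinite M] : ¬ Thin R a (Set.univ : Set (Fin a → M)) := by
  classical
  -- a thin set is covered by finitely many affine hyperplanes
  have key : ∀ T : Set (Fin a → M), Thin R a T → ∃ Λ : Finset ((Fin a → R) × M),
      (∀ p ∈ Λ, p.1 ≠ 0) ∧ ∀ x ∈ T, ∃ p ∈ Λ, ∑ i, op (p.1 i) • x i = p.2 := by
    intro T hT
    induction hT with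
    | empty => exact ⟨∅, by simp⟩
    | @range e he τ hτ =>
      choose r c hr using hτ
      let L : (Fin e → R) →ₗ[R] (Fin a → R) := Matrix.vecMulLinear (Matrix.of fun j i => r i j)
      have hlt : LinearMap.range L < ⊤ := by
        rw [lt_top_iff_ne_top]
        intro h
        have := LinearMap.finrank_range_le L
        rw [h, finrank_top, Module.finrank_fin_fun, Module.finrank_fin_fun] at this
        omega
      -- a nonzero linear functional that vanishes on the range of the linear part of `τ`
      obtain ⟨f, hf, hfL⟩ := Submodule.exists_le_ker_of_lt_top _ hlt
      have hfe : ∀ w : Fin a → R, f w = ∑ i, w i * f (Pi.single i 1) := by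
        intro w
        conv_lhs => rw [← Finset.univ_sum_single w, map_sum]
        refine Finset.sum_congr rfl fun i _ => ?_
        rw [show Pi.single i (w i) = w i • (Pi.single i 1 : Fin a → R) by
          rw [← Pi.single_smul]; simp, map_smul]
        rfl
      refine ⟨{(fun i => f (Pi.single i 1), ∑ i, op (f (Pi.single i 1)) • c i)}, ?_, ?_⟩
      · simp only [Finset.mem_singleton, forall_eq]
        intro h0
        refine hf (LinearMap.ext fun w => ?_)
        rw [hfe]
        simp [fun i => congrFun h0 i]
      · rintro _ ⟨y, rfl⟩
        refine ⟨_, Finset.mem_singleton_self _, ?_⟩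
        simp only [hr, smul_add, Finset.sum_add_distrib, Finset.smul_sum, ← mul_smul, ← op_mul]
        rw [Finset.sum_comm]
        simp only [← Finset.sum_smul, ← Finset.op_sum]
        have : ∀ j, ∑ i, r i j * f (Pi.single i 1) = 0 := by
          intro j
          have h1 : f (L (Pi.single j 1)) = 0 := hfL ⟨_, rfl⟩
          rw [hfe] at h1
          simpa [L, Matrix.vecMul, dotProduct, Pi.single_apply] using h1
        simp [this]
    | union _ _ h1 h2 =>
      obtain ⟨Λ, k1, k2⟩ := h1
      obtain ⟨Λ', l1, l2⟩ := h2
      refine ⟨Λ ∪ Λ', fun p hp => ?_, ?_⟩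
      · rcases Finset.mem_union.1 hp with h | h
        exacts [k1 p h, l1 p h]
      · rintro x (hx | hx)
        · obtain ⟨p, hp, h⟩ := k2 x hx
          exact ⟨p, Finset.mem_union_left _ hp, h⟩
        · obtain ⟨p, hp, h⟩ := l2 x hx
          exact ⟨p, Finset.mem_union_right _ hp, h⟩
    | mono h _ ih =>
      obtain ⟨Λ, k1, k2⟩ := ih
      exact ⟨Λ, k1, fun x hx => k2 x (h hx)⟩
  intro h
  obtain ⟨Λ, h1, h2⟩ := key _ h
  let F : (Fin a → R) → (Fin a → M) →+ M := fun ℓ =>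
    { toFun := fun x => ∑ i, op (ℓ i) • x i
      map_zero' := by simp
      map_add' := fun x y => by simp [Finset.sum_add_distrib] }
  have hsurj : ∀ ℓ : Fin a → R, ℓ ≠ 0 → Function.Surjective (F ℓ) := by
    intro ℓ hℓ m
    obtain ⟨j, hj⟩ := Function.ne_iff.1 hℓ
    have hj : ℓ j ≠ 0 := hj
    refine ⟨Pi.single j (op ((ℓ j)⁻¹) • m), ?_⟩
    change ∑ i, op (ℓ i) • (Pi.single j (op ((ℓ j)⁻¹) • m) : Fin a → M) i = m
    rw [Finset.sum_eq_single j]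
    · rw [Pi.single_eq_same, ← mul_smul, ← op_mul, inv_mul_cancel₀ hj]
      simp
    · intro i _ hi
      simp [hi]
    · simp
  have hg : ∀ p : (Fin a → R) × M, ∃ x, p ∈ Λ → F p.1 x = p.2 := by
    intro p
    by_cases hp : p ∈ Λ
    · obtain ⟨x, hx⟩ := hsurj p.1 (h1 p hp) p.2
      exact ⟨x, fun _ => hx⟩
    · exact ⟨0, fun h => absurd h hp⟩
  choose g hg using hg
  obtain ⟨p, hp, hfin⟩ := AddSubgroup.exists_finiteIndex_of_leftCoset_cover
    (s := Λ) (g := g) (H := fun p => (F p.1).ker) (by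
      rw [Set.eq_univ_iff_forall]
      intro x
      obtain ⟨p, hp, hx⟩ := h2 x trivial
      refine Set.mem_biUnion hp ?_
      rw [mem_leftAddCoset_iff]
      change -g p + x ∈ (F p.1).ker
      rw [AddMonoidHom.mem_ker, map_add, map_neg, hg p hp]
      exact neg_add_eq_zero.2 hx.symm)
  refine hfin.index_ne_zero ?_
  rw [AddSubgroup.index_ker, AddMonoidHom.range_eq_top.2 (hsurj p.1 (h1 p hp))]
  simp

theorem not_thin_of_thin_compl [Infinite M] {S : Set (Fin a → M)} (h : Thin R a Sᶜ) :
    ¬ Thin R a S := fun h' => not_thin_univ (R := R) (M := M) (a := a) (by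
  simpa using h'.union h)

theorem exists_mem_of_thin_compl [Infinite M] {S : Set (Fin a → M)} (h : Thin R a Sᶜ) :
    ∃ x, x ∈ S := by
  by_contra hne
  push Not at hne
  refine not_thin_of_thin_compl h ?_
  rw [Set.eq_empty_of_forall_notMem hne]
  exact .empty

/-- A piecewise affine map is affine off a thin set. -/
theorem PiecewiseAffine.exists_generic [Infinite M] {h : (Fin a → M) → (Fin b → M)}
    (hh : PiecewiseAffine R h) : ∃ β, IsAffine R β ∧ Thin R a {y | h y ≠ β y} := by
  obtain ⟨C, h1, h2, h3⟩ := hh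
  by_contra hcon
  push Not at hcon
  refine not_thin_univ (R := R) (M := M) (a := a)
    ((Thin.biUnion h1 (S := fun p => p.1) fun p hp => ?_).mono fun x _ => ?_)
  · refine (h2 p hp).1.thin_or_thin_compl.resolve_right fun h => ?_
    exact hcon p.2 (h2 p hp).2.1 (h.mono fun y hy hy' => hy ((h2 p hp).2.2 y hy'))
  · obtain ⟨p, hp, hx⟩ := h3 x
    exact Set.mem_biUnion hp hx

/-- Affine maps are determined by their generic values. -/
theorem IsAffine.eq_of_thin [Infinite M] {α β : (Fin a → M) → (Fin b → M)} (hα : IsAffine R α)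
    (hβ : IsAffine R β) (h : Thin R a {y | α y ≠ β y}) : α = β := by
  by_contra hne
  obtain ⟨y, hy⟩ := Function.ne_iff.1 hne
  obtain ⟨k, hk⟩ := Function.ne_iff.1 hy
  have h2 := thin_zeroLocus ((hα k).sub (hβ k)) ⟨y, sub_ne_zero.2 hk⟩
  refine not_thin_of_thin_compl (S := {y | α y = β y}) h (h2.mono fun z hz => ?_)
  exact sub_eq_zero.2 (congrFun hz k)

/-- An affine map that is injective at generic points is injective: if it takes the same value at
`x` and `x'`, it is periodic with period `x - x'`. -/
theorem IsAffine.injective_of_injOn [Infinite M] {β : (Fin a → M) → (Fin b → M)}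
    (hβ : IsAffine R β) {E : Set (Fin a → M)} (hE : Thin R a Eᶜ) (hinj : Set.InjOn β E) :
    Function.Injective β := by
  intro x x' hxx
  have hper : ∀ y, β (fun i => y i + (x i - x' i)) = β y := by
    choose r c hr using hβ
    intro y
    ext k
    have := congrFun hxx k
    simp only [hr, smul_add, smul_sub, Finset.sum_add_distrib, Finset.sum_sub_distrib] at this ⊢
    rw [add_right_cancel this]
    abel
  have ht : IsAffine R fun (y : Fin a → M) i => y i + (x' i - x i) := fun i =>
    (IsAffineFunctional.coord i).add (.const _)
  obtain ⟨y, hy⟩ := exists_mem_of_thin_compl (S := E ∩ {y | (fun i => y i + (x i - x' i)) ∈ E})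
    (by
      rw [Set.compl_inter]
      refine hE.union ((hE.image ht).mono ?_)
      intro y hy
      refine ⟨_, hy, ?_⟩
      ext i
      change y i + (x i - x' i) + (x' i - x i) = y i
      abel)
  have := hinj hy.1 hy.2 (hper y).symm
  ext i
  have := congrFun this i
  exact (sub_eq_zero.1 (left_eq_add.1 this))

/-- Injective affine self-maps are bijective, with affine inverse. -/
theorem IsAffine.exists_inverse [Infinite M] {f : (Fin a → M) → (Fin a → M)} (hf : IsAffine R f)
    (hinj : Function.Injective f) : ∃ g, IsAffine R g ∧ (∀ y, g (f y) = y) ∧ ∀ y, f (g y) = y := by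
  obtain ⟨g, hg, hgf⟩ := hf.exists_leftInverse hinj
  refine ⟨g, hg, hgf, fun y => ?_⟩
  rcases hg.injective_or_thin_range with h | h
  · exact h (hgf _)
  · refine absurd (h.mono fun y _ => Set.mem_range.2 ⟨f y, hgf y⟩) (not_thin_univ (R := R) (M := M) (a := a))

theorem Thin.preimage_of_injective [Infinite M] {τ : (Fin a → M) → (Fin b → M)}
    (hτ : IsAffine R τ) (hinj : Function.Injective τ) {T : Set (Fin b → M)} (hT : Thin R d T) :
    Thin R d (τ ⁻¹' T) := by
  obtain ⟨ρ, hρ, h⟩ := hτ.exists_leftInverse hinj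
  exact (hT.image hρ).mono fun y hy => (Set.mem_image _ _ _).2 ⟨τ y, hy, h y⟩

end Thin

/-! ### Frames and flats -/

section Frames

variable {n d : ℕ}

variable (R M) in
/-- A `d`-frame in `M ^ n`: an injective affine map `M ^ d → M ^ n`. Its range is a flat of
dimension `d` with a choice of affine coordinates. -/
@[ext]
structure Frame (d n : ℕ) where
  /-- the underlying map -/
  toFun : (Fin d → M) → (Fin n → M)
  affine : IsAffine R toFun
  injective : Function.Injective toFun

namespace Frame

instance : CoeFun (Frame R M d n) fun _ => (Fin d → M) → (Fin n → M) := ⟨toFun⟩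

/-- The flat parametrized by a frame. -/
def flat (τ : Frame R M d n) : Set (Fin n → M) := Set.range τ

theorem mem_flat (τ : Frame R M d n) (y : Fin d → M) : τ y ∈ τ.flat := ⟨y, rfl⟩

theorem thin_flat (τ : Frame R M d n) : Thin R (d + 1) τ.flat :=
  .range (Nat.lt_succ_self d) τ.affine

variable [Infinite M]

/-- Affine coordinates on `M ^ n` that restrict to the inverse of the frame on its flat. -/
noncomputable def retraction (τ : Frame R M d n) : (Fin n → M) → (Fin d → M) :=
  (τ.affine.exists_leftInverse τ.injective).choose

theorem retraction_affine (τ : Frame R M d n) : IsAffine R τ.retraction :=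
  (τ.affine.exists_leftInverse τ.injective).choose_spec.1

@[simp]
theorem retraction_apply (τ : Frame R M d n) (y : Fin d → M) : τ.retraction (τ y) = y :=
  (τ.affine.exists_leftInverse τ.injective).choose_spec.2 y

theorem mem_flat_iff {τ : Frame R M d n} {x : Fin n → M} :
    x ∈ τ.flat ↔ τ (τ.retraction x) = x :=
  ⟨by rintro ⟨y, rfl⟩; simp, fun h => ⟨_, h⟩⟩

theorem constr_flat (τ : Frame R M d n) : Constr R τ.flat := by
  have : τ.flat = {x | (τ ∘ τ.retraction) x = id x} := by ext x; exact mem_flat_iff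
  rw [this]
  exact Constr.eqLocus (τ.affine.comp τ.retraction_affine) .id

/-- The image of an affine map of `M ^ d` is the flat of the `d`-frame `β` or meets it in a thin
set. In particular two flats of the same dimension are equal or meet in a thin set. -/
theorem flat_eq_or_thin {γ : (Fin d → M) → (Fin n → M)} (hγ : IsAffine R γ) (β : Frame R M d n) :
    (Set.range γ = β.flat) ∨ Thin R d (β ⁻¹' Set.range γ) := by
  have haff : IsAffine R (β.retraction ∘ γ) := β.retraction_affine.comp hγ
  rcases haff.injective_or_thin_range with hinj | hthin
  · by_cases h : β ∘ β.retraction ∘ γ = γ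
    · left
      obtain ⟨g, -, -, hg⟩ := haff.exists_inverse hinj
      refine Set.Subset.antisymm ?_ ?_
      · rintro _ ⟨y, rfl⟩
        exact ⟨_, congrFun h y⟩
      · rintro _ ⟨y, rfl⟩
        refine ⟨g y, ?_⟩
        rw [← congrFun h]
        exact congrArg β (hg y)
    · right
      have hne : ¬ Thin R d {y | (β ∘ β.retraction ∘ γ) y ≠ γ y} := fun hth =>
        h ((β.affine.comp haff).eq_of_thin hγ hth)
      have hth := (Constr.eqLocus (β.affine.comp haff) hγ).thin_or_thin_compl.resolve_right hne
      refine (hth.image haff).mono ?_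
      rintro y ⟨z, hz⟩
      have : y = β.retraction (γ z) := by rw [hz, retraction_apply]
      refine ⟨z, ?_, this.symm⟩
      change β (β.retraction (γ z)) = γ z
      rw [← this, hz]
  · right
    refine hthin.mono ?_
    rintro y ⟨z, hz⟩
    exact ⟨z, by simp [hz]⟩

theorem thin_preimage_flat {β γ : Frame R M d n} (h : β.flat ≠ γ.flat) :
    Thin R d (β ⁻¹' γ.flat) :=
  (flat_eq_or_thin γ.affine β).resolve_left fun h' => h h'.symm

end Frame

end Frames

/-! ### The action of definable automorphisms on frames and flats -/

section Action

variable [Infinite M] {n d : ℕ}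

variable (R M) in
/-- The group of affine bijections of `M ^ d`. -/
def affineGroup (d : ℕ) : Subgroup (Equiv.Perm (Fin d → M)) where
  carrier := {f | IsAffine R f}
  one_mem' := IsAffine.id
  mul_mem' := fun {f g} hf hg => IsAffine.comp (g := f) hf (f := g) hg
  inv_mem' := fun {f} hf => by
    obtain ⟨g, hg, h, -⟩ := IsAffine.exists_inverse hf f.injective
    have : (⇑f⁻¹ : (Fin d → M) → (Fin d → M)) = g := by
      ext y : 1
      rw [← h (f⁻¹ y)]
      exact congrArg g (f.apply_symm_apply y)
    change IsAffine R ⇑f⁻¹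
    rwa [this]

variable (R M) in
/-- The group of definable automorphisms of `M ^ n` for the language of right `R`-modules. -/
abbrev DefinableAut (n : ℕ) := definableAut (rightModuleLanguage R) M n

theorem piecewiseAffine_coe (f : DefinableAut R M n) : PiecewiseAffine R f.1 :=
  mem_definableAut_iff.1 f.2

namespace Frame

/-- Reparametrization of a frame by an affine bijection. -/
def comp (τ : Frame R M d n) (a : affineGroup R M d) : Frame R M d n where
  toFun := τ ∘ a.1
  affine := τ.affine.comp a.2
  injective := τ.injective.comp a.1.injective

@[simp]
theorem comp_apply (τ : Frame R M d n) (a : affineGroup R M d) (y : Fin d → M) :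
    τ.comp a y = τ (a.1 y) := rfl

theorem comp_mul (τ : Frame R M d n) (a b : affineGroup R M d) :
    τ.comp (a * b) = (τ.comp a).comp b := rfl

@[simp]
theorem comp_one (τ : Frame R M d n) : τ.comp 1 = τ := rfl

theorem comp_injective (τ : Frame R M d n) : Function.Injective τ.comp := by
  intro a b h
  ext y : 2
  exact τ.injective (congrFun (congrArg Frame.toFun h) y)

@[simp]
theorem flat_comp (τ : Frame R M d n) (a : affineGroup R M d) : (τ.comp a).flat = τ.flat :=
  a.1.surjective.range_comp τ

theorem flat_eq_iff {τ τ' : Frame R M d n} :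
    τ.flat = τ'.flat ↔ ∃ a : affineGroup R M d, τ' = τ.comp a := by
  constructor
  · intro h
    have hm : ∀ y, τ (τ.retraction (τ' y)) = τ' y := fun y =>
      mem_flat_iff.1 (h ▸ τ'.mem_flat y)
    have haff : IsAffine R (τ.retraction ∘ τ') := τ.retraction_affine.comp τ'.affine
    have hinj : Function.Injective (τ.retraction ∘ τ') := by
      intro y z hyz
      refine τ'.injective ?_
      rw [← hm y, ← hm z]
      exact congrArg τ hyz
    obtain ⟨g, -, h1, h2⟩ := haff.exists_inverse hinj
    refine ⟨⟨⟨τ.retraction ∘ τ', g, h1, h2⟩, haff⟩, ?_⟩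
    ext y : 2
    exact (hm y).symm
  · rintro ⟨a, rfl⟩
    simp

end Frame

/-- A piecewise affine map that is injective at the generic points of a flat maps it generically
onto a flat. -/
theorem exists_generic_frame {q : (Fin n → M) → (Fin n → M)} (hq : PiecewiseAffine R q)
    (τ : Frame R M d n) {E : Set (Fin d → M)} (hE : Thin R d Eᶜ) (hinj : Set.InjOn (q ∘ τ) E) :
    ∃ β : Frame R M d n, Thin R d {y | q (τ y) ≠ β y} := by
  obtain ⟨β, hβ, h⟩ := (hq.comp_affine τ.affine).exists_generic
  refine ⟨⟨β, hβ, hβ.injective_of_injOn (E := E ∩ {y | q (τ y) = β y}) ?_ ?_⟩, h⟩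
  · rw [Set.compl_inter]
    exact hE.union h
  · rintro y ⟨hy, hy'⟩ z ⟨hz, hz'⟩ hyz
    refine hinj hy hz ?_
    exact (Eq.trans hy' hyz).trans (Eq.symm hz')

theorem Frame.eq_of_thin {β γ : Frame R M d n} (q : (Fin d → M) → (Fin n → M))
    (h : Thin R d {y | q y ≠ β y}) (h' : Thin R d {y | q y ≠ γ y}) : β = γ := by
  refine Frame.ext (β.affine.eq_of_thin γ.affine ((h.union h').mono fun y hy => ?_))
  by_contra hcon
  simp only [Set.mem_union, Set.mem_ofPred_eq, not_or, not_not] at hcon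
  exact hy (hcon.1.symm.trans hcon.2)

theorem exists_smul_frame (f : DefinableAut R M n) (τ : Frame R M d n) :
    ∃ β : Frame R M d n, Thin R d {y | f.1 (τ y) ≠ β y} :=
  exists_generic_frame (piecewiseAffine_coe f) τ (E := Set.univ) (by simpa using Thin.empty)
    (f.1.injective.comp τ.injective).injOn

/-- `f • τ` is the frame that agrees with `f ∘ τ` off a thin set. -/
noncomputable instance : SMul (DefinableAut R M n) (Frame R M d n) where
  smul f τ := (exists_smul_frame f τ).choose

theorem smul_frame_spec (f : DefinableAut R M n) (τ : Frame R M d n) :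
    Thin R d {y | f.1 (τ y) ≠ (f • τ) y} :=
  (exists_smul_frame f τ).choose_spec

theorem smul_frame_eq {f : DefinableAut R M n} {τ β : Frame R M d n}
    (h : Thin R d {y | f.1 (τ y) ≠ β y}) : f • τ = β :=
  Frame.eq_of_thin _ (smul_frame_spec f τ) h

theorem smul_frame_eq_of_forall {f : DefinableAut R M n} {τ β : Frame R M d n}
    (h : ∀ y, f.1 (τ y) = β y) : f • τ = β :=
  smul_frame_eq (Thin.empty.mono fun y hy => hy (h y))

noncomputable instance : MulAction (DefinableAut R M n) (Frame R M d n) where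
  one_smul τ := smul_frame_eq_of_forall fun y => rfl
  mul_smul f g τ := by
    refine smul_frame_eq (((smul_frame_spec g τ).union (smul_frame_spec f (g • τ))).mono ?_)
    intro y hy
    by_contra hcon
    simp only [Set.mem_union, Set.mem_ofPred_eq, not_or, not_not] at hcon
    refine hy ?_
    rw [← hcon.2, ← hcon.1]
    rfl

@[simp]
theorem smul_comp (f : DefinableAut R M n) (τ : Frame R M d n) (a : affineGroup R M d) :
    f • τ.comp a = (f • τ).comp a := by
  refine smul_frame_eq (((smul_frame_spec f τ).image (a⁻¹).2).mono ?_)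
  intro y hy
  exact ⟨a.1 y, hy, by simp⟩

variable (R M) in
/-- The flats of dimension `d` in `M ^ n`. -/
def Flat (d n : ℕ) := {P : Set (Fin n → M) // ∃ τ : Frame R M d n, τ.flat = P}

/-- The flat parametrized by a frame, as an element of the type of flats. -/
def Frame.toFlat (τ : Frame R M d n) : Flat R M d n := ⟨τ.flat, τ, rfl⟩

theorem Frame.toFlat_eq_iff {τ τ' : Frame R M d n} : τ.toFlat = τ'.toFlat ↔ τ.flat = τ'.flat :=
  Subtype.ext_iff

/-- A chosen frame of a flat. -/
noncomputable def Flat.frame (P : Flat R M d n) : Frame R M d n := P.2.choose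

@[simp]
theorem Flat.toFlat_frame (P : Flat R M d n) : P.frame.toFlat = P :=
  Subtype.ext P.2.choose_spec

noncomputable instance : SMul (DefinableAut R M n) (Flat R M d n) where
  smul f P := (f • P.frame).toFlat

theorem smul_toFlat (f : DefinableAut R M n) (τ : Frame R M d n) :
    f • τ.toFlat = (f • τ).toFlat := by
  obtain ⟨a, ha⟩ := Frame.flat_eq_iff.1 (Frame.toFlat_eq_iff.1 τ.toFlat.toFlat_frame.symm)
  change (f • τ.toFlat.frame).toFlat = _
  rw [ha, smul_comp, Frame.toFlat_eq_iff, Frame.flat_comp]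

noncomputable instance : MulAction (DefinableAut R M n) (Flat R M d n) where
  one_smul P := by rw [← P.toFlat_frame, smul_toFlat, one_smul]
  mul_smul f g P := by rw [← P.toFlat_frame]; simp only [smul_toFlat, mul_smul]

/-- The flats on which `f` is not generically the identity. -/
def movedFlats (d : ℕ) (f : DefinableAut R M n) : Set (Flat R M d n) := {P | f • P.frame ≠ P.frame}

theorem toFlat_mem_movedFlats {f : DefinableAut R M n} {τ : Frame R M d n} :
    τ.toFlat ∈ movedFlats d f ↔ f • τ ≠ τ := by
  obtain ⟨a, ha⟩ := Frame.flat_eq_iff.1 (Frame.toFlat_eq_iff.1 τ.toFlat.toFlat_frame.symm)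
  change f • τ.toFlat.frame ≠ τ.toFlat.frame ↔ _
  rw [ha, smul_comp, not_iff_not]
  constructor
  · intro h
    have := congrArg (fun σ => Frame.comp σ a⁻¹) h
    simpa [← Frame.comp_mul] using this
  · intro h
    rw [h]

theorem movedFlats_conj (g f : DefinableAut R M n) (P : Flat R M d n) :
    g • P ∈ movedFlats d (g * f * g⁻¹) ↔ P ∈ movedFlats d f := by
  rw [← P.toFlat_frame, smul_toFlat, toFlat_mem_movedFlats, toFlat_mem_movedFlats, not_iff_not]
  rw [mul_smul, inv_smul_smul, mul_smul]
  exact smul_left_cancel_iff g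

/-- A set of dimension at most `d` contains the generic points of only finitely many `d`-flats. -/
theorem finite_thick_flats {T : Set (Fin n → M)} (hT : Thin R (d + 1) T) :
    {P : Flat R M d n | ¬ Thin R d (P.frame ⁻¹' T)}.Finite := by
  induction hT with
  | empty => simp [Thin.empty]
  | @range e he τ hτ =>
    rcases Nat.lt_succ_iff_lt_or_eq.1 he with he | rfl
    · refine Set.finite_empty.subset fun P hP => hP ?_
      exact (Thin.range he hτ).preimage_of_injective P.frame.affine P.frame.injective
    · refine Set.Subsingleton.finite fun P hP Q hQ => ?_
      have h1 := (Frame.flat_eq_or_thin hτ P.frame).resolve_right hP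
      have h2 := (Frame.flat_eq_or_thin hτ Q.frame).resolve_right hQ
      rw [← P.toFlat_frame, ← Q.toFlat_frame, Frame.toFlat_eq_iff, ← h1, ← h2]
  | union _ _ h1 h2 =>
    refine (h1.union h2).subset fun P hP => ?_
    by_contra hcon
    simp only [Set.mem_union, Set.mem_ofPred_eq, not_or, not_not] at hcon
    exact hP (hcon.1.union hcon.2)
  | mono h _ ih => exact ih.subset fun P hP hP' => hP (hP'.mono (Set.preimage_mono h))

/-- A set of dimension at most `d` that contains the generic points of no `d`-flat has smaller
dimension. -/
theorem thin_of_forall_frame {D : Set (Fin n → M)} (hD : Thin R (d + 1) D)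
    (h : ∀ τ : Frame R M d n, Thin R d (τ ⁻¹' D)) : Thin R d D := by
  suffices key : ∀ T, Thin R (d + 1) T → ∀ D ⊆ T, (∀ τ : Frame R M d n, Thin R d (τ ⁻¹' D)) →
    Thin R d D from key D hD D le_rfl h
  clear h hD D
  intro T hT
  induction hT with
  | empty => exact fun D hD _ => Thin.empty.mono hD
  | @range e he τ hτ =>
    intro D hD h
    rcases Nat.lt_succ_iff_lt_or_eq.1 he with he | rfl
    · exact (Thin.range he hτ).mono hD
    · rcases hτ.injective_or_thin_range with hinj | hth
      · refine ((h ⟨τ, hτ, hinj⟩).image hτ).mono fun x hx => ?_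
        obtain ⟨y, rfl⟩ := hD hx
        exact ⟨y, hx, rfl⟩
      · exact hth.mono hD
  | @union S T _ _ h1 h2 =>
    intro D hD h
    refine ((h1 (D ∩ S) Set.inter_subset_right fun τ => (h τ).mono ?_).union
      (h2 (D ∩ T) Set.inter_subset_right fun τ => (h τ).mono ?_)).mono ?_
    · exact Set.preimage_mono Set.inter_subset_left
    · exact Set.preimage_mono Set.inter_subset_left
    · rw [← Set.inter_union_distrib_left]
      exact Set.subset_inter le_rfl hD
  | mono hST _ ih => exact fun D hD h => ih D (hD.trans hST) h

variable (R M n) in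
/-- The subgroup of definable automorphisms whose support has dimension less than `d`. -/
def thinSupport (d : ℕ) : Subgroup (DefinableAut R M n) where
  carrier := {f | Thin R d {x | f.1 x ≠ x}}
  one_mem' := Thin.empty.mono fun x hx => hx rfl
  mul_mem' := fun {f g} hf hg => by
    refine (hf.union hg).mono fun x hx => ?_
    by_contra hcon
    simp only [Set.mem_union, Set.mem_ofPred_eq, not_or, not_not] at hcon
    refine hx ?_
    change f.1 (g.1 x) = x
    rw [hcon.2, hcon.1]
  inv_mem' := fun {f} hf => by
    refine Thin.mono (fun x hx => ?_) hf
    intro h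
    refine hx ?_
    change f.1⁻¹ x = x
    rw [Equiv.Perm.inv_eq_iff_eq, h]

theorem mem_thinSupport {f : DefinableAut R M n} :
    f ∈ thinSupport R M n d ↔ Thin R d {x | f.1 x ≠ x} := Iff.rfl

instance : (thinSupport R M n d).Normal where
  conj_mem f hf g := by
    refine (Thin.image_piecewiseAffine hf (piecewiseAffine_coe g)).mono fun x hx => ?_
    refine ⟨g.1⁻¹ x, fun h => hx ?_, by simp⟩
    change g.1 (f.1 (g.1⁻¹ x)) = x
    rw [h]
    simp

theorem thinSupport_zero : thinSupport R M n 0 = ⊥ := by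
  rw [eq_bot_iff]
  intro f hf
  rw [mem_thinSupport, thin_zero, Set.eq_empty_iff_forall_notMem] at hf
  rw [Subgroup.mem_bot]
  ext x : 2
  exact not_not.1 (hf x)

theorem thinSupport_eq_top (h : n < d) : thinSupport R M n d = ⊤ :=
  eq_top_iff.2 fun _ _ => thin_of_lt h _

theorem thinSupport_mono {d e : ℕ} (h : d ≤ e) : thinSupport R M n d ≤ thinSupport R M n e :=
  fun _ hf => Thin.of_le h hf

theorem smul_frame_of_mem_thinSupport {f : DefinableAut R M n} (hf : f ∈ thinSupport R M n d)
    (τ : Frame R M d n) : f • τ = τ :=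
  smul_frame_eq (Thin.preimage_of_injective τ.affine τ.injective hf)

theorem mem_thinSupport_of_smul_eq {f : DefinableAut R M n}
    (hf : f ∈ thinSupport R M n (d + 1)) (h : ∀ τ : Frame R M d n, f • τ = τ) :
    f ∈ thinSupport R M n d := by
  refine thin_of_forall_frame hf fun τ => ?_
  have := smul_frame_spec f τ
  rwa [h τ] at this

theorem finite_movedFlats {f : DefinableAut R M n} (hf : f ∈ thinSupport R M n (d + 1)) :
    (movedFlats d f).Finite :=
  (finite_thick_flats hf).subset fun _ hP hP' => hP (smul_frame_eq hP')

/-! ### Elementary automorphisms -/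

/-- The automorphism acting on the flat of `τ` as `a` does in the coordinates `τ`, and trivially
elsewhere. -/
noncomputable def supportedOn (τ : Frame R M d n) : affineGroup R M d →* DefinableAut R M n :=
  ((Equiv.Perm.viaEmbeddingHom ⟨τ, τ.injective⟩).comp (affineGroup R M d).subtype).codRestrict _
    fun a => by
      classical
      rw [mem_definableAut_iff]
      have : PiecewiseAffine R fun x => if x ∈ τ.flat then τ (a.1 (τ.retraction x)) else x :=
        (((τ.comp a).affine.comp τ.retraction_affine).piecewiseAffine).ite
          IsAffine.id.piecewiseAffine τ.constr_flat
      convert this using 2 with x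
      split_ifs with hx
      · obtain ⟨y, rfl⟩ := hx
        rw [τ.retraction_apply]
        exact Equiv.Perm.viaEmbedding_apply a.1 ⟨τ, τ.injective⟩ y
      · exact Equiv.Perm.viaEmbedding_apply_of_notMem a.1 ⟨τ, τ.injective⟩ x hx

theorem supportedOn_apply (τ : Frame R M d n) (a : affineGroup R M d) (y : Fin d → M) :
    (supportedOn τ a).1 (τ y) = τ (a.1 y) :=
  Equiv.Perm.viaEmbedding_apply a.1 ⟨τ, τ.injective⟩ y

theorem supportedOn_apply_of_notMem (τ : Frame R M d n) (a : affineGroup R M d) {x : Fin n → M}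
    (hx : x ∉ τ.flat) : (supportedOn τ a).1 x = x :=
  Equiv.Perm.viaEmbedding_apply_of_notMem a.1 ⟨τ, τ.injective⟩ x hx

theorem supportedOn_mem (τ : Frame R M d n) (a : affineGroup R M d) :
    supportedOn τ a ∈ thinSupport R M n (d + 1) :=
  τ.thin_flat.mono fun _ hx => not_not.1 fun h => hx (supportedOn_apply_of_notMem τ a h)

theorem supportedOn_smul (τ : Frame R M d n) (a : affineGroup R M d) :
    supportedOn τ a • τ = τ.comp a :=
  smul_frame_eq_of_forall fun y => supportedOn_apply τ a y

theorem supportedOn_smul_of_ne {τ σ : Frame R M d n} (a : affineGroup R M d)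
    (h : σ.flat ≠ τ.flat) : supportedOn τ a • σ = σ :=
  smul_frame_eq ((Frame.thin_preimage_flat h).mono fun _ hy =>
    not_not.1 fun hy' => hy (supportedOn_apply_of_notMem τ a hy'))

/-- The part of the flat of `β` that `swap β γ` moves. -/
def swapDomain (β γ : Frame R M d n) : Set (Fin n → M) :=
  β.flat ∩ γ.flatᶜ ∩ (γ ∘ β.retraction) ⁻¹' β.flatᶜ

open Classical in
/-- The map underlying `swap β γ`. -/
noncomputable def swapFun (β γ : Frame R M d n) (x : Fin n → M) : Fin n → M :=
  if x ∈ swapDomain β γ then (γ ∘ β.retraction) x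
  else if x ∈ swapDomain γ β then (β ∘ γ.retraction) x else x

theorem swapDomain_apply {β γ : Frame R M d n} {x : Fin n → M} (hx : x ∈ swapDomain β γ) :
    γ (β.retraction x) ∈ swapDomain γ β ∧ γ (β.retraction x) ∉ swapDomain β γ ∧
      β (γ.retraction (γ (β.retraction x))) = x := by
  obtain ⟨⟨h1, h2⟩, h3⟩ := hx
  have hx : β (γ.retraction (γ (β.retraction x))) = x := by
    rw [γ.retraction_apply, Frame.mem_flat_iff.1 h1]
  refine ⟨⟨⟨γ.mem_flat _, h3⟩, ?_⟩, fun h => h3 h.1.1, hx⟩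
  change β (γ.retraction _) ∉ _
  rwa [hx]

theorem swapFun_involutive (β γ : Frame R M d n) : Function.Involutive (swapFun β γ) := by
  intro x
  by_cases h : x ∈ swapDomain β γ
  · obtain ⟨h1, h2, h3⟩ := swapDomain_apply h
    rw [swapFun, swapFun, if_pos h, Function.comp_apply, if_neg h2, if_pos h1]
    exact h3
  · by_cases h' : x ∈ swapDomain γ β
    · obtain ⟨h1, h2, h3⟩ := swapDomain_apply h'
      rw [swapFun, swapFun, if_neg h, if_pos h', Function.comp_apply, if_pos h1]
      exact h3
    · rw [swapFun, swapFun, if_neg h, if_neg h', if_neg h, if_neg h']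

theorem constr_swapDomain (β γ : Frame R M d n) : Constr R (swapDomain β γ) :=
  (β.constr_flat.inter γ.constr_flat.compl).inter
    (β.constr_flat.compl.preimage (γ.affine.comp β.retraction_affine))

/-- The involution interchanging the flats of `β` and `γ` along their coordinates, generically; a
point of one flat is moved unless it or its partner lies on both flats. -/
noncomputable def swap (β γ : Frame R M d n) : DefinableAut R M n :=
  ⟨(swapFun_involutive β γ).toPerm, by
    classical
    rw [mem_definableAut_iff]
    have := (γ.affine.comp β.retraction_affine).piecewiseAffine.ite
      ((β.affine.comp γ.retraction_affine).piecewiseAffine.ite IsAffine.id.piecewiseAffine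
        (constr_swapDomain γ β)) (constr_swapDomain β γ)
    exact this⟩

theorem swap_mul_self (β γ : Frame R M d n) : swap β γ * swap β γ = 1 := by
  ext x : 2
  exact swapFun_involutive β γ x

theorem swap_apply_of_notMem (β γ : Frame R M d n) {x : Fin n → M} (h : x ∉ β.flat)
    (h' : x ∉ γ.flat) : (swap β γ).1 x = x := by
  change swapFun β γ x = x
  rw [swapFun, if_neg fun hx => h hx.1.1, if_neg fun hx => h' hx.1.1]

theorem swap_mem (β γ : Frame R M d n) : swap β γ ∈ thinSupport R M n (d + 1) := by
  refine (β.thin_flat.union γ.thin_flat).mono fun x hx => ?_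
  by_contra hcon
  simp only [Set.mem_union, not_or] at hcon
  exact hx (swap_apply_of_notMem β γ hcon.1 hcon.2)

theorem swap_smul_left {β γ : Frame R M d n} (h : β.flat ≠ γ.flat) : swap β γ • β = γ := by
  refine smul_frame_eq (((Frame.thin_preimage_flat h).union
    (Frame.thin_preimage_flat h.symm)).mono fun y hy => ?_)
  by_contra hcon
  simp only [Set.mem_union, Set.mem_preimage, not_or] at hcon
  refine hy ?_
  change swapFun β γ (β y) = γ y
  rw [swapFun, if_pos, Function.comp_apply, β.retraction_apply]
  exact ⟨⟨β.mem_flat y, hcon.1⟩, by simpa using hcon.2⟩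

theorem swap_smul_right {β γ : Frame R M d n} (h : β.flat ≠ γ.flat) : swap β γ • γ = β := by
  have := congrArg (swap β γ • ·) (swap_smul_left h)
  simpa only [← mul_smul, swap_mul_self, one_smul] using this.symm

theorem swap_smul_of_ne {β γ τ : Frame R M d n} (h : τ.flat ≠ β.flat) (h' : τ.flat ≠ γ.flat) :
    swap β γ • τ = τ := by
  refine smul_frame_eq (((Frame.thin_preimage_flat h).union
    (Frame.thin_preimage_flat h')).mono fun y hy => ?_)
  by_contra hcon
  simp only [Set.mem_union, Set.mem_preimage, not_or] at hcon
  exact hy (swap_apply_of_notMem β γ hcon.1 hcon.2)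

/-- Any frame is carried to any other one of the same dimension by an automorphism that fixes the frames of
all other flats. -/
theorem exists_smul_eq (β γ : Frame R M d n) : ∃ u ∈ thinSupport R M n (d + 1), u • β = γ ∧
    ∀ τ : Frame R M d n, τ.flat ≠ β.flat → τ.flat ≠ γ.flat → u • τ = τ := by
  by_cases h : β.flat = γ.flat
  · obtain ⟨a, rfl⟩ := Frame.flat_eq_iff.1 h
    exact ⟨supportedOn β a, supportedOn_mem β a, supportedOn_smul β a,
      fun τ hτ _ => supportedOn_smul_of_ne a hτ⟩
  · exact ⟨swap β γ, swap_mem β γ, swap_smul_left h, fun τ => swap_smul_of_ne⟩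

/-! ### Extension of definable injections -/

/-- A definable automorphism that agrees with a piecewise affine injection `q : Y → M ^ n` off a
thin set can be corrected by an automorphism of thin support so as to agree with `q` on all of
`Y`. The discrepancy is removed one flat of top dimension at a time, and then by induction on the
dimension. -/
theorem exists_thinSupport_mul_eqOn {Y : Set (Fin n → M)} (hY : Constr R Y)
    {q : (Fin n → M) → (Fin n → M)} (hq : PiecewiseAffine R q) (hinj : Set.InjOn q Y) :
    ∀ (d : ℕ) (g : DefinableAut R M n), Thin R d {x | x ∈ Y ∧ g.1 x ≠ q x} →
      ∃ u ∈ thinSupport R M n d, ∀ x ∈ Y, (u * g).1 x = q x := by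
  intro d
  induction d with
  | zero =>
    intro g hg
    rw [thin_zero, Set.eq_empty_iff_forall_notMem] at hg
    exact ⟨1, one_mem _, fun x hx => by
      by_contra h
      exact hg x ⟨hx, h⟩⟩
  | succ d ih =>
    intro g
    -- the flats on which `g` differs generically from `q`
    generalize hN : {P : Flat R M d n |
      ¬ Thin R d (P.frame ⁻¹' {x | x ∈ Y ∧ g.1 x ≠ q x})}.ncard = N
    -- correcting `g` on one of these flats decreases their number
    induction N using Nat.strong_induction_on generalizing g with
    | _ N ihN =>
    intro hg
    have hfin := finite_thick_flats (d := d) hg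
    by_cases hne : ∃ τ : Frame R M d n, ¬ Thin R d (τ ⁻¹' {x | x ∈ Y ∧ g.1 x ≠ q x})
    swap
    · push Not at hne
      obtain ⟨u, hu, h⟩ := ih g (thin_of_forall_frame hg hne)
      exact ⟨u, thinSupport_mono (Nat.le_succ d) hu, h⟩
    have htransfer : ∀ (T : Set (Fin n → M)) (τ τ' : Frame R M d n), τ.flat = τ'.flat →
        Thin R d (τ ⁻¹' T) → Thin R d (τ' ⁻¹' T) := by
      intro T τ τ' h hT
      obtain ⟨a, rfl⟩ := Frame.flat_eq_iff.1 h
      exact (hT.image (a⁻¹).2).mono fun y hy =>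
        (Set.mem_image _ _ _).2 ⟨a.1 y, hy, by simp⟩
    -- a frame with generic points in `Y` has a generic image under `q`
    have hqframe : ∀ τ : Frame R M d n, ¬ Thin R d (τ ⁻¹' {x | x ∈ Y ∧ g.1 x ≠ q x}) →
        Thin R d (τ ⁻¹' Y)ᶜ ∧ ∃ γ : Frame R M d n, Thin R d {y | q (τ y) ≠ γ y} := by
      intro τ hτ
      have h1 : Thin R d (τ ⁻¹' Y)ᶜ := (hY.preimage τ.affine).thin_or_thin_compl.resolve_left
        fun h => hτ (h.mono fun y hy => hy.1)
      refine ⟨h1, exists_generic_frame hq τ h1 ?_⟩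
      intro y hy z hz hyz
      exact τ.injective (hinj hy hz hyz)
    obtain ⟨τ, hτ⟩ := hne
    obtain ⟨hτY, γ, hγ⟩ := hqframe τ hτ
    obtain ⟨u, hu, huγ, hufix⟩ := exists_smul_eq (g • τ) γ
    have hug : ∀ σ : Frame R M d n, (u * g) • σ = u • g • σ := fun σ => mul_smul _ _ _
    have hsub : {P : Flat R M d n |
        ¬ Thin R d (P.frame ⁻¹' {x | x ∈ Y ∧ (u * g).1 x ≠ q x})} ⊂
        {P : Flat R M d n | ¬ Thin R d (P.frame ⁻¹' {x | x ∈ Y ∧ g.1 x ≠ q x})} := by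
      have hτgood : Thin R d (τ ⁻¹' {x | x ∈ Y ∧ (u * g).1 x ≠ q x}) := by
        refine (hγ.union (smul_frame_spec (u * g) τ)).mono fun y hy => ?_
        by_contra hcon
        simp only [Set.mem_union, Set.mem_ofPred_eq, not_or, not_not] at hcon
        exact hy.2 (by rw [hcon.1, hcon.2, hug, huγ])
      refine ⟨fun P hP => ?_, fun h => ?_⟩
      · -- a flat that is good for `g` stays good
        intro hgood
        refine hP ?_
        by_cases hPτ : τ.flat = P.frame.flat
        · exact htransfer _ _ _ hPτ hτgood
        by_cases hPY : Thin R d (P.frame ⁻¹' Y)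
        · exact hPY.mono fun y hy => hy.1
        have hPY' := (hY.preimage P.frame.affine).thin_or_thin_compl.resolve_left hPY
        -- on `P` the map `q` is generically `g • P`
        have hqP : Thin R d {y | q (P.frame y) ≠ (g • P.frame) y} := by
          refine ((hgood.union hPY').union (smul_frame_spec g P.frame)).mono fun y hy => ?_
          by_contra hcon
          simp only [Set.mem_union, Set.mem_preimage, Set.mem_compl_iff, Set.mem_ofPred_eq,
            not_or, not_not, not_and] at hcon
          exact hy ((hcon.1.1 hcon.1.2).symm.trans hcon.2)
        have hfix : u • g • P.frame = g • P.frame := by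
          refine hufix _ ?_ ?_
          · intro h
            have h' : g • P.frame.toFlat = g • τ.toFlat := by
              rw [smul_toFlat, smul_toFlat, Frame.toFlat_eq_iff, h]
            exact hPτ (Frame.toFlat_eq_iff.1 (smul_left_cancel g h')).symm
          · -- otherwise `q` would take the same values on two flats
            intro h
            obtain ⟨a, ha⟩ := Frame.flat_eq_iff.1 h
            obtain ⟨y, hy⟩ := exists_mem_of_thin_compl (R := R) (S :=
              (τ ⁻¹' Y ∩ {y | q (τ y) = γ y}) ∩ {y | τ y ∉ P.frame.flat} ∩
              (fun y => a.1 y) ⁻¹' (P.frame ⁻¹' Y ∩ {y | q (P.frame y) = (g • P.frame) y}))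
              (by
                simp only [Set.compl_inter]
                refine ((hτY.union hγ).union ((Frame.thin_preimage_flat hPτ).mono
                  fun y hy => not_not.1 hy)).union ?_
                refine ((hPY'.union hqP).image (a⁻¹).2).mono fun y hy =>
                  (Set.mem_image _ _ _).2 ⟨a.1 y, ?_, by simp⟩
                rw [Set.mem_compl_iff, Set.mem_preimage, Set.mem_inter_iff, not_and_or] at hy
                exact hy)
            obtain ⟨⟨⟨h1, h2⟩, h3⟩, h4, h5⟩ := hy
            refine h3 ?_
            have h5 : q (P.frame (a.1 y)) = (g • P.frame) (a.1 y) := h5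
            have h2 : q (τ y) = γ y := h2
            rw [← Frame.comp_apply (g • P.frame), ← ha, ← h2] at h5
            rw [← hinj h4 h1 h5]
            exact P.frame.mem_flat _
        refine (hgood.union (((smul_frame_spec g P.frame).union
          (smul_frame_spec (u * g) P.frame)))).mono fun y hy => ?_
        by_contra hcon
        simp only [Set.mem_union, Set.mem_preimage, Set.mem_ofPred_eq, not_or, not_not,
          not_and] at hcon
        refine hy.2 ?_
        rw [hcon.2.2, hug, hfix, ← hcon.2.1]
        exact hcon.1 hy.1
      · have h1 : τ.toFlat ∈ {P : Flat R M d n |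
            ¬ Thin R d (P.frame ⁻¹' {x | x ∈ Y ∧ g.1 x ≠ q x})} := fun h' =>
          hτ (htransfer _ _ _ (Frame.toFlat_eq_iff.1 τ.toFlat.toFlat_frame) h')
        exact h h1 (htransfer _ _ _ (Frame.toFlat_eq_iff.1 τ.toFlat.toFlat_frame).symm hτgood)
    -- `u` spoils the agreement with `q` only on a set of dimension at most `d`
    have hthin : Thin R (d + 1) {x | x ∈ Y ∧ (u * g).1 x ≠ q x} := by
      refine (hg.union (Thin.image_piecewiseAffine hu (piecewiseAffine_coe g⁻¹))).mono fun x hx => ?_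
      by_cases h : g.1 x = q x
      · right
        refine ⟨g.1 x, fun h' => hx.2 ?_, ?_⟩
        · change u.1 (g.1 x) = q x
          rw [h', h]
        · change g.1⁻¹ (g.1 x) = x
          simp
      · exact .inl ⟨hx.1, h⟩
    obtain ⟨w, hw, h⟩ := ihN _ (hN ▸ Set.ncard_lt_ncard hsub hfin) (u * g) rfl hthin
    exact ⟨w * u, mul_mem hw hu, fun x hx => by rw [mul_assoc]; exact h x hx⟩

end Action

/-! ### Straightening on disjoint flats -/

section Tidy

variable [Infinite M] {n d : ℕ}

/-- The piecewise affine map that agrees on each flat of a disjoint family with the frames obtained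
from the action of `w`, and is the identity elsewhere. -/
theorem exists_straightening {𝓕 : Set (Flat R M d n)} (hfin : 𝓕.Finite)
    (hdisj : 𝓕.Pairwise fun P Q => Disjoint P.1 Q.1) (w : DefinableAut R M n) :
    ∃ q : (Fin n → M) → (Fin n → M), PiecewiseAffine R q ∧
      (∀ τ : Frame R M d n, τ.toFlat ∈ 𝓕 → ∀ y, q (τ y) = (w • τ) y) ∧
      ∀ x, (∀ P ∈ 𝓕, x ∉ P.1) → q x = x := by
  classical
  let q : (Fin n → M) → (Fin n → M) := fun x =>
    if h : ∃ P ∈ 𝓕, x ∈ P.1 then (w • h.choose.frame) (h.choose.frame.retraction x) else x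
  have hq : ∀ P ∈ 𝓕, ∀ x ∈ P.1, q x = (w • P.frame) (P.frame.retraction x) := by
    intro P hP x hx
    have h : ∃ P ∈ 𝓕, x ∈ P.1 := ⟨P, hP, hx⟩
    have hPe : h.choose = P := by
      by_contra hne
      exact Set.disjoint_left.1 (hdisj h.choose_spec.1 hP hne) h.choose_spec.2 hx
    simp only [q, dif_pos h]
    rw [hPe]
  have hq' : ∀ x, (∀ P ∈ 𝓕, x ∉ P.1) → q x = x := by
    intro x hx
    have h : ¬ ∃ P ∈ 𝓕, x ∈ P.1 := by push Not; exact hx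
    simp only [q, dif_neg h]
  have hflat : ∀ P : Flat R M d n, Constr R P.1 := by
    intro P
    have := P.frame.constr_flat
    rwa [show P.frame.flat = P.1 from P.2.choose_spec] at this
  refine ⟨q, ⟨insert ((⋃ P ∈ 𝓕, P.1)ᶜ, id) ((fun P : Flat R M d n =>
    (P.1, (w • P.frame) ∘ P.frame.retraction)) '' 𝓕), (hfin.image _).insert _, ?_, ?_⟩, ?_, hq'⟩
  · rintro p (rfl | ⟨P, hP, rfl⟩)
    · refine ⟨(Constr.biUnion hfin fun P _ => hflat P).compl, IsAffine.id, fun x hx => hq' x ?_⟩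
      simpa using hx
    · exact ⟨hflat P, (w • P.frame).affine.comp P.frame.retraction_affine, hq P hP⟩
  · intro x
    by_cases h : ∃ P ∈ 𝓕, x ∈ P.1
    · obtain ⟨P, hP, hx⟩ := h
      exact ⟨_, .inr ⟨P, hP, rfl⟩, hx⟩
    · exact ⟨_, .inl rfl, by simpa using h⟩
  · intro τ hτ y
    obtain ⟨a, ha⟩ := Frame.flat_eq_iff.1 (Frame.toFlat_eq_iff.1 τ.toFlat.toFlat_frame)
    rw [hq _ hτ _ (τ.mem_flat y)]
    generalize τ.toFlat.frame = σ at ha ⊢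
    subst ha
    rw [smul_comp, Frame.comp_apply, Frame.comp_apply, Frame.retraction_apply]

theorem injOn_straightening {𝓕 : Set (Flat R M d n)} {w : DefinableAut R M n}
    (hdisj : ((w • ·) '' 𝓕).Pairwise fun P Q => Disjoint P.1 Q.1)
    {q : (Fin n → M) → (Fin n → M)}
    (hq : ∀ τ : Frame R M d n, τ.toFlat ∈ 𝓕 → ∀ y, q (τ y) = (w • τ) y) :
    Set.InjOn q (⋃ P ∈ 𝓕, P.1) := by
  intro x hx x' hx' hxx
  simp only [Set.mem_iUnion, exists_prop] at hx hx'
  obtain ⟨P, hP, hx⟩ := hx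
  obtain ⟨P', hP', hx'⟩ := hx'
  obtain ⟨τ, rfl⟩ : ∃ τ : Frame R M d n, τ.toFlat = P := ⟨_, P.toFlat_frame⟩
  obtain ⟨τ', rfl⟩ : ∃ τ : Frame R M d n, τ.toFlat = P' := ⟨_, P'.toFlat_frame⟩
  obtain ⟨y, rfl⟩ := hx
  obtain ⟨y', rfl⟩ := hx'
  rw [hq τ hP, hq τ' hP'] at hxx
  by_cases h : τ.toFlat = τ'.toFlat
  · obtain ⟨a, rfl⟩ := Frame.flat_eq_iff.1 (Frame.toFlat_eq_iff.1 h)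
    rw [smul_comp, Frame.comp_apply] at hxx
    rw [Frame.comp_apply, (w • τ).injective hxx]
  · refine absurd hxx ?_
    have := hdisj ⟨_, hP, rfl⟩ ⟨_, hP', rfl⟩ fun h' => h (smul_left_cancel w h')
    simp only [smul_toFlat] at this
    exact fun he => Set.disjoint_left.1 this ((w • τ).mem_flat y) (he ▸ (w • τ').mem_flat y')

/-- If `w` maps a disjoint family of `d`-flats to a disjoint family, then up to an automorphism with
support of dimension less than `d` it is affine on each of these flats. -/
theorem exists_thinSupport_mul_affine {𝓕 : Set (Flat R M d n)} (hfin : 𝓕.Finite)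
    (w : DefinableAut R M n) (hdisj : 𝓕.Pairwise fun P Q => Disjoint P.1 Q.1)
    (hdisj' : ((w • ·) '' 𝓕).Pairwise fun P Q => Disjoint P.1 Q.1) :
    ∃ u ∈ thinSupport R M n d, ∀ τ : Frame R M d n, τ.toFlat ∈ 𝓕 → ∀ y,
      (u * w).1 (τ y) = (w • τ) y := by
  obtain ⟨q, hq, hqτ, -⟩ := exists_straightening hfin hdisj w
  have hY : Constr R (⋃ P ∈ 𝓕, P.1) := Constr.biUnion hfin fun P _ => by
    have := P.frame.constr_flat
    rwa [show P.frame.flat = P.1 from P.2.choose_spec] at this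
  obtain ⟨u, hu, h⟩ := exists_thinSupport_mul_eqOn hY hq (injOn_straightening hdisj' hqτ) d w (by
    refine (Thin.biUnion hfin (S := fun P => P.frame '' {y | w.1 (P.frame y) ≠ (w • P.frame) y})
      fun P _ => (smul_frame_spec w P.frame).image P.frame.affine).mono ?_
    rintro x ⟨hx, hne⟩
    simp only [Set.mem_iUnion, exists_prop] at hx
    obtain ⟨P, hP, hx⟩ := hx
    rw [← show P.frame.flat = P.1 from P.2.choose_spec] at hx
    obtain ⟨y, rfl⟩ := hx
    refine Set.mem_biUnion hP ⟨y, ?_, rfl⟩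
    rwa [hqτ _ (by rwa [Flat.toFlat_frame])] at hne)
  refine ⟨u, hu, fun τ hτ y => ?_⟩
  rw [← hqτ τ hτ y]
  exact h _ (Set.mem_biUnion hτ (τ.mem_flat y))

/-- A definable automorphism is tidy for a finite family of disjoint flats if it is the identity off
these flats and permutes them affinely. -/
structure Tidy (𝓕 : Set (Flat R M d n)) (h : DefinableAut R M n) : Prop where
  finite : 𝓕.Finite
  disjoint : 𝓕.Pairwise fun P Q => Disjoint P.1 Q.1
  apply_of_notMem : ∀ x, (∀ P ∈ 𝓕, x ∉ P.1) → h.1 x = x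
  apply_frame : ∀ τ : Frame R M d n, τ.toFlat ∈ 𝓕 →
    (h • τ).toFlat ∈ 𝓕 ∧ ∀ y, h.1 (τ y) = (h • τ) y

theorem Tidy.mul {𝓕 : Set (Flat R M d n)} {h k : DefinableAut R M n} (hh : Tidy 𝓕 h)
    (hk : Tidy 𝓕 k) : Tidy 𝓕 (h * k) where
  finite := hh.finite
  disjoint := hh.disjoint
  apply_of_notMem x hx := by
    change h.1 (k.1 x) = x
    rw [hk.apply_of_notMem x hx, hh.apply_of_notMem x hx]
  apply_frame τ hτ := by
    obtain ⟨h1, h2⟩ := hk.apply_frame τ hτ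
    obtain ⟨h3, h4⟩ := hh.apply_frame _ h1
    rw [mul_smul]
    refine ⟨h3, fun y => ?_⟩
    change h.1 (k.1 (τ y)) = _
    rw [h2, h4]

theorem thin_preimage_biUnion_flats {𝓕 : Set (Flat R M d n)} (hfin : 𝓕.Finite)
    {τ : Frame R M d n} (hτ : τ.toFlat ∉ 𝓕) : Thin R d (τ ⁻¹' ⋃ P ∈ 𝓕, P.1) := by
  rw [Set.preimage_iUnion₂]
  refine Thin.biUnion hfin fun P hP => ?_
  rw [← show P.frame.flat = P.1 from P.2.choose_spec]
  refine Frame.thin_preimage_flat fun h => hτ ?_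
  rwa [Frame.toFlat_eq_iff.2 h, Flat.toFlat_frame]

theorem Tidy.movedFlats_subset {𝓕 : Set (Flat R M d n)} {h : DefinableAut R M n}
    (hh : Tidy 𝓕 h) : movedFlats d h ⊆ 𝓕 := by
  intro P hP
  by_contra hP'
  refine hP (smul_frame_eq ((thin_preimage_biUnion_flats (τ := P.frame) hh.finite
    (by rwa [Flat.toFlat_frame])).mono fun y hy => ?_))
  by_contra hcon
  refine hy (hh.apply_of_notMem _ fun Q hQ hyQ => hcon (Set.mem_biUnion hQ hyQ))

theorem Tidy.movedFlats {𝓕 : Set (Flat R M d n)} {h : DefinableAut R M n} (hh : Tidy 𝓕 h) :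
    Tidy (movedFlats d h) h where
  finite := hh.finite.subset hh.movedFlats_subset
  disjoint := hh.disjoint.mono hh.movedFlats_subset
  apply_of_notMem x hx := by
    by_cases hx' : ∃ P ∈ 𝓕, x ∈ P.1
    · obtain ⟨P, hP, hxP⟩ := hx'
      obtain ⟨τ, rfl⟩ : ∃ τ : Frame R M d n, τ.toFlat = P := ⟨_, P.toFlat_frame⟩
      obtain ⟨y, rfl⟩ := hxP
      rw [(hh.apply_frame τ hP).2]
      by_contra hne
      refine hx τ.toFlat (toFlat_mem_movedFlats.2 fun h' => hne ?_) (τ.mem_flat y)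
      rw [h']
    · push Not at hx'
      exact hh.apply_of_notMem x hx'
  apply_frame τ hτ := by
    refine ⟨toFlat_mem_movedFlats.2 fun h' => ?_,
      (hh.apply_frame τ (hh.movedFlats_subset hτ)).2⟩
    exact toFlat_mem_movedFlats.1 hτ (smul_left_cancel h h')

/-- Modulo automorphisms with support of dimension less than `d`, an automorphism with support of
dimension at most `d` that moves only flats of a disjoint family is tidy. -/
theorem exists_tidy {𝓕 : Set (Flat R M d n)} (hfin : 𝓕.Finite)
    (hdisj : 𝓕.Pairwise fun P Q => Disjoint P.1 Q.1) {f : DefinableAut R M n}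
    (hf : f ∈ thinSupport R M n (d + 1)) (hmov : movedFlats d f ⊆ 𝓕) :
    ∃ h, Tidy 𝓕 h ∧ f * h⁻¹ ∈ thinSupport R M n d := by
  have hstab : ∀ P ∈ 𝓕, f • P ∈ 𝓕 := by
    intro P hP
    by_cases h : P ∈ movedFlats d f
    · refine hmov ?_
      rw [← movedFlats_conj f f P] at h
      simpa using h
    · rw [← P.toFlat_frame, smul_toFlat, not_not.1 h, P.toFlat_frame]
      exact hP
  have himage : (f • ·) '' 𝓕 ⊆ 𝓕 := by
    rintro _ ⟨P, hP, rfl⟩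
    exact hstab P hP
  have himage' : 𝓕 ⊆ (f • ·) '' 𝓕 :=
    (Set.eq_of_subset_of_ncard_le himage (by
      rw [Set.ncard_image_of_injective _ (MulAction.injective f)]) hfin).ge
  -- the straightening of `f` is the tidy automorphism, once it is known to be definable
  obtain ⟨q, hq, hqτ, hqid⟩ := exists_straightening hfin hdisj f
  have hqmem : ∀ x ∈ ⋃ P ∈ 𝓕, P.1, q x ∈ ⋃ P ∈ 𝓕, P.1 := by
    intro x hx
    simp only [Set.mem_iUnion, exists_prop] at hx
    obtain ⟨P, hP, hx⟩ := hx
    obtain ⟨τ, rfl⟩ : ∃ τ : Frame R M d n, τ.toFlat = P := ⟨_, P.toFlat_frame⟩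
    obtain ⟨y, rfl⟩ := hx
    rw [hqτ τ hP]
    refine Set.mem_biUnion (hstab _ hP) ?_
    rw [smul_toFlat]
    exact (f • τ).mem_flat y
  have hqid' : ∀ x ∉ ⋃ P ∈ 𝓕, P.1, q x = x := fun x hx => hqid x fun P hP hxP =>
    hx (Set.mem_biUnion hP hxP)
  have hinj : Set.InjOn q Set.univ := by
    intro x _ x' _ hxx
    by_cases hx : x ∈ ⋃ P ∈ 𝓕, P.1 <;> by_cases hx' : x' ∈ ⋃ P ∈ 𝓕, P.1
    · exact injOn_straightening (hdisj.mono himage) hqτ hx hx' hxx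
    · rw [hqid' x' hx'] at hxx
      exact absurd (hxx ▸ hqmem x hx) hx'
    · rw [hqid' x hx] at hxx
      exact absurd (hxx ▸ hqmem x' hx') hx
    · rwa [hqid' x hx, hqid' x' hx'] at hxx
  have hflat : ∀ P : Flat R M d n, Thin R (d + 1) P.1 := fun P => by
    rw [← show P.frame.flat = P.1 from P.2.choose_spec]
    exact P.frame.thin_flat
  obtain ⟨u, hu, h⟩ := exists_thinSupport_mul_eqOn Constr.univ hq hinj d f (by
    refine thin_of_forall_frame (d := d) ((Thin.union hf
      (Thin.biUnion hfin fun P _ => hflat P)).mono ?_) fun τ => ?_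
    · rintro x ⟨-, hx⟩
      by_contra hcon
      simp only [Set.mem_union, not_or] at hcon
      exact hx ((not_not.1 hcon.1).trans (hqid' x hcon.2).symm)
    · by_cases hτ : τ.toFlat ∈ 𝓕
      · refine (smul_frame_spec f τ).mono fun y hy => ?_
        have := hy.2
        rwa [hqτ τ hτ] at this
      · have hfix : f • τ = τ := by
          by_contra h
          exact hτ (hmov (toFlat_mem_movedFlats.2 h))
        refine ((smul_frame_spec f τ).union (thin_preimage_biUnion_flats hfin hτ)).mono ?_
        rintro y ⟨-, hy⟩
        by_contra hcon
        simp only [Set.mem_union, Set.mem_ofPred_eq, Set.mem_preimage, not_or, not_not] at hcon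
        exact hy (by rw [hcon.1, hfix, hqid' _ hcon.2]))
  have hk : ∀ x, (u * f).1 x = q x := fun x => h x trivial
  have hsmul : ∀ τ : Frame R M d n, (u * f) • τ = f • τ := fun τ => by
    rw [mul_smul, smul_frame_of_mem_thinSupport hu]
  refine ⟨u * f, ⟨hfin, hdisj, fun x hx => (hk x).trans (hqid x hx), fun τ hτ => ?_⟩, ?_⟩
  · rw [hsmul]
    refine ⟨?_, fun y => by rw [hk, hqτ τ hτ]⟩
    rw [← smul_toFlat]
    exact hstab _ hτ
  · simpa using hu

/-! ### Making flats disjoint -/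

/-- Parallel flats of dimension `d`: the last `n - d` coordinates are equal to `m`. -/
def parallelFrame (h : d ≤ n) (m : M) : Frame R M d n where
  toFun y i := if hi : i.1 < d then y ⟨i, hi⟩ else m
  affine i := by
    by_cases hi : i.1 < d
    · simp only [hi, dif_pos]
      exact .coord _
    · simp only [hi, dif_neg, not_false_eq_true]
      exact .const m
  injective y z hyz := by
    ext i
    have := congrFun hyz (Fin.castLE h i)
    simpa using this

theorem parallelFrame_apply_last (h : d < n) (m : M) (y : Fin d → M) :
    parallelFrame (R := R) h.le m y ⟨d, h⟩ = m := by
  simp [parallelFrame]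

theorem disjoint_parallelFrame (h : d < n) {m m' : M} (hm : m ≠ m') :
    Disjoint (parallelFrame (R := R) h.le m).flat (parallelFrame (R := R) h.le m').flat := by
  rw [Set.disjoint_left]
  rintro _ ⟨y, rfl⟩ ⟨z, hz⟩
  refine hm ?_
  rw [← parallelFrame_apply_last (R := R) h m y, ← hz, parallelFrame_apply_last]

theorem toFlat_parallelFrame_injective (h : d < n) :
    Function.Injective fun m : M => (parallelFrame (R := R) h.le m).toFlat := by
  intro m m' hmm
  by_contra hne
  have := disjoint_parallelFrame (R := R) h hne
  rw [Frame.toFlat_eq_iff.1 hmm] at this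
  have h0 := Frame.mem_flat (parallelFrame (R := R) h.le m') fun _ => 0
  exact Set.disjoint_left.1 this h0 h0

theorem flat_eq_univ (τ : Frame R M n n) : τ.flat = Set.univ := by
  obtain ⟨g, -, -, hg⟩ := τ.affine.exists_inverse τ.injective
  exact Set.eq_univ_of_forall fun x => ⟨g x, hg x⟩

/-- Finitely many `d`-flats can be made disjoint: for `d < n` they are moved to parallel flats one by
one, and for `d = n` there is only one flat. -/
theorem exists_smul_pairwise_disjoint (hd : d ≤ n) {𝓢 : Set (Flat R M d n)} (hfin : 𝓢.Finite) :
    ∃ g : DefinableAut R M n, ((g • ·) '' 𝓢).Pairwise fun P Q => Disjoint P.1 Q.1 := by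
  rcases hd.lt_or_eq with hd | rfl
  swap
  · refine ⟨1, fun P _ Q _ hne => absurd ?_ hne⟩
    rw [← P.toFlat_frame, ← Q.toFlat_frame, Frame.toFlat_eq_iff, flat_eq_univ, flat_eq_univ]
  suffices ∃ g : DefinableAut R M n, ∀ P ∈ 𝓢, ∃ m : M, g • P = (parallelFrame hd.le m).toFlat by
    obtain ⟨g, hg⟩ := this
    refine ⟨g, ?_⟩
    rintro _ ⟨P, hP, rfl⟩ _ ⟨Q, hQ, rfl⟩ hne
    obtain ⟨m, hm⟩ := hg P hP
    obtain ⟨m', hm'⟩ := hg Q hQ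
    simp only [hm, hm'] at hne ⊢
    exact disjoint_parallelFrame hd fun h => hne (h ▸ rfl)
  induction 𝓢, hfin using Set.Finite.induction_on with
  | empty => exact ⟨1, by simp⟩
  | @insert P 𝓢 hP hfin ih =>
    obtain ⟨g, hg⟩ := ih
    obtain ⟨m, hm⟩ := ((((hfin.image (g • ·)).insert (g • P)).preimage
      (toFlat_parallelFrame_injective (R := R) hd).injOn).infinite_compl).nonempty
    simp only [Set.mem_compl_iff, Set.mem_preimage, Set.mem_insert_iff, not_or] at hm
    have hne : (g • P.frame).flat ≠ (parallelFrame (R := R) hd.le m).flat := by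
      intro h
      refine hm.1 ?_
      rw [← Frame.toFlat_eq_iff, ← smul_toFlat, P.toFlat_frame] at h
      exact h.symm
    refine ⟨swap (g • P.frame) (parallelFrame hd.le m) * g, ?_⟩
    rintro Q (rfl | hQ)
    · refine ⟨m, ?_⟩
      rw [mul_smul]
      have := smul_toFlat (swap (g • Q.frame) (parallelFrame hd.le m)) (g • Q.frame)
      rwa [swap_smul_left hne, ← smul_toFlat, Q.toFlat_frame] at this
    · obtain ⟨m', hm'⟩ := hg Q hQ
      refine ⟨m', ?_⟩
      rw [mul_smul, hm', smul_toFlat, swap_smul_of_ne]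
      · intro h
        rw [← Frame.toFlat_eq_iff, ← hm', ← smul_toFlat, P.toFlat_frame] at h
        exact hP (smul_left_cancel g h ▸ hQ)
      · intro h
        rw [← Frame.toFlat_eq_iff, ← hm'] at h
        exact hm.2 ⟨Q, hQ, h⟩

/-! ### Extension of invariant characters -/

/-- `χ` restricts to a homomorphism on the automorphisms with support of dimension less than `d`,
and this homomorphism is invariant under conjugation by all definable automorphisms. -/
structure IsInvariantHom {A : Type*} [CommGroup A] (d : ℕ) (χ : DefinableAut R M n → A) :
    Prop where
  map_mul : ∀ f ∈ thinSupport R M n d, ∀ g ∈ thinSupport R M n d, χ (f * g) = χ f * χ g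
  map_conj : ∀ f ∈ thinSupport R M n d, ∀ w, χ (w * f * w⁻¹) = χ f

variable {A : Type*} [CommGroup A]

theorem IsInvariantHom.map_one {χ : DefinableAut R M n → A} (hχ : IsInvariantHom d χ) :
    χ 1 = 1 := by
  have := hχ.map_mul 1 (one_mem _) 1 (one_mem _)
  rw [mul_one] at this
  exact (left_eq_mul.1 this)

theorem IsInvariantHom.inv_mul {χ : DefinableAut R M n → A} (hχ : IsInvariantHom d χ)
    {u : DefinableAut R M n} (hu : u ∈ thinSupport R M n d) : χ u⁻¹ * χ u = 1 := by
  rw [← hχ.map_mul _ (inv_mem hu) _ hu, inv_mul_cancel, hχ.map_one]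

theorem smul_frame_eq_of_mul_inv_mem {f g : DefinableAut R M n}
    (h : f * g⁻¹ ∈ thinSupport R M n d) (τ : Frame R M d n) : f • τ = g • τ := by
  have := smul_frame_of_mem_thinSupport h (g • τ)
  rwa [← mul_smul, inv_mul_cancel_right] at this

/-- The value `χ (g f g⁻¹ h⁻¹)`, for `h` a tidy automorphism equal to `g f g⁻¹` up to thin support,
does not depend on the choice of `g` and `h`: two choices become conjugate after the conjugating
element has been straightened. -/
theorem IsInvariantHom.tidy_unique {χ : DefinableAut R M n → A} (hχ : IsInvariantHom d χ)
    {f g₁ g₂ h₁ h₂ : DefinableAut R M n} {𝓕₁ 𝓕₂ : Set (Flat R M d n)}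
    (ht₁ : Tidy 𝓕₁ h₁) (ht₂ : Tidy 𝓕₂ h₂)
    (hm₁ : g₁ * f * g₁⁻¹ * h₁⁻¹ ∈ thinSupport R M n d)
    (hm₂ : g₂ * f * g₂⁻¹ * h₂⁻¹ ∈ thinSupport R M n d) :
    χ (g₂ * f * g₂⁻¹ * h₂⁻¹) = χ (g₁ * f * g₁⁻¹ * h₁⁻¹) := by
  have ht₁ := ht₁.movedFlats
  have ht₂ := ht₂.movedFlats
  have hs₁ := smul_frame_eq_of_mul_inv_mem hm₁
  have hs₂ := smul_frame_eq_of_mul_inv_mem hm₂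
  have hmov₁ : ∀ P : Flat R M d n, g₁ • P ∈ movedFlats d h₁ ↔ P ∈ movedFlats d f := fun P => by
    rw [← movedFlats_conj g₁ f]
    exact not_congr (by rw [hs₁])
  have hmov₂ : ∀ P : Flat R M d n, g₂ • P ∈ movedFlats d h₂ ↔ P ∈ movedFlats d f := fun P => by
    rw [← movedFlats_conj g₂ f]
    exact not_congr (by rw [hs₂])
  set w := g₂ * g₁⁻¹ with hw
  have hwmov : ∀ P : Flat R M d n, w • P ∈ movedFlats d h₂ ↔ P ∈ movedFlats d h₁ := fun P => by
    rw [hw, mul_smul, hmov₂, ← hmov₁, smul_inv_smul]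
  obtain ⟨u, hu, huw⟩ := exists_thinSupport_mul_affine ht₁.finite w ht₁.disjoint (by
    refine ht₂.disjoint.mono ?_
    rintro _ ⟨P, hP, rfl⟩
    exact (hwmov P).2 hP)
  -- `u * w` and both tidy automorphisms are affine on the moved flats, where they can be compared
  -- through the action on frames
  have hcomm : u * w * h₁ = h₂ * (u * w) := by
    ext x : 2
    change (u * w).1 (h₁.1 x) = h₂.1 ((u * w).1 x)
    by_cases hx : ∃ P ∈ movedFlats d h₁, x ∈ P.1
    · obtain ⟨P, hP, hx⟩ := hx
      obtain ⟨τ, rfl⟩ : ∃ τ : Frame R M d n, τ.toFlat = P := ⟨_, P.toFlat_frame⟩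
      obtain ⟨y, rfl⟩ := hx
      obtain ⟨k1, k2⟩ := ht₁.apply_frame τ hP
      rw [k2, huw _ k1, huw _ hP, (ht₂.apply_frame (w • τ) ?_).2, ← hs₁, ← hs₂]
      · simp only [← mul_smul, hw]
        congr 2
        group
      · rw [← smul_toFlat, hwmov]
        exact hP
    · push Not at hx
      rw [ht₁.apply_of_notMem x hx, ht₂.apply_of_notMem]
      intro P hP hxP
      obtain ⟨σ, rfl⟩ : ∃ τ : Frame R M d n, τ.toFlat = P := ⟨_, P.toFlat_frame⟩
      obtain ⟨y, hy⟩ := hxP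
      have hτ : (w⁻¹ • σ).toFlat ∈ movedFlats d h₁ := by
        rw [← hwmov, smul_toFlat, smul_inv_smul]
        exact hP
      have := huw _ hτ y
      rw [smul_inv_smul, hy] at this
      refine hx _ hτ ?_
      rw [← (u * w).1.injective this]
      exact Frame.mem_flat _ y
  have hh₂ : h₂ = u * w * h₁ * (u * w)⁻¹ := by rw [hcomm]; group
  set F := u * w * (g₁ * f * g₁⁻¹) * (u * w)⁻¹ with hF
  have e1 : g₂ * f * g₂⁻¹ * h₂⁻¹ = u⁻¹ * (F * u * F⁻¹) * (F * h₂⁻¹) := by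
    rw [hF, hw]; group
  have e2 : F * h₂⁻¹ = u * w * (g₁ * f * g₁⁻¹ * h₁⁻¹) * (u * w)⁻¹ := by
    rw [hF, hh₂]; group
  have hFu : F * u * F⁻¹ ∈ thinSupport R M n d := Subgroup.Normal.conj_mem inferInstance u hu F
  have hFh : F * h₂⁻¹ ∈ thinSupport R M n d := by
    rw [e2]; exact Subgroup.Normal.conj_mem inferInstance _ hm₁ _
  rw [e1, hχ.map_mul _ (mul_mem (inv_mem hu) hFu) _ hFh, hχ.map_mul _ (inv_mem hu) _ hFu,
    hχ.map_conj u hu, hχ.inv_mul hu, one_mul, e2, hχ.map_conj _ hm₁]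

/-- After conjugation, an automorphism whose support has dimension at most `d` is tidy up to an
automorphism of smaller support. -/
theorem exists_conj_tidy (hd : d ≤ n) {f : DefinableAut R M n}
    (hf : f ∈ thinSupport R M n (d + 1)) : ∃ (g h : DefinableAut R M n) (𝓕 : Set (Flat R M d n)),
      Tidy 𝓕 h ∧ g * f * g⁻¹ * h⁻¹ ∈ thinSupport R M n d := by
  have hfin := finite_movedFlats hf
  obtain ⟨g, hg⟩ := exists_smul_pairwise_disjoint hd hfin
  obtain ⟨h, hh⟩ := exists_tidy (hfin.image _) hg
    (Subgroup.Normal.conj_mem inferInstance f hf g) (fun P hP => ⟨g⁻¹ • P, by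
      rwa [← movedFlats_conj g, smul_inv_smul], smul_inv_smul g P⟩)
  exact ⟨g, h, _, hh⟩

/-- An invariant character of the automorphisms with support of dimension less than `d` extends
to the automorphisms with support of dimension at most `d`: after conjugation, such an automorphism is
the product of one with smaller support and a tidy automorphism, and the latter is sent to `1`. -/
theorem IsInvariantHom.exists_extension_succ {χ : DefinableAut R M n → A}
    (hχ : IsInvariantHom d χ) (hd : d ≤ n) : ∃ χ' : DefinableAut R M n → A,
      IsInvariantHom (d + 1) χ' ∧ ∀ f ∈ thinSupport R M n d, χ' f = χ f := by
  classical
  choose! g h 𝓕 ht hm using fun f (hf : f ∈ thinSupport R M n (d + 1)) => exists_conj_tidy hd hf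
  have key : ∀ f ∈ thinSupport R M n (d + 1), ∀ (g' h' : DefinableAut R M n)
      (𝓕' : Set (Flat R M d n)), Tidy 𝓕' h' → g' * f * g'⁻¹ * h'⁻¹ ∈ thinSupport R M n d →
      χ (g f * f * (g f)⁻¹ * (h f)⁻¹) = χ (g' * f * g'⁻¹ * h'⁻¹) := fun f hf g' h' 𝓕' ht' hm' =>
    hχ.tidy_unique ht' (ht f hf) hm' (hm f hf)
  refine ⟨fun f => χ (g f * f * (g f)⁻¹ * (h f)⁻¹), ⟨?_, ?_⟩, ?_⟩
  -- for the product of two automorphisms, conjugate both by the same element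
  · intro f₁ hf₁ f₂ hf₂
    have hfin := (finite_movedFlats hf₁).union (finite_movedFlats hf₂)
    obtain ⟨c, hc⟩ := exists_smul_pairwise_disjoint hd hfin
    have hmov : ∀ f, movedFlats d f ⊆ movedFlats d f₁ ∪ movedFlats d f₂ →
        movedFlats d (c * f * c⁻¹) ⊆ (c • ·) '' (movedFlats d f₁ ∪ movedFlats d f₂) := by
      intro f hf P hP
      exact ⟨c⁻¹ • P, hf (by rwa [← movedFlats_conj c, smul_inv_smul]), smul_inv_smul c P⟩
    obtain ⟨h₁, ht₁, hm₁⟩ := exists_tidy (hfin.image _) hc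
      (Subgroup.Normal.conj_mem inferInstance f₁ hf₁ c) (hmov f₁ Set.subset_union_left)
    obtain ⟨h₂, ht₂, hm₂⟩ := exists_tidy (hfin.image _) hc
      (Subgroup.Normal.conj_mem inferInstance f₂ hf₂ c) (hmov f₂ Set.subset_union_right)
    have e : c * (f₁ * f₂) * c⁻¹ * (h₁ * h₂)⁻¹ =
        c * f₁ * c⁻¹ * h₁⁻¹ * (h₁ * (c * f₂ * c⁻¹ * h₂⁻¹) * h₁⁻¹) := by group
    have hm' : h₁ * (c * f₂ * c⁻¹ * h₂⁻¹) * h₁⁻¹ ∈ thinSupport R M n d :=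
      Subgroup.Normal.conj_mem inferInstance _ hm₂ _
    rw [key _ (mul_mem hf₁ hf₂) c (h₁ * h₂) _ (ht₁.mul ht₂) (by rw [e]; exact mul_mem hm₁ hm'),
      key _ hf₁ c h₁ _ ht₁ hm₁, key _ hf₂ c h₂ _ ht₂ hm₂, e, hχ.map_mul _ hm₁ _ hm',
      hχ.map_conj _ hm₂]
  · intro f hf w
    have e : g f * w⁻¹ * (w * f * w⁻¹) * (g f * w⁻¹)⁻¹ * (h f)⁻¹ =
        g f * f * (g f)⁻¹ * (h f)⁻¹ := by group
    rw [key (w * f * w⁻¹) (Subgroup.Normal.conj_mem inferInstance f hf w) (g f * w⁻¹) (h f) _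
      (ht f hf) (by rw [e]; exact hm f hf), e]
  · intro f hf
    have h1 : Tidy (∅ : Set (Flat R M d n)) 1 :=
      ⟨Set.finite_empty, Set.pairwise_empty _, fun _ _ => rfl, fun τ hτ => absurd hτ (by simp)⟩
    have := key f (thinSupport_mono (Nat.le_succ d) hf) 1 1 _ h1 (by simpa using hf)
    simpa using this

theorem IsInvariantHom.exists_extension {χ : DefinableAut R M n → A} (hd : d ≤ n + 1)
    (hχ : IsInvariantHom d χ) : ∃ χ' : DefinableAut R M n →* A,
      ∀ f ∈ thinSupport R M n d, χ' f = χ f := by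
  have : ∀ e, d ≤ e → e ≤ n + 1 → ∃ χ' : DefinableAut R M n → A, IsInvariantHom e χ' ∧
      ∀ f ∈ thinSupport R M n d, χ' f = χ f := by
    intro e he
    induction e, he using Nat.le_induction with
    | base => exact fun _ => ⟨χ, hχ, fun _ _ => rfl⟩
    | succ e he ih =>
      intro hen
      obtain ⟨χ', h1, h2⟩ := ih (by omega)
      obtain ⟨χ'', k1, k2⟩ := h1.exists_extension_succ (by omega)
      exact ⟨χ'', k1, fun f hf => (k2 f (thinSupport_mono he hf)).trans (h2 f hf)⟩
  obtain ⟨χ', h1, h2⟩ := this (n + 1) hd le_rfl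
  have htop : ∀ f, f ∈ thinSupport R M n (n + 1) := fun f => by
    rw [thinSupport_eq_top (Nat.lt_succ_self n)]; trivial
  exact ⟨⟨⟨χ', h1.map_one⟩, fun f g => h1.map_mul f (htop f) g (htop g)⟩, h2⟩

end Tidy

/-! ### The sign of a finitary permutation -/

section FinitarySign

variable {α : Type*}

open Classical in
/-- The sign of a permutation with finite support, `1` for other permutations. -/
noncomputable def finitarySign (σ : Equiv.Perm α) : ℤˣ :=
  if h : {x | σ x ≠ x}.Finite then
    Equiv.Perm.sign (σ.subtypePerm (p := fun x => x ∈ h.toFinset) (by simp))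
  else 1

open Classical in
theorem finitarySign_eq (σ : Equiv.Perm α) (S : Finset α) (hS : ∀ x, σ x ≠ x → x ∈ S)
    (hS' : ∀ x, σ x ∈ S ↔ x ∈ S) :
    finitarySign σ = Equiv.Perm.sign (σ.subtypePerm (p := fun x => x ∈ S) hS') := by
  have h : {x | σ x ≠ x}.Finite := S.finite_toSet.subset hS
  have hsub : ∀ x ∈ h.toFinset, x ∈ S := fun x hx => hS x (by simpa using hx)
  rw [finitarySign, dif_pos h, ← Equiv.Perm.sign_subtypePerm
    (σ.subtypePerm (p := fun x => x ∈ S) hS') (p := fun y => y.1 ∈ h.toFinset) (by simp)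
    (fun y hy => by
      simp only [Set.Finite.mem_toFinset, Set.mem_ofPred_eq]
      intro h'
      exact hy (Subtype.ext h'))]
  refine Equiv.Perm.sign_eq_sign_of_equiv _ _
    ⟨fun x => ⟨⟨x.1, hsub _ x.2⟩, x.2⟩, fun y => ⟨y.1.1, y.2⟩, fun x => rfl, fun y => rfl⟩ ?_
  intro x
  rfl

theorem mem_iff_of_support {σ : Equiv.Perm α} {S : Finset α} (hS : ∀ x, σ x ≠ x → x ∈ S) (x : α) :
    σ x ∈ S ↔ x ∈ S := by
  by_cases h : σ x = x
  · rw [h]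
  · exact iff_of_true (hS _ fun h' => h (σ.injective h')) (hS _ h)

theorem finitarySign_mul {σ τ : Equiv.Perm α} (hσ : {x | σ x ≠ x}.Finite)
    (hτ : {x | τ x ≠ x}.Finite) : finitarySign (σ * τ) = finitarySign σ * finitarySign τ := by
  classical
  have h1 : ∀ x, σ x ≠ x → x ∈ hσ.toFinset ∪ hτ.toFinset := fun x hx => by simp [hx]
  have h2 : ∀ x, τ x ≠ x → x ∈ hσ.toFinset ∪ hτ.toFinset := fun x hx => by simp [hx]
  have h3 : ∀ x, (σ * τ) x ≠ x → x ∈ hσ.toFinset ∪ hτ.toFinset := fun x hx => by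
    by_contra hcon
    simp only [Finset.mem_union, Set.Finite.mem_toFinset, Set.mem_ofPred_eq, not_or,
      not_not] at hcon
    exact hx (by rw [Equiv.Perm.mul_apply, hcon.2, hcon.1])
  rw [finitarySign_eq _ _ h1 (mem_iff_of_support h1), finitarySign_eq _ _ h2
    (mem_iff_of_support h2), finitarySign_eq _ _ h3 (mem_iff_of_support h3), ← map_mul]
  rfl

theorem finitarySign_conj (σ τ : Equiv.Perm α) :
    finitarySign (τ * σ * τ⁻¹) = finitarySign σ := by
  classical
  have hset : {x | (τ * σ * τ⁻¹) x ≠ x} = τ '' {x | σ x ≠ x} := by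
    ext x
    rw [Equiv.image_eq_preimage_symm]
    simp only [Set.mem_ofPred_eq, Set.mem_preimage, ← Equiv.Perm.inv_def, Equiv.Perm.mul_apply]
    rw [not_iff_not, ← Equiv.Perm.eq_inv_iff_eq]
  by_cases h : {x | σ x ≠ x}.Finite
  · have h1 : ∀ x, σ x ≠ x → x ∈ h.toFinset := fun x hx => by simpa using hx
    have h2 : ∀ x, (τ * σ * τ⁻¹) x ≠ x → x ∈ h.toFinset.map τ.toEmbedding := fun x hx => by
      have : x ∈ {x | (τ * σ * τ⁻¹) x ≠ x} := hx
      rw [hset] at this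
      simpa using this
    rw [finitarySign_eq _ _ h1 (mem_iff_of_support h1), finitarySign_eq _ _ h2
      (mem_iff_of_support h2)]
    refine Equiv.Perm.sign_eq_sign_of_equiv _ _
      ⟨fun x => ⟨τ⁻¹ x.1, ?_⟩, fun y => ⟨τ y.1, by simp⟩, fun x => by simp,
        fun y => by simp⟩ fun x => by simp [Equiv.Perm.subtypePerm]
    have := x.2
    simp only [Finset.mem_map_equiv] at this
    exact this
  · have h' : ¬ {x | (τ * σ * τ⁻¹) x ≠ x}.Finite := by
      rwa [hset, Set.finite_image_iff τ.injective.injOn]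
    rw [finitarySign, finitarySign, dif_neg h, dif_neg h']

theorem finitarySign_swap [DecidableEq α] {a b : α} (h : a ≠ b) :
    finitarySign (Equiv.swap a b) = -1 := by
  classical
  have h1 : ∀ x, Equiv.swap a b x ≠ x → x ∈ ({a, b} : Finset α) := fun x hx => by
    by_contra hcon
    simp only [Finset.mem_insert, Finset.mem_singleton, not_or] at hcon
    exact hx (Equiv.swap_apply_of_ne_of_ne hcon.1 hcon.2)
  rw [finitarySign_eq _ _ h1 (mem_iff_of_support h1)]
  have : (Equiv.swap a b).subtypePerm (p := fun x => x ∈ ({a, b} : Finset α))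
      (mem_iff_of_support h1) = Equiv.swap ⟨a, by simp⟩ ⟨b, by simp⟩ := by
    ext ⟨x, hx⟩
    simp only [Equiv.Perm.subtypePerm_apply, Equiv.swap_apply_def, Subtype.mk.injEq]
    split_ifs <;> rfl
  rw [this]
  convert Equiv.Perm.sign_swap (x := (⟨a, by simp⟩ : {x // x ∈ ({a, b} : Finset α)}))
    (y := ⟨b, by simp⟩) fun h' => h (congrArg Subtype.val h')

@[simp]
theorem finitarySign_one : finitarySign (1 : Equiv.Perm α) = 1 := by
  classical
  rw [finitarySign_eq 1 ∅ (by simp) (by simp)]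
  exact Equiv.Perm.sign_one

end FinitarySign

/-! ### The basic characters in each dimension -/

section Characters

variable [Infinite M] {n d : ℕ}

/-- The permutation of the `d`-flats induced by a definable automorphism. -/
noncomputable def flatPerm (d : ℕ) : DefinableAut R M n →* Equiv.Perm (Flat R M d n) :=
  MulAction.toPermHom _ _

@[simp]
theorem flatPerm_apply (f : DefinableAut R M n) (P : Flat R M d n) : flatPerm d f P = f • P := rfl

theorem smul_eq_of_notMem_movedFlats {f : DefinableAut R M n} {P : Flat R M d n}
    (h : P ∉ movedFlats d f) : f • P = P := by
  have h : f • P.frame = P.frame := not_not.1 h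
  rw [← P.toFlat_frame, smul_toFlat, h]

theorem finite_support_flatPerm {f : DefinableAut R M n} (hf : f ∈ thinSupport R M n (d + 1)) :
    {P : Flat R M d n | flatPerm d f P ≠ P}.Finite :=
  (finite_movedFlats hf).subset fun _ hP => by_contra fun h => hP (smul_eq_of_notMem_movedFlats h)

theorem isInvariantHom_sign :
    IsInvariantHom (R := R) (M := M) (n := n) (d + 1) fun f => finitarySign (flatPerm d f) where
  map_mul f hf g hg := by
    rw [map_mul, finitarySign_mul (finite_support_flatPerm hf) (finite_support_flatPerm hg)]
  map_conj f _ w := by rw [map_mul, map_mul, map_inv, finitarySign_conj]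

theorem exists_transition (f : DefinableAut R M n) (P : Flat R M d n) :
    ∃ a : affineGroup R M d, f • P.frame = (f • P).frame.comp a := by
  refine Frame.flat_eq_iff.1 (Frame.toFlat_eq_iff.1 ?_)
  rw [Flat.toFlat_frame, ← smul_toFlat, P.toFlat_frame]

/-- The affine bijection that expresses the generic restriction of `f` to the flat `P` in the chosen
coordinates of `P` and `f • P`. -/
noncomputable def transition (f : DefinableAut R M n) (P : Flat R M d n) : affineGroup R M d :=
  (exists_transition f P).choose

theorem transition_spec (f : DefinableAut R M n) (P : Flat R M d n) :
    f • P.frame = (f • P).frame.comp (transition f P) :=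
  (exists_transition f P).choose_spec

theorem transition_eq {f : DefinableAut R M n} {P : Flat R M d n} {a : affineGroup R M d}
    (h : f • P.frame = (f • P).frame.comp a) : transition f P = a :=
  Frame.comp_injective _ ((transition_spec f P).symm.trans h)

theorem transition_mul (f g : DefinableAut R M n) (P : Flat R M d n) :
    transition (f * g) P = transition f (g • P) * transition g P := by
  refine transition_eq ?_
  rw [mul_smul, transition_spec g, smul_comp, transition_spec f, Frame.comp_mul, mul_smul]

theorem transition_eq_one {f : DefinableAut R M n} {P : Flat R M d n} (h : P ∉ movedFlats d f) :
    transition f P = 1 := by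
  refine transition_eq ?_
  rw [smul_eq_of_notMem_movedFlats h, Frame.comp_one]
  exact not_not.1 h

variable {L : Type*} [CommGroup L] (c : affineGroup R M d →* L)

/-- The product over all `d`-flats of the classes, under a character of the affine group, of the
generic restrictions of `f`. It has the junk value `1` if infinitely many factors are nontrivial,
which does not happen if the support of `f` has dimension at most `d`. -/
noncomputable def transitionProd (f : DefinableAut R M n) : L :=
  ∏ᶠ P : Flat R M d n, c (transition f P)

theorem finite_mulSupport_transition {f : DefinableAut R M n}
    (hf : f ∈ thinSupport R M n (d + 1)) :
    (Function.mulSupport fun P : Flat R M d n => c (transition f P)).Finite :=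
  (finite_movedFlats hf).subset fun _ hP => by_contra fun h => hP (by
    change c _ = 1
    rw [transition_eq_one h, map_one])

theorem finprod_comp_smul (g : DefinableAut R M n) (φ : Flat R M d n → L) :
    ∏ᶠ P, φ (g • P) = ∏ᶠ P, φ P :=
  finprod_comp_equiv (MulAction.toPerm g)

/-- Conjugation by `w` changes the transition of `f` at `P` by the factors of `w` at `f • P` and at
`P`; these cancel in the product, as `f` permutes the flats that it moves. -/
theorem isInvariantHom_transitionProd :
    IsInvariantHom (n := n) (d + 1) (transitionProd c) where
  map_mul f hf g hg := by
    have h1 : (Function.mulSupport fun P : Flat R M d n => c (transition f (g • P))).Finite :=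
      ((finite_mulSupport_transition c hf).preimage (MulAction.injective g).injOn)
    simp only [transitionProd, transition_mul, map_mul]
    rw [finprod_mul_distrib h1 (finite_mulSupport_transition c hg),
      finprod_comp_smul g fun P => c (transition f P)]
  map_conj f hf w := by
    classical
    have h1 : ∀ P : Flat R M d n, c (transition (w * f * w⁻¹) (w • P)) =
        c (transition w (f • P)) * (c (transition w P))⁻¹ * c (transition f P) := by
      intro P
      have h2 := transition_mul (w * f * w⁻¹) w P
      rw [inv_mul_cancel_right, transition_mul w f] at h2
      rw [eq_mul_inv_of_mul_eq h2.symm, map_mul, map_mul, map_inv]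
      exact mul_right_comm _ _ _
    have hfin := finite_movedFlats hf
    have h3 : (Function.mulSupport fun P : Flat R M d n =>
        c (transition w (f • P)) * (c (transition w P))⁻¹) ⊆ hfin.toFinset := by
      intro P hP
      rw [Set.Finite.coe_toFinset]
      by_contra h
      exact hP (by
        change c _ * _ = 1
        rw [smul_eq_of_notMem_movedFlats h, mul_inv_cancel])
    rw [transitionProd, ← finprod_comp_smul w]
    simp only [h1]
    rw [finprod_mul_distrib (hfin.toFinset.finite_toSet.subset h3)
      (finite_mulSupport_transition c hf), finprod_eq_prod_of_mulSupport_subset _ h3,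
      Finset.prod_mul_distrib, Finset.prod_inv_distrib]
    have h4 : ∏ P ∈ hfin.toFinset, c (transition w (f • P)) =
        ∏ P ∈ hfin.toFinset, c (transition w P) := by
      refine Finset.prod_bij' (fun P _ => f • P) (fun P _ => f⁻¹ • P) ?_ ?_ ?_ ?_ ?_
      · intro P hP
        rw [Set.Finite.mem_toFinset] at hP ⊢
        simpa using (movedFlats_conj f f P).2 hP
      · intro P hP
        rw [Set.Finite.mem_toFinset] at hP ⊢
        rw [← movedFlats_conj f f, smul_inv_smul]
        simpa using hP
      · intro P _; simp
      · intro P _; simp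
      · intro P _; rfl
    rw [h4, mul_inv_cancel, one_mul]
    rfl

/-! ### Values of the basic characters on elementary automorphisms -/

theorem flatPerm_supportedOn (τ : Frame R M d n) (a : affineGroup R M d) :
    flatPerm d (supportedOn τ a) = 1 := by
  ext P : 1
  obtain ⟨σ, rfl⟩ : ∃ τ : Frame R M d n, τ.toFlat = P := ⟨_, P.toFlat_frame⟩
  rw [flatPerm_apply, smul_toFlat, Equiv.Perm.one_apply, Frame.toFlat_eq_iff]
  by_cases h : σ.flat = τ.flat
  · obtain ⟨b, rfl⟩ := Frame.flat_eq_iff.1 h.symm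
    rw [smul_comp, supportedOn_smul]
    simp
  · rw [supportedOn_smul_of_ne a h]

theorem transitionProd_supportedOn (τ : Frame R M d n) (a : affineGroup R M d) :
    transitionProd c (supportedOn τ a) = c a := by
  have hfix : ∀ P : Flat R M d n, supportedOn τ a • P = P := fun P =>
    Equiv.congr_fun (flatPerm_supportedOn τ a) P
  rw [transitionProd, finprod_eq_single _ τ.toFlat]
  · obtain ⟨b, hb⟩ := Frame.flat_eq_iff.1 (Frame.toFlat_eq_iff.1 τ.toFlat.toFlat_frame.symm)
    have : transition (supportedOn τ a) τ.toFlat = b⁻¹ * a * b := by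
      refine transition_eq ?_
      rw [hfix, hb, smul_comp, supportedOn_smul, ← Frame.comp_mul, ← Frame.comp_mul]
      congr 1
      group
    rw [this, map_mul, map_mul, map_inv, mul_right_comm, inv_mul_cancel, one_mul]
  · intro P hP
    rw [transition_eq_one, map_one]
    refine not_not.2 (supportedOn_smul_of_ne a fun h => hP ?_)
    rw [← P.toFlat_frame, Frame.toFlat_eq_iff, h]

theorem flatPerm_swap [DecidableEq (Flat R M d n)] {β γ : Frame R M d n} (h : β.flat ≠ γ.flat) :
    flatPerm d (swap β γ) = Equiv.swap β.toFlat γ.toFlat := by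
  ext P : 1
  obtain ⟨σ, rfl⟩ : ∃ τ : Frame R M d n, τ.toFlat = P := ⟨_, P.toFlat_frame⟩
  rw [flatPerm_apply]
  by_cases h1 : σ.toFlat = β.toFlat
  · rw [h1, Equiv.swap_apply_left, smul_toFlat, swap_smul_left h]
  by_cases h2 : σ.toFlat = γ.toFlat
  · rw [h2, Equiv.swap_apply_right, smul_toFlat, swap_smul_right h]
  rw [Equiv.swap_apply_of_ne_of_ne h1 h2, smul_toFlat, swap_smul_of_ne]
  · exact fun h' => h1 (Frame.toFlat_eq_iff.2 h')
  · exact fun h' => h2 (Frame.toFlat_eq_iff.2 h')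

theorem transitionProd_swap {β γ : Frame R M d n} (h : β.flat ≠ γ.flat) :
    transitionProd c (swap β γ) = 1 := by
  classical
  have hne : β.toFlat ≠ γ.toFlat := fun h' => h (Frame.toFlat_eq_iff.1 h')
  have hsub : (Function.mulSupport fun P : Flat R M d n => c (transition (swap β γ) P)) ⊆
      ({β.toFlat, γ.toFlat} : Finset (Flat R M d n)) := by
    intro P hP
    by_contra hcon
    simp only [Finset.coe_insert, Finset.coe_singleton, Set.mem_insert_iff,
      Set.mem_singleton_iff, not_or] at hcon
    refine hP ?_
    change c _ = 1
    rw [transition_eq_one, map_one]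
    refine not_not.2 (swap_smul_of_ne ?_ ?_)
    · rw [ne_eq, ← Frame.toFlat_eq_iff, P.toFlat_frame]
      exact hcon.1
    · rw [ne_eq, ← Frame.toFlat_eq_iff, P.toFlat_frame]
      exact hcon.2
  rw [transitionProd, finprod_eq_prod_of_mulSupport_subset _ hsub, Finset.prod_pair hne, ← map_mul]
  have h1 : swap β γ • γ.toFlat = β.toFlat := by rw [smul_toFlat, swap_smul_right h]
  have h2 := transition_mul (swap β γ) (swap β γ) γ.toFlat
  rw [swap_mul_self, h1, transition_eq_one (f := 1)] at h2
  · rw [← h2, map_one]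
  · exact not_not.2 (one_smul _ _)

/-! ### Generation by elementary automorphisms -/

section Generation

variable {Q : Type*} [CommGroup Q] {π : DefinableAut R M n →* Q}

theorem map_eq_of_smul_eq (hπ : ∀ f ∈ thinSupport R M n d, π f = 1) {f g : DefinableAut R M n}
    (hf : f ∈ thinSupport R M n (d + 1)) (hg : g ∈ thinSupport R M n (d + 1))
    (h : ∀ τ : Frame R M d n, f • τ = g • τ) : π f = π g := by
  have : f * g⁻¹ ∈ thinSupport R M n d :=
    mem_thinSupport_of_smul_eq (mul_mem hf (inv_mem hg)) fun τ => by
      rw [mul_smul, h, smul_inv_smul]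
  have h1 := hπ _ this
  rwa [map_mul, map_inv, mul_inv_eq_one] at h1

/-- Modulo smaller support, automorphisms supported on different flats are conjugate if they are
given by the same affine bijection in suitable coordinates. -/
theorem map_supportedOn_eq (hπ : ∀ f ∈ thinSupport R M n d, π f = 1) (τ τ' : Frame R M d n)
    (a : affineGroup R M d) : π (supportedOn τ a) = π (supportedOn τ' a) := by
  obtain ⟨u, hu, hτ, -⟩ := exists_smul_eq τ τ'
  have h1 : π (supportedOn τ a) = π (u * supportedOn τ a * u⁻¹) := by
    rw [map_mul, map_mul, map_inv, mul_right_comm, mul_inv_cancel, one_mul]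
  rw [h1]
  refine map_eq_of_smul_eq hπ (Subgroup.Normal.conj_mem inferInstance _ (supportedOn_mem τ a) u)
    (supportedOn_mem τ' a) fun σ => ?_
  rw [mul_smul, mul_smul]
  by_cases h : σ.flat = τ'.flat
  · obtain ⟨b, rfl⟩ := Frame.flat_eq_iff.1 h.symm
    rw [smul_comp, smul_comp, smul_comp, smul_comp, supportedOn_smul, inv_smul_eq_iff.2 hτ.symm,
      supportedOn_smul, smul_comp, hτ]
  · rw [supportedOn_smul_of_ne a h, supportedOn_smul_of_ne, smul_inv_smul]
    intro h'
    refine h ?_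
    rw [← Frame.toFlat_eq_iff, ← smul_toFlat, inv_smul_eq_iff, smul_toFlat, hτ,
      Frame.toFlat_eq_iff] at h'
    exact h'

/-- Modulo smaller support, any two swaps are conjugate. -/
theorem map_swap_eq (hπ : ∀ f ∈ thinSupport R M n d, π f = 1) {β γ β' γ' : Frame R M d n}
    (h : β.flat ≠ γ.flat) (h' : β'.flat ≠ γ'.flat) : π (swap β γ) = π (swap β' γ') := by
  obtain ⟨u, -, hu, -⟩ := exists_smul_eq β β'
  have hne : ∀ (w : DefinableAut R M n) {σ τ : Frame R M d n}, (w • σ).flat = (w • τ).flat →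
      σ.flat = τ.flat := fun w σ τ hw => by
    rw [← Frame.toFlat_eq_iff, ← smul_toFlat, ← smul_toFlat] at hw
    exact Frame.toFlat_eq_iff.1 (smul_left_cancel w hw)
  obtain ⟨v, -, hv, hv'⟩ := exists_smul_eq (u • γ) γ'
  have hβ : v • u • β = β' := by
    rw [hu, hv' _ ?_ h']
    rw [← hu]
    exact fun h0 => h (hne u h0)
  set w := v * u
  have hwβ : w • β = β' := by rw [mul_smul, hβ]
  have hwγ : w • γ = γ' := by rw [mul_smul, hv]
  have h1 : π (swap β γ) = π (w * swap β γ * w⁻¹) := by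
    rw [map_mul, map_mul, map_inv, mul_right_comm, mul_inv_cancel, one_mul]
  rw [h1]
  refine map_eq_of_smul_eq hπ (Subgroup.Normal.conj_mem inferInstance _ (swap_mem β γ) w)
    (swap_mem β' γ') fun σ => ?_
  rw [mul_smul, mul_smul]
  by_cases h1 : σ.flat = β'.flat
  · obtain ⟨b, rfl⟩ := Frame.flat_eq_iff.1 h1.symm
    simp only [smul_comp]
    rw [inv_smul_eq_iff.2 hwβ.symm, swap_smul_left h, hwγ, swap_smul_left h']
  by_cases h2 : σ.flat = γ'.flat
  · obtain ⟨b, rfl⟩ := Frame.flat_eq_iff.1 h2.symm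
    simp only [smul_comp]
    rw [inv_smul_eq_iff.2 hwγ.symm, swap_smul_right h, hwβ, swap_smul_right h']
  rw [swap_smul_of_ne h1 h2, swap_smul_of_ne, smul_inv_smul]
  · intro h3
    refine h1 (hne w⁻¹ ?_)
    rw [h3, ← hwβ, inv_smul_smul]
  · intro h3
    refine h2 (hne w⁻¹ ?_)
    rw [h3, ← hwγ, inv_smul_smul]

/-- Modulo automorphisms of smaller support, an automorphism whose support has dimension at most
`d` is a product of automorphisms supported on a single `d`-flat and of swaps. As all swaps are
conjugate modulo smaller support, its class in an abelian quotient is determined by its basic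
characters. -/
theorem map_eq_one_of_characters (hπ : ∀ f ∈ thinSupport R M n d, π f = 1)
    (hc : ∀ τ : Frame R M d n, ∀ a, c a = 1 → π (supportedOn τ a) = 1)
    {f : DefinableAut R M n} (hf : f ∈ thinSupport R M n (d + 1))
    (hf1 : transitionProd c f = 1) (hf2 : finitarySign (flatPerm d f) = 1) : π f = 1 := by
  classical
  -- The image of the general element is that of `supportedOn τ a`, times that of a swap if its sign
  -- is `-1`. This is proved by induction on the number of moved flats.
  suffices key : ∀ (N : ℕ) (f : DefinableAut R M n), f ∈ thinSupport R M n (d + 1) →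
      (movedFlats d f).ncard = N → ∀ τ : Frame R M d n, ∃ a : affineGroup R M d,
      c a = transitionProd c f ∧ ((finitarySign (flatPerm d f) = 1 ∧ π f = π (supportedOn τ a)) ∨
        (finitarySign (flatPerm d f) = -1 ∧ ∃ β γ : Frame R M d n, β.flat ≠ γ.flat ∧
          π f = π (supportedOn τ a) * π (swap β γ))) by
    by_cases hne : Nonempty (Frame R M d n)
    · obtain ⟨τ⟩ := hne
      obtain ⟨a, ha, h⟩ := key _ f hf rfl τ
      rcases h with ⟨-, h⟩ | ⟨h, -⟩
      · rw [h, hc τ a (ha.trans hf1)]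
      · rw [hf2] at h
        exact absurd h (by decide)
    · exact hπ f (mem_thinSupport_of_smul_eq hf fun τ => absurd ⟨τ⟩ hne)
  intro N
  induction N using Nat.strong_induction_on with
  | _ N ih =>
  intro f hf hN τ
  have hfin := finite_movedFlats hf
  by_cases hemp : ∀ σ : Frame R M d n, f • σ = σ
  · refine ⟨1, ?_, .inl ⟨?_, ?_⟩⟩
    · rw [map_one, transitionProd]
      refine (finprod_eq_one_of_forall_eq_one fun P => ?_).symm
      rw [transition_eq_one (not_not.2 (hemp _)), map_one]
    · rw [show flatPerm d f = 1 from ?_, finitarySign_one]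
      ext P : 1
      exact smul_eq_of_notMem_movedFlats (not_not.2 (hemp _))
    · rw [map_one, map_one, hπ f (mem_thinSupport_of_smul_eq hf hemp)]
  push Not at hemp
  obtain ⟨σ, hσ⟩ := hemp
  have hlt : ∀ g : DefinableAut R M n, g • f • σ = σ →
      (∀ ρ : Frame R M d n, ρ.flat ≠ σ.flat → f • ρ = ρ → g • f • ρ = ρ) →
      (movedFlats d (g * f)).ncard < N := by
    intro g hg hg'
    rw [← hN]
    refine Set.ncard_lt_ncard ⟨fun P hP => ?_, fun h => ?_⟩ hfin
    · intro h
      refine hP ?_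
      rw [mul_smul]
      by_cases hPσ : P.frame.flat = σ.flat
      · obtain ⟨b, hb⟩ := Frame.flat_eq_iff.1 hPσ.symm
        rw [hb, smul_comp, smul_comp, hg]
      · exact hg' _ hPσ h
    · have h1 := h (toFlat_mem_movedFlats.2 hσ)
      rw [toFlat_mem_movedFlats, mul_smul] at h1
      exact h1 hg
  -- `f` either maps the flat of `σ` to itself, and is corrected there by an affine bijection, or moves
  -- it, and is corrected by a swap
  by_cases hflat : σ.flat = (f • σ).flat
  · obtain ⟨b, hb⟩ := Frame.flat_eq_iff.1 hflat
    set s := supportedOn σ b with hs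
    have hsm : s⁻¹ ∈ thinSupport R M n (d + 1) := inv_mem (supportedOn_mem σ b)
    obtain ⟨a, ha, h⟩ := ih _ (hlt s⁻¹ (by rw [hb, inv_smul_eq_iff, hs, supportedOn_smul])
      (fun ρ hρ hfρ => by rw [hfρ, inv_smul_eq_iff, hs, supportedOn_smul_of_ne b hρ]))
      (s⁻¹ * f) (mul_mem hsm hf) rfl τ
    have hfe : f = s * (s⁻¹ * f) := by group
    have hsig : finitarySign (flatPerm d (s⁻¹ * f)) = finitarySign (flatPerm d f) := by
      rw [map_mul, map_inv, hs, flatPerm_supportedOn, inv_one, one_mul]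
    have hprod : transitionProd c f = c b * transitionProd c (s⁻¹ * f) := by
      conv_lhs => rw [hfe]
      rw [(isInvariantHom_transitionProd c).map_mul _ (supportedOn_mem σ b) _ (mul_mem hsm hf),
        transitionProd_supportedOn]
    have hπs : π f = π (supportedOn τ b) * π (s⁻¹ * f) := by
      conv_lhs => rw [hfe]
      rw [map_mul, hs, map_supportedOn_eq hπ σ τ]
    refine ⟨b * a, by rw [map_mul, hprod, ha], ?_⟩
    rw [hsig] at h
    have hba : π (supportedOn τ (b * a)) = π (supportedOn τ b) * π (supportedOn τ a) := by
      rw [map_mul, map_mul]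
    rcases h with ⟨h1, h2⟩ | ⟨h1, β, γ, h3, h2⟩
    · exact .inl ⟨h1, by rw [hπs, h2, hba]⟩
    · exact .inr ⟨h1, β, γ, h3, by rw [hπs, h2, hba, mul_assoc]⟩
  · set s := swap σ (f • σ) with hs
    have hsm : s ∈ thinSupport R M n (d + 1) := swap_mem _ _
    obtain ⟨a, ha, h⟩ := ih _ (hlt s (by rw [hs, swap_smul_right hflat])
      (fun ρ hρ hfρ => by
        rw [hfρ, hs, swap_smul_of_ne hρ]
        intro h
        refine hρ ?_
        rw [← hfρ, ← Frame.toFlat_eq_iff, ← smul_toFlat, ← smul_toFlat] at h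
        exact Frame.toFlat_eq_iff.1 (smul_left_cancel f h)))
      (s * f) (mul_mem hsm hf) rfl τ
    have hfe : f = s * (s * f) := by rw [← mul_assoc, hs, swap_mul_self, one_mul]
    have hne : σ.toFlat ≠ (f • σ).toFlat := fun h => hflat (Frame.toFlat_eq_iff.1 h)
    have hsig : finitarySign (flatPerm d f) = - finitarySign (flatPerm d (s * f)) := by
      conv_lhs => rw [hfe]
      rw [isInvariantHom_sign.map_mul _ hsm _ (mul_mem hsm hf), hs, flatPerm_swap hflat,
        finitarySign_swap hne, neg_one_mul]
    have hprod : transitionProd c f = transitionProd c (s * f) := by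
      conv_lhs => rw [hfe]
      rw [(isInvariantHom_transitionProd c).map_mul _ hsm _ (mul_mem hsm hf), hs,
        transitionProd_swap c hflat, one_mul]
    have hπs : π f = π s * π (s * f) := by
      conv_lhs => rw [hfe]
      rw [map_mul]
    refine ⟨a, by rw [hprod, ha], ?_⟩
    rw [hsig]
    rcases h with ⟨h1, h2⟩ | ⟨h1, β, γ, h3, h2⟩
    · exact .inr ⟨by rw [h1], σ, f • σ, hflat, by rw [hπs, h2, mul_comm]⟩
    · refine .inl ⟨by rw [h1, neg_neg], ?_⟩
      rw [hπs, h2, hs, map_swap_eq hπ hflat h3, mul_left_comm, ← map_mul, swap_mul_self, map_one,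
        mul_one]

end Generation

end Characters

/-! ### The abelianization of the affine group -/

section Linear

variable {d : ℕ}

/-- The product `x A` of a row vector over the right module `M` with a square matrix. -/
def rowMul (A : Matrix (Fin d) (Fin d) R) (x : Fin d → M) : Fin d → M :=
  fun i => ∑ j, op (A j i) • x j

theorem rowMul_mul (A B : Matrix (Fin d) (Fin d) R) (x : Fin d → M) :
    rowMul (A * B) x = rowMul B (rowMul A x) := by
  ext k
  simp only [rowMul, Matrix.mul_apply, Finset.op_sum, op_mul, Finset.sum_smul, Finset.smul_sum, mul_smul]
  exact Finset.sum_comm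

@[simp]
theorem rowMul_one (x : Fin d → M) : rowMul (1 : Matrix (Fin d) (Fin d) R) x = x := by
  ext k
  rw [rowMul, Finset.sum_eq_single k] <;> simp +contextual

theorem rowMul_add (A : Matrix (Fin d) (Fin d) R) (x y : Fin d → M) :
    rowMul A (x + y) = rowMul A x + rowMul A y := by
  ext k
  simp [rowMul, Finset.sum_add_distrib]

@[simp]
theorem rowMul_zero (A : Matrix (Fin d) (Fin d) R) : rowMul A (0 : Fin d → M) = 0 := by
  ext k
  simp [rowMul]

theorem isAffine_rowMul_add (A : Matrix (Fin d) (Fin d) R) (c : Fin d → M) :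
    IsAffine R fun x => rowMul A x + c :=
  fun k => ⟨fun j => A j k, c k, fun _ => rfl⟩

theorem exists_eq_rowMul_add {f : (Fin d → M) → (Fin d → M)} (hf : IsAffine R f) :
    ∃ A : Matrix (Fin d) (Fin d) R, ∀ x, f x = rowMul A x + f 0 := by
  choose r c h using hf
  refine ⟨fun j k => r k j, fun x => ?_⟩
  ext k
  simp [h, rowMul]

theorem rowMul_injective [Nontrivial M] {A B : Matrix (Fin d) (Fin d) R}
    (h : ∀ x : Fin d → M, rowMul A x = rowMul B x) : A = B := by
  obtain ⟨m, hm⟩ := exists_ne (0 : M)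
  ext i j
  have := congrFun (h (Pi.single i m)) j
  simp only [rowMul] at this
  rw [Finset.sum_eq_single i (by simp +contextual) (by simp),
    Finset.sum_eq_single i (by simp +contextual) (by simp), Pi.single_eq_same,
    ← sub_eq_zero, ← sub_smul, smul_eq_zero] at this
  exact op_injective (sub_eq_zero.1 (this.resolve_right hm))

variable [Infinite M]

/-- The matrix of the linear part of an affine permutation. -/
noncomputable def linearMatrix (f : affineGroup R M d) : Matrix (Fin d) (Fin d) R :=
  (exists_eq_rowMul_add f.2).choose

theorem linearMatrix_spec (f : affineGroup R M d) (x : Fin d → M) :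
    f.1 x = rowMul (linearMatrix f) x + f.1 0 :=
  (exists_eq_rowMul_add f.2).choose_spec x

theorem linearMatrix_eq {f : affineGroup R M d} {A : Matrix (Fin d) (Fin d) R} {c : Fin d → M}
    (h : ∀ x, f.1 x = rowMul A x + c) : linearMatrix f = A := by
  refine rowMul_injective (M := M) fun x => ?_
  have h1 := linearMatrix_spec f x
  rw [h, h 0, rowMul_zero, zero_add] at h1
  exact (add_right_cancel h1).symm

theorem linearMatrix_mul (f g : affineGroup R M d) :
    linearMatrix (f * g) = linearMatrix g * linearMatrix f := by
  refine linearMatrix_eq (c := rowMul (linearMatrix f) (g.1 0) + f.1 0) fun x => ?_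
  rw [rowMul_mul, ← add_assoc, ← rowMul_add, ← linearMatrix_spec g, ← linearMatrix_spec f]
  rfl

@[simp]
theorem linearMatrix_one : linearMatrix (1 : affineGroup R M d) = 1 :=
  linearMatrix_eq (c := 0) fun x => by simp

/-- The linear part of an affine permutation. Matrices act on row vectors from the right, so the
matrix of the inverse is taken in order to obtain a homomorphism. -/
noncomputable def linearPart : affineGroup R M d →* Matrix.GeneralLinearGroup (Fin d) R where
  toFun f := ⟨linearMatrix f⁻¹, linearMatrix f, by rw [← linearMatrix_mul]; simp,
    by rw [← linearMatrix_mul]; simp⟩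
  map_one' := Units.ext (by simp)
  map_mul' f g := Units.ext (by simp [linearMatrix_mul])

/-- The linear action of `GL_d` on `M ^ d`, a section of `linearPart`. -/
def ofLinear : Matrix.GeneralLinearGroup (Fin d) R →* affineGroup R M d where
  toFun A := ⟨⟨rowMul A⁻¹.1, rowMul A.1, fun x => by rw [← rowMul_mul]; simp,
    fun x => by rw [← rowMul_mul]; simp⟩, by
      change IsAffine R (rowMul A⁻¹.1)
      simpa using isAffine_rowMul_add (M := M) A⁻¹.1 0⟩
  map_one' := by
    ext x : 2
    exact rowMul_one x
  map_mul' A B := by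
    ext x : 2
    change rowMul (A * B)⁻¹.1 x = rowMul A⁻¹.1 (rowMul B⁻¹.1 x)
    rw [← rowMul_mul, mul_inv_rev, Units.val_mul]

theorem linearPart_ofLinear (A : Matrix.GeneralLinearGroup (Fin d) R) :
    linearPart (ofLinear (M := M) A) = A := by
  refine Units.ext (linearMatrix_eq (c := 0) fun x => ?_)
  rw [← map_inv, add_zero]
  change rowMul A⁻¹⁻¹.1 x = _
  rw [inv_inv]

variable (R) in
/-- Translation by `c`. -/
def translation (c : Fin d → M) : affineGroup R M d :=
  ⟨Equiv.addRight c, by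
    change IsAffine R fun x => x + c
    simpa using isAffine_rowMul_add (1 : Matrix (Fin d) (Fin d) R) c⟩

theorem eq_translation_mul (f : affineGroup R M d) :
    f = translation R (f.1 0) * ofLinear (linearPart f) := by
  ext x : 2
  change f.1 x = rowMul (linearPart f)⁻¹.1 x + f.1 0
  rw [linearMatrix_spec]
  rfl

variable (M) in
/-- Multiplication of all coordinates by a nonzero scalar. -/
def scaling (d : ℕ) (u : Rˣ) : affineGroup R M d :=
  ⟨⟨fun x => op (u : R) • x, fun x => op ((u⁻¹ : Rˣ) : R) • x,
    fun x => by simp [smul_smul], fun x => by simp [smul_smul]⟩,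
    fun k => (IsAffineFunctional.coord k).smul _⟩

/-- A translation is the commutator of a translation with the multiplication by a scalar `u`, as
soon as `u - 1` is invertible. -/
theorem map_translation_eq_one (hR : ∃ u : R, u ≠ 0 ∧ u ≠ 1) {Q : Type*} [CommGroup Q]
    (k : affineGroup R M d →* Q) (c : Fin d → M) : k (translation R c) = 1 := by
  obtain ⟨u, hu, hu1⟩ := hR
  have hu' : u - 1 ≠ 0 := sub_ne_zero.2 hu1
  set z := scaling M d (Units.mk0 u hu)
  set c' : Fin d → M := op (u - 1)⁻¹ • c
  have hc : op (u - 1) • c' = c := by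
    rw [smul_smul, ← op_mul, inv_mul_cancel₀ hu', op_one, one_smul]
  have h : z * translation R c' = translation R c * translation R c' * z := by
    ext x : 2
    change op u • (x + c') = op u • x + c' + c
    rw [← hc, op_sub, sub_smul, smul_add, op_one, one_smul]
    abel
  have h2 := congrArg k h
  simp only [map_mul] at h2
  rw [mul_comm (k z), mul_assoc] at h2
  exact (mul_eq_right.1 h2.symm)

/-- The quotient map of the affine group onto the abelianization of the general linear group. It is
the universal homomorphism to a commutative group if `R` has more than two elements. -/
noncomputable def affineAb :
    affineGroup R M d →* Abelianization (Matrix.GeneralLinearGroup (Fin d) R) :=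
  Abelianization.of.comp linearPart

theorem affineAb_surjective : Function.Surjective (affineAb (R := R) (M := M) (d := d)) := by
  intro y
  obtain ⟨A, rfl⟩ := QuotientGroup.mk_surjective y
  exact ⟨ofLinear A, congrArg Abelianization.of (linearPart_ofLinear A)⟩

theorem map_eq_one_of_affineAb_eq_one (hR : ∃ u : R, u ≠ 0 ∧ u ≠ 1) {Q : Type*} [CommGroup Q]
    (k : affineGroup R M d →* Q) {f : affineGroup R M d} (hf : affineAb f = 1) : k f = 1 := by
  rw [eq_translation_mul f, map_mul, map_translation_eq_one hR, one_mul]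
  have h := congrArg (Abelianization.lift (k.comp ofLinear)) hf
  rwa [affineAb, MonoidHom.comp_apply, Abelianization.lift_apply_of, map_one] at h

end Linear

/-! ### The Dieudonné determinant -/

section Dieudonne

open Matrix

open Classical in
/-- The class of a nonzero scalar in the abelianized unit group, with value `1` at zero. -/
noncomputable def unitClass (r : R) : Abelianization Rˣ :=
  if h : r = 0 then 1 else Abelianization.of (Units.mk0 r h)

theorem unitClass_coe (u : Rˣ) : unitClass (u : R) = Abelianization.of u := by
  rw [unitClass, dif_neg u.ne_zero]
  congr
  ext
  rfl

theorem unitClass_mul {r s : R} (hr : r ≠ 0) (hs : s ≠ 0) :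
    unitClass (r * s) = unitClass r * unitClass s := by
  lift r to Rˣ using hr.isUnit
  lift s to Rˣ using hs.isUnit
  rw [← Units.val_mul, unitClass_coe, unitClass_coe, unitClass_coe, map_mul]

@[simp]
theorem unitClass_one : unitClass (1 : R) = 1 := by
  rw [← Units.val_one, unitClass_coe, map_one]

theorem unitClass_inv {r : R} (hr : r ≠ 0) : unitClass r⁻¹ = (unitClass r)⁻¹ := by
  rw [eq_inv_iff_mul_eq_one, ← unitClass_mul (inv_ne_zero hr) hr, inv_mul_cancel₀ hr,
    unitClass_one]

theorem unitClass_neg {r : R} (hr : r ≠ 0) : unitClass (-r) = unitClass (-1 : R) * unitClass r := by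
  rw [← unitClass_mul (neg_ne_zero.2 one_ne_zero) hr, neg_one_mul]

theorem unitClass_neg_one_mul_self : unitClass (-1 : R) * unitClass (-1 : R) = 1 := by
  rw [← unitClass_mul (neg_ne_zero.2 one_ne_zero) (neg_ne_zero.2 one_ne_zero), neg_mul_neg,
    one_mul, unitClass_one]

/-- The rows of a square matrix are left linearly independent. -/
def RowIndep {n : ℕ} (A : Matrix (Fin n) (Fin n) R) : Prop :=
  ∀ c, c ᵥ* A = 0 → c = 0

theorem rowIndep_of_isUnit {n : ℕ} (A : GL (Fin n) R) : RowIndep A.1 := fun c hc => by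
  have := congrArg (· ᵥ* A⁻¹.1) hc
  simpa only [vecMul_vecMul, Units.inv_eq_val_inv, Units.mul_inv, vecMul_one, zero_vecMul] using this

theorem RowIndep.exists_vecMul_eq {n : ℕ} {A : Matrix (Fin n) (Fin n) R} (hA : RowIndep A)
    (v : Fin n → R) : ∃ c, c ᵥ* A = v := by
  have h : Function.Injective A.vecMulLinear := by
    rw [← LinearMap.ker_eq_bot, LinearMap.ker_eq_bot']
    exact hA
  exact LinearMap.injective_iff_surjective.1 h v

theorem RowIndep.vecMul_injective {n : ℕ} {A : Matrix (Fin n) (Fin n) R} (hA : RowIndep A)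
    {c c' : Fin n → R} (h : c ᵥ* A = c' ᵥ* A) : c = c' :=
  sub_eq_zero.1 (hA _ (by rw [sub_vecMul, h, sub_self]))

/-- The rows of `B` are those of `C`, except that row `m` is replaced by the left linear
combination of the rows of `C` with coefficients `b`. -/
structure IsRowReplace {n : ℕ} (B C : Matrix (Fin n) (Fin n) R) (m : Fin n) (b : Fin n → R) :
    Prop where
  row_of_ne : ∀ k, k ≠ m → B k = C k
  row_self : B m = b ᵥ* C

theorem IsRowReplace.vecMul {n : ℕ} {B C : Matrix (Fin n) (Fin n) R} {m : Fin n} {b : Fin n → R}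
    (h : IsRowReplace B C m b) (c : Fin n → R) :
    c ᵥ* B = (Function.update c m 0 + c m • b) ᵥ* C := by
  rw [add_vecMul, smul_vecMul, ← h.row_self, vecMul_eq_sum, vecMul_eq_sum,
    ← Finset.add_sum_erase _ _ (Finset.mem_univ m), ← Finset.add_sum_erase _ _ (Finset.mem_univ m),
    Function.update_self, zero_smul, zero_add, add_comm]
  congr 1
  refine Finset.sum_congr rfl fun k hk => ?_
  rw [Function.update_of_ne (Finset.ne_of_mem_erase hk), h.row_of_ne k (Finset.ne_of_mem_erase hk)]

theorem IsRowReplace.rowIndep {n : ℕ} {B C : Matrix (Fin n) (Fin n) R} {m : Fin n} {b : Fin n → R}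
    (h : IsRowReplace B C m b) (hb : b m ≠ 0) (hC : RowIndep C) : RowIndep B := by
  intro c hc
  rw [h.vecMul] at hc
  have h0 := hC _ hc
  have hm : c m = 0 := by
    have := congrFun h0 m
    simpa [hb] using this
  rw [hm, zero_smul, add_zero] at h0
  rw [← h0, ← hm, Function.update_eq_self]

variable {n : ℕ}

/-- The matrix left after deleting the first column and row `i`, the first row taking the place of
row `i`. -/
def deleteRow (A : Matrix (Fin (n + 1)) (Fin (n + 1)) R) (i : Fin (n + 1)) :
    Matrix (Fin n) (Fin n) R :=
  fun k l => A (Equiv.swap 0 i k.succ) l.succ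

theorem vecMul_succ (A : Matrix (Fin (n + 1)) (Fin (n + 1)) R) (i : Fin (n + 1))
    (c : Fin (n + 1) → R) (l : Fin n) :
    (c ᵥ* A) l.succ = c i * A i l.succ +
      ((fun k => c (Equiv.swap 0 i (Fin.succ k))) ᵥ* deleteRow A i) l := by
  simp only [vecMul, dotProduct, deleteRow]
  rw [← Equiv.sum_comp (Equiv.swap 0 i), Fin.sum_univ_succ, Equiv.swap_apply_left]

variable {A : Matrix (Fin (n + 1)) (Fin (n + 1)) R} {x : Fin (n + 1) → R} {i j : Fin (n + 1)}

theorem rowIndep_deleteRow (hA : RowIndep A) (hx : x ᵥ* A = Pi.single 0 1) (hi : x i ≠ 0) :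
    RowIndep (deleteRow A i) := by
  intro c hc
  set c' : Fin (n + 1) → R := fun j => (Fin.cons 0 c : Fin (n + 1) → R) (Equiv.swap 0 i j)
  have hc'i : c' i = 0 := by simp [c']
  have hc' : (fun k => c' (Equiv.swap 0 i (Fin.succ k))) = c := by
    ext k
    simp [c']
  have h : c' ᵥ* A = ((c' ᵥ* A) 0 • x) ᵥ* A := by
    rw [smul_vecMul, hx]
    ext l
    refine Fin.cases ?_ (fun l => ?_) l
    · simp
    · rw [vecMul_succ A i, hc', hc, hc'i]
      simp
  have h2 := hA.vecMul_injective h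
  have h3 : (c' ᵥ* A) 0 = 0 := by
    have := congrFun h2 i
    rw [hc'i] at this
    simpa [hi] using this.symm
  rw [← hc', h2, h3]
  ext
  simp

/-- The first column being dropped, a row with nonzero coefficient in the relation
`x A = (1, 0, …, 0)` is a combination of the others. -/
theorem row_eq_vecMul_deleteRow (hx : x ᵥ* A = Pi.single 0 1) (hi : x i ≠ 0) :
    (fun l : Fin n => A i l.succ) =
      (fun k => -((x i)⁻¹ * x (Equiv.swap 0 i (Fin.succ k)))) ᵥ* deleteRow A i := by
  ext l
  have h := vecMul_succ A i x l
  rw [hx, Pi.single_eq_of_ne (Fin.succ_ne_zero l), add_comm, eq_comm, add_eq_zero_iff_neg_eq] at h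
  have h2 : (fun k => -((x i)⁻¹ * x (Equiv.swap 0 i (Fin.succ k)))) =
      -((x i)⁻¹ • fun k : Fin n => x (Equiv.swap 0 i (Fin.succ k))) := rfl
  rw [h2, neg_vecMul, smul_vecMul, Pi.neg_apply, Pi.smul_apply, smul_eq_mul, ← mul_neg, h,
    inv_mul_cancel_left₀ hi]

theorem exists_pivot (hA : RowIndep A) : ∃ (x : Fin (n + 1) → R) (i : Fin (n + 1)),
    x ᵥ* A = Pi.single 0 1 ∧ x i ≠ 0 := by
  obtain ⟨x, hx⟩ := hA.exists_vecMul_eq (Pi.single 0 1)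
  have : x ≠ 0 := by
    rintro rfl
    have := congrFun hx 0
    simp at this
  obtain ⟨i, hi⟩ := Function.ne_iff.1 this
  exact ⟨x, i, hx, hi⟩

/-- The sign of the permutation that exchanges row `i` with the first row, as an element of `R`. -/
def pivotSign (R : Type u) [DivisionRing R] (i : Fin (n + 1)) : R := if i = 0 then 1 else -1

open Classical in
/-- Artin's recursive definition of the Dieudonné determinant of a matrix with independent rows: if
`x A = (1, 0, …, 0)` and `x i ≠ 0`, expand along row `i`. The value is `1` for other matrices. -/
noncomputable def dieudonne : ∀ n : ℕ, Matrix (Fin n) (Fin n) R → Abelianization Rˣ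
  | 0, _ => 1
  | n + 1, A =>
    if h : ∃ p : (Fin (n + 1) → R) × Fin (n + 1), p.1 ᵥ* A = Pi.single 0 1 ∧ p.1 p.2 ≠ 0 then
      unitClass (pivotSign R h.choose.2) * (unitClass (h.choose.1 h.choose.2))⁻¹ *
        dieudonne n (deleteRow A h.choose.2)
    else 1

variable (R n) in
/-- Replacing row `m` by a combination of the rows multiplies the Dieudonné determinant by the class
of the coefficient of row `m`. -/
def RowReplaceProp : Prop :=
  ∀ (B C : Matrix (Fin n) (Fin n) R) (m : Fin n) (b : Fin n → R), RowIndep C →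
    IsRowReplace B C m b → b m ≠ 0 → dieudonne n B = unitClass (b m) * dieudonne n C

/-- An exchange of two rows is a sequence of three row replacements, with coefficients `1`, `-1` and
`1`. -/
theorem RowReplaceProp.swap_rows (H : RowReplaceProp R n) {C : Matrix (Fin n) (Fin n) R}
    (hC : RowIndep C) {p q : Fin n} (hpq : p ≠ q) :
    dieudonne n (fun k => C (Equiv.swap p q k)) = unitClass (-1 : R) * dieudonne n C := by
  -- The rows `(y, z)` are replaced by `(y + z, z)`, then `(y + z, y)`, then `(z, y)`.
  set C₁ := C.updateRow p (C p + C q)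
  set C₂ := C₁.updateRow q (C p)
  have h1 : IsRowReplace C₁ C p (Pi.single p 1 + Pi.single q 1) :=
    ⟨fun k hk => updateRow_ne hk, by
      rw [add_vecMul, single_one_vecMul, single_one_vecMul]; exact updateRow_self⟩
  have h2 : IsRowReplace C₂ C₁ q (Pi.single p 1 + Pi.single q (-1)) :=
    ⟨fun k hk => updateRow_ne hk, by
      rw [add_vecMul, single_one_vecMul, single_vecMul]
      ext l
      simp [C₁, C₂, updateRow_ne hpq.symm, row]⟩
  have h3 : IsRowReplace (fun k => C (Equiv.swap p q k)) C₂ p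
      (Pi.single p 1 + Pi.single q (-1)) := by
    refine ⟨fun k hk => ?_, ?_⟩
    · by_cases hkq : k = q
      · subst hkq
        simp [C₂]
      · rw [Equiv.swap_apply_of_ne_of_ne hk hkq]
        simp only [C₂, C₁]
        rw [updateRow_ne hkq, updateRow_ne hk]
    · rw [add_vecMul, single_one_vecMul, single_vecMul]
      ext l
      simp [C₁, C₂, updateRow_ne hpq, row]
  have hC1 := h1.rowIndep (by simp [hpq]) hC
  have hC2 := h2.rowIndep (by simp [hpq.symm]) hC1
  rw [H _ _ _ _ hC2 h3 (by simp [hpq]), H _ _ _ _ hC1 h2 (by simp [hpq.symm]),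
    H _ _ _ _ hC h1 (by simp [hpq])]
  simp [hpq, hpq.symm]

/-- `deleteRow A j` arises from `deleteRow A 0` by replacing row `j` by the first row of `A`. -/
theorem RowReplaceProp.deleteRow_zero (H : RowReplaceProp R n) (hA : RowIndep A)
    (hx : x ᵥ* A = Pi.single 0 1) (hi : x 0 ≠ 0) (hj : x j ≠ 0) (hj0 : j ≠ 0) :
    dieudonne n (deleteRow A j) =
      unitClass (-1 : R) * (unitClass (x 0))⁻¹ * unitClass (x j) * dieudonne n (deleteRow A 0) := by
  obtain ⟨q, rfl⟩ := Fin.exists_succ_eq.2 hj0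
  have h : IsRowReplace (deleteRow A q.succ) (deleteRow A 0) q
      (fun k => -((x 0)⁻¹ * x (Equiv.swap 0 0 (Fin.succ k)))) := by
    refine ⟨fun k hk => ?_, ?_⟩
    · ext l
      simp only [deleteRow]
      rw [Equiv.swap_apply_of_ne_of_ne (Fin.succ_ne_zero k) (by simpa using hk)]
      simp
    · rw [← row_eq_vecMul_deleteRow hx hi]
      ext l
      simp [deleteRow]
  have hi' := inv_ne_zero hi
  rw [H _ _ _ _ (rowIndep_deleteRow hA hx hi) h (by simp [hi, hj])]
  simp only [Equiv.swap_self, Equiv.refl_apply]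
  rw [unitClass_neg (mul_ne_zero hi' hj), unitClass_mul hi' hj, unitClass_inv hi]
  simp only [mul_assoc]

/-- `deleteRow A j` arises from `deleteRow A i` by replacing row `j` by row `i` of `A` and exchanging
the rows `i` and `j`. -/
theorem RowReplaceProp.deleteRow_ne_zero (H : RowReplaceProp R n) (hA : RowIndep A)
    (hx : x ᵥ* A = Pi.single 0 1) (hi : x i ≠ 0) (hj : x j ≠ 0) (hi0 : i ≠ 0) (hj0 : j ≠ 0)
    (hij : i ≠ j) : dieudonne n (deleteRow A j) =
      (unitClass (x i))⁻¹ * unitClass (x j) * dieudonne n (deleteRow A i) := by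
  obtain ⟨p, rfl⟩ := Fin.exists_succ_eq.2 hi0
  obtain ⟨q, rfl⟩ := Fin.exists_succ_eq.2 hj0
  have hpq : p ≠ q := fun h => hij (congrArg _ h)
  have hsw := H.swap_rows (rowIndep_deleteRow hA hx hj) hpq
  have hq : Equiv.swap 0 p.succ q.succ = q.succ :=
    Equiv.swap_apply_of_ne_of_ne (Fin.succ_ne_zero q) hij.symm
  have hp : Equiv.swap 0 q.succ p.succ = p.succ :=
    Equiv.swap_apply_of_ne_of_ne (Fin.succ_ne_zero p) hij
  have h : IsRowReplace (fun k => deleteRow A q.succ (Equiv.swap p q k)) (deleteRow A p.succ) q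
      (fun k => -((x p.succ)⁻¹ * x (Equiv.swap 0 p.succ (Fin.succ k)))) := by
    refine ⟨fun k hk => ?_, ?_⟩
    · ext l
      simp only [deleteRow]
      by_cases hkp : k = p
      · subst hkp
        simp
      · rw [Equiv.swap_apply_of_ne_of_ne hkp hk, Equiv.swap_apply_of_ne_of_ne (Fin.succ_ne_zero k)
          (by simpa using hk), Equiv.swap_apply_of_ne_of_ne (Fin.succ_ne_zero k)
          (by simpa using hkp)]
    · rw [← row_eq_vecMul_deleteRow hx hi]
      ext l
      simp [deleteRow, hp]
  have hi' := inv_ne_zero hi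
  rw [H _ _ _ _ (rowIndep_deleteRow hA hx hi) h (by simp [hi, hj, hq])] at hsw
  rw [hq, unitClass_neg (mul_ne_zero hi' hj), unitClass_mul hi' hj, unitClass_inv hi,
    mul_assoc (unitClass (-1 : R))] at hsw
  exact (mul_left_cancel hsw).symm

/-- Artin's expansion does not depend on the row. -/
theorem RowReplaceProp.expand_eq_expand (H : RowReplaceProp R n) (hA : RowIndep A)
    (hx : x ᵥ* A = Pi.single 0 1) (hi : x i ≠ 0) (hj : x j ≠ 0) :
    unitClass (pivotSign R i) * (unitClass (x i))⁻¹ * dieudonne n (deleteRow A i) =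
      unitClass (pivotSign R j) * (unitClass (x j))⁻¹ * dieudonne n (deleteRow A j) := by
  have key : ∀ {j}, x 0 ≠ 0 → x j ≠ 0 → j ≠ 0 →
      unitClass (pivotSign R (0 : Fin (n + 1))) * (unitClass (x 0))⁻¹ *
        dieudonne n (deleteRow A 0) =
      unitClass (pivotSign R j) * (unitClass (x j))⁻¹ * dieudonne n (deleteRow A j) := by
    intro j h0 hj hj0
    rw [H.deleteRow_zero hA hx h0 hj hj0, pivotSign, pivotSign, if_pos rfl, if_neg hj0]
    have := unitClass_neg_one_mul_self (R := R)
    generalize unitClass (-1 : R) = e at *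
    generalize unitClass (x j) = s
    rw [unitClass_one, one_mul]
    calc _ = (e * e) * ((s⁻¹ * s) * ((unitClass (x 0))⁻¹ * dieudonne n (deleteRow A 0))) := by
          rw [this, inv_mul_cancel, one_mul, one_mul]
      _ = _ := by ac_rfl
  by_cases hij : i = j
  · rw [hij]
  by_cases hi0 : i = 0
  · subst hi0
    exact key hi hj (Ne.symm hij)
  by_cases hj0 : j = 0
  · subst hj0
    exact (key hj hi hij).symm
  rw [H.deleteRow_ne_zero hA hx hi hj hi0 hj0 hij, pivotSign, pivotSign, if_neg hi0, if_neg hj0]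
  generalize unitClass (x j) = s
  calc _ = (s⁻¹ * s) * (unitClass (-1 : R) * (unitClass (x i))⁻¹ *
      dieudonne n (deleteRow A i)) := by rw [inv_mul_cancel, one_mul]
    _ = _ := by ac_rfl

theorem RowReplaceProp.dieudonne_succ (H : RowReplaceProp R n) (hA : RowIndep A)
    (hx : x ᵥ* A = Pi.single 0 1) (hi : x i ≠ 0) :
    dieudonne (n + 1) A =
      unitClass (pivotSign R i) * (unitClass (x i))⁻¹ * dieudonne n (deleteRow A i) := by
  have h : ∃ p : (Fin (n + 1) → R) × Fin (n + 1), p.1 ᵥ* A = Pi.single 0 1 ∧ p.1 p.2 ≠ 0 :=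
    ⟨(x, i), hx, hi⟩
  have hx' : h.choose.1 = x := hA.vecMul_injective (h.choose_spec.1.trans hx.symm)
  have hne := h.choose_spec.2
  rw [dieudonne, dif_pos h]
  rw [hx'] at hne ⊢
  exact H.expand_eq_expand hA hx hne hi

theorem RowReplaceProp.succ (H : RowReplaceProp R n) : RowReplaceProp R (n + 1) := by
  intro B C m b hC h hb
  have hB := h.rowIndep hb hC
  obtain ⟨x, i, hx, hi⟩ := exists_pivot hC
  by_cases hm : x m = 0
  · -- The relation `x C = (1, 0, …, 0)` does not involve row `m`, so it persists.
    have hxB : x ᵥ* B = Pi.single 0 1 := by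
      rw [h.vecMul, hm, zero_smul, add_zero, ← hm, Function.update_eq_self, hx]
    have him : m ≠ i := fun h' => hi (h' ▸ hm)
    obtain ⟨p, hp⟩ := Fin.exists_succ_eq.2 (show Equiv.swap 0 i m ≠ 0 by
      rw [Ne, Equiv.swap_apply_eq_iff, Equiv.swap_apply_left]; exact him)
    have hpm : Equiv.swap 0 i p.succ = m := by rw [hp, Equiv.swap_apply_self]
    have h' : IsRowReplace (deleteRow B i) (deleteRow C i) p
        ((fun k => b (Equiv.swap 0 i (Fin.succ k))) +
          b i • fun k => -((x i)⁻¹ * x (Equiv.swap 0 i (Fin.succ k)))) := by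
      refine ⟨fun k hk => ?_, ?_⟩
      · ext l
        simp only [deleteRow]
        rw [h.row_of_ne]
        intro hk'
        rw [← hpm] at hk'
        exact hk (Fin.succ_injective _ ((Equiv.swap 0 i).injective hk'))
      · ext l
        rw [add_vecMul, smul_vecMul, ← row_eq_vecMul_deleteRow hx hi]
        simp only [deleteRow]
        rw [hpm, h.row_self, vecMul_succ C i b l, add_comm]
        rfl
    have hbp : ((fun k => b (Equiv.swap 0 i (Fin.succ k))) +
          b i • fun k => -((x i)⁻¹ * x (Equiv.swap 0 i (Fin.succ k)))) p = b m := by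
      simp [hpm, hm]
    have h2 := H _ _ _ _ (rowIndep_deleteRow hC hx hi) h' (by rwa [hbp])
    rw [hbp] at h2
    rw [H.dieudonne_succ hB hxB hi, H.dieudonne_succ hC hx hi, h2]
    ac_rfl
  · -- Expanding both matrices along row `m`, only the coefficient of that row changes.
    set x' := Function.update (x - (x m * (b m)⁻¹) • b) m (x m * (b m)⁻¹) with hx'
    have hx'm : x' m = x m * (b m)⁻¹ := by simp [x']
    have hxB : x' ᵥ* B = Pi.single 0 1 := by
      rw [h.vecMul, hx'm, ← hx]
      congr 1
      ext k
      by_cases hk : k = m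
      · subst hk
        simp [hb]
      · simp [hk, x']
    have hd : deleteRow B m = deleteRow C m := by
      ext k l
      simp only [deleteRow]
      rw [h.row_of_ne]
      rw [Ne, Equiv.swap_apply_eq_iff, Equiv.swap_apply_right]
      exact Fin.succ_ne_zero k
    have hb' := inv_ne_zero hb
    rw [H.dieudonne_succ hB hxB (i := m) (by rw [hx'm]; exact mul_ne_zero hm hb'),
      H.dieudonne_succ hC hx hm, hd, hx'm, unitClass_mul hm hb', unitClass_inv hb, mul_inv, inv_inv]
    ac_rfl

variable (R) in
theorem rowReplaceProp : ∀ n, RowReplaceProp R n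
  | 0 => fun _ _ m => m.elim0
  | n + 1 => (rowReplaceProp n).succ

theorem dieudonne_one : ∀ n, dieudonne n (1 : Matrix (Fin n) (Fin n) R) = 1
  | 0 => rfl
  | n + 1 => by
    have hA : RowIndep (1 : Matrix (Fin (n + 1)) (Fin (n + 1)) R) := fun c hc => by
      rwa [vecMul_one] at hc
    have hd : deleteRow (1 : Matrix (Fin (n + 1)) (Fin (n + 1)) R) 0 = 1 := by
      ext k l
      simp [deleteRow, one_apply]
    rw [(rowReplaceProp R n).dieudonne_succ hA (x := Pi.single 0 1) (i := 0) (vecMul_one _)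
      (by simp), hd, dieudonne_one n]
    simp [pivotSign]

end Dieudonne

/-! ### The abelianization of the general linear group -/

section GeneralLinear

open Matrix

variable {n : ℕ}

theorem one_row_eq (k : Fin n) : (1 : Matrix (Fin n) (Fin n) R) k = Pi.single k 1 := by
  ext l
  simp [one_apply, Pi.single_apply, eq_comm]

theorem isRowReplace_mul (m : Fin n) (b : Fin n → R) (A : Matrix (Fin n) (Fin n) R) :
    IsRowReplace ((1 : Matrix (Fin n) (Fin n) R).updateRow m b * A) A m b := by
  refine ⟨fun k hk => ?_, ?_⟩
  · change ((1 : Matrix (Fin n) (Fin n) R).updateRow m b) k ᵥ* A = A k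
    rw [updateRow_ne hk, one_row_eq, single_one_vecMul]
    rfl
  · change ((1 : Matrix (Fin n) (Fin n) R).updateRow m b) m ᵥ* A = b ᵥ* A
    rw [updateRow_self]

theorem IsRowReplace.eq {B B' C : Matrix (Fin n) (Fin n) R} {m : Fin n} {b : Fin n → R}
    (h : IsRowReplace B C m b) (h' : IsRowReplace B' C m b) : B = B' := by
  refine funext fun k => ?_
  by_cases hk : k = m
  · rw [hk, h.row_self, h'.row_self]
  · rw [h.row_of_ne k hk, h'.row_of_ne k hk]

theorem RowIndep.exists_unit {A : Matrix (Fin n) (Fin n) R} (hA : RowIndep A) :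
    ∃ B : GL (Fin n) R, B.1 = A := by
  choose c hc using fun k => hA.exists_vecMul_eq (Pi.single k 1)
  have h : (Matrix.of c) * A = 1 := by
    refine funext fun k => ?_
    exact (hc k).trans (one_row_eq k).symm
  exact ⟨⟨A, Matrix.of c, mul_eq_one_comm.1 h, h⟩, rfl⟩

theorem rowIndep_one : RowIndep (1 : Matrix (Fin n) (Fin n) R) := fun c hc => by
  rwa [vecMul_one] at hc

/-- The invertible matrix whose left multiplication replaces row `m` by the combination of the rows
with coefficients `b`. -/
noncomputable def rowOp (m : Fin n) (b : Fin n → R) (hb : b m ≠ 0) : GL (Fin n) R :=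
  ((isRowReplace_mul m b 1).rowIndep hb rowIndep_one).exists_unit.choose

theorem coe_rowOp (m : Fin n) (b : Fin n → R) (hb : b m ≠ 0) :
    (rowOp m b hb).1 = (1 : Matrix (Fin n) (Fin n) R).updateRow m b := by
  rw [rowOp, ((isRowReplace_mul m b 1).rowIndep hb rowIndep_one).exists_unit.choose_spec, mul_one]

theorem isRowReplace_rowOp (m : Fin n) (b : Fin n → R) (hb : b m ≠ 0) (A : GL (Fin n) R) :
    IsRowReplace (rowOp m b hb * A).1 A.1 m b := by
  rw [Units.val_mul, coe_rowOp]
  exact isRowReplace_mul m b A.1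

/-- Gaussian elimination: the row operations generate the general linear group. -/
theorem mem_of_rowOp_mem (H : Subgroup (GL (Fin n) R)) (hH : ∀ m b hb, rowOp m b hb ∈ H)
    (A : GL (Fin n) R) : A ∈ H := by
  -- By descending induction on the number of leading rows that agree with the identity matrix.
  suffices h : ∀ k : ℕ, ∀ A : GL (Fin n) R,
      (∀ i : Fin n, (i : ℕ) + k < n → A.1 i = Pi.single i 1) → A ∈ H by
    exact h n A fun i hi => by omega
  intro k
  induction k with
  | zero =>
    intro A hA
    have : A = 1 := by
      refine Units.ext (funext fun i => ?_)
      rw [hA i (by have := i.2; omega)]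
      exact (one_row_eq i).symm
    rw [this]
    exact one_mem H
  | succ k ih =>
    intro A hA
    by_cases hk : k < n
    swap
    · exact ih A fun i hi => by omega
    set m : Fin n := ⟨n - 1 - k, by omega⟩ with hm
    have step : ∀ A : GL (Fin n) R, (∀ i : Fin n, (i : ℕ) + (k + 1) < n → A.1 i = Pi.single i 1) →
        ∀ c, c ᵥ* A.1 = Pi.single m 1 → c m ≠ 0 → A ∈ H := by
      intro A hA c hc hcm
      rw [← Subgroup.mul_mem_cancel_left H (hH m c hcm)]
      have h := isRowReplace_rowOp m c hcm A
      refine ih _ fun i hi => ?_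
      by_cases him : i = m
      · rw [him, h.row_self, hc]
      · rw [h.row_of_ne i him]
        refine hA i ?_
        have : (i : ℕ) ≠ n - 1 - k := fun h => him (Fin.ext h)
        omega
    obtain ⟨c, hc⟩ := (rowIndep_of_isUnit A).exists_vecMul_eq (Pi.single m 1)
    by_cases hcm : c m ≠ 0
    · exact step A hA c hc hcm
    push Not at hcm
    obtain ⟨i, hi, hci⟩ : ∃ i : Fin n, n ≤ (i : ℕ) + (k + 1) ∧ c i ≠ 0 := by
      by_contra! hcon
      have h1 : (c ᵥ* A.1) m = 0 := by
        rw [vecMul_eq_sum, Finset.sum_apply]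
        refine Finset.sum_eq_zero fun i _ => ?_
        by_cases hi : n ≤ (i : ℕ) + (k + 1)
        · rw [hcon i hi, zero_smul, Pi.zero_apply]
        · rw [hA i (by omega), Pi.smul_apply, Pi.single_eq_of_ne, smul_zero]
          intro h
          have h' : n - 1 - k = (i : ℕ) := congrArg Fin.val h
          omega
      rw [hc] at h1
      simp at h1
    have him : i ≠ m := fun h => hci (h ▸ hcm)
    -- Adding row `m` to row `i` makes the coefficient of row `m` nonzero.
    have hb : (Pi.single i 1 + Pi.single m 1 : Fin n → R) i ≠ 0 := by simp [him]
    have h := isRowReplace_rowOp i _ hb A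
    rw [← Subgroup.mul_mem_cancel_left H (hH i _ hb)]
    refine step _ (fun j hj => ?_) (c - Pi.single m (c i)) ?_ ?_
    · rw [h.row_of_ne j (by rintro rfl; omega), hA j hj]
    · rw [h.vecMul]
      refine Eq.trans ?_ hc
      congr 1
      ext j
      by_cases hj : j = i
      · subst hj
        simp [him]
      · by_cases hjm : j = m
        · subst hjm
          simp [hj]
        · simp [hj, hjm]
    · simpa [hcm] using hci

theorem dieudonne_rowOp_mul (m : Fin n) (b : Fin n → R) (hb : b m ≠ 0) (A : GL (Fin n) R) :
    dieudonne n (rowOp m b hb * A).1 = unitClass (b m) * dieudonne n A.1 :=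
  rowReplaceProp R n _ _ _ _ (rowIndep_of_isUnit A) (isRowReplace_rowOp m b hb A) hb

theorem dieudonne_rowOp (m : Fin n) (b : Fin n → R) (hb : b m ≠ 0) :
    dieudonne n (rowOp m b hb).1 = unitClass (b m) := by
  have := dieudonne_rowOp_mul m b hb 1
  rwa [mul_one, Units.val_one, dieudonne_one, mul_one] at this

theorem dieudonne_mul (A B : GL (Fin n) R) :
    dieudonne n (A * B).1 = dieudonne n A.1 * dieudonne n B.1 := by
  let H : Subgroup (GL (Fin n) R) :=
    { carrier := {A | ∀ B : GL (Fin n) R, dieudonne n (A * B).1 = dieudonne n A.1 * dieudonne n B.1}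
      one_mem' := fun B => by rw [one_mul, Units.val_one, dieudonne_one, one_mul]
      mul_mem' := fun {A A'} hA hA' B => by rw [mul_assoc, hA, hA', hA, mul_assoc]
      inv_mem' := fun {A} hA B => by
        have h1 := hA (A⁻¹ * B)
        have h2 := hA A⁻¹
        rw [mul_inv_cancel_left] at h1
        rw [mul_inv_cancel, Units.val_one, dieudonne_one] at h2
        rw [h1, ← mul_assoc, mul_comm (dieudonne n A⁻¹.1), ← h2, one_mul] }
  exact mem_of_rowOp_mem H (fun m b hb B => by rw [dieudonne_rowOp_mul, dieudonne_rowOp]) A B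

variable (R n) in
/-- The Dieudonné determinant as a homomorphism on the general linear group. -/
noncomputable def dieudonneHom : GL (Fin n) R →* Abelianization Rˣ where
  toFun A := dieudonne n A.1
  map_one' := dieudonne_one n
  map_mul' := dieudonne_mul

/-- The diagonal matrix with entry `u` at `m` and all other diagonal entries `1`. -/
noncomputable def diagonalAt (m : Fin n) : Rˣ →* GL (Fin n) R :=
  (Units.map (Matrix.diagonalRingHom (Fin n) R).toMonoidHom).comp
    (MulEquiv.piUnits.symm.toMonoidHom.comp (MonoidHom.mulSingle (fun _ : Fin n => Rˣ) m))

theorem isRowReplace_diagonalAt_mul (m : Fin n) (u : Rˣ) (A : GL (Fin n) R) :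
    IsRowReplace (diagonalAt m u * A).1 A.1 m (Pi.single m (u : R)) := by
  have h : (diagonalAt m u : GL (Fin n) R).1 =
    diagonal fun i => (Pi.mulSingle (M := fun _ => Rˣ) m u i : R) := rfl
  rw [Units.val_mul, h]
  refine ⟨fun k hk => ?_, ?_⟩
  · ext l
    rw [diagonal_mul, Pi.mulSingle_eq_of_ne hk, Units.val_one, one_mul]
  · ext l
    rw [diagonal_mul, Pi.mulSingle_eq_same, single_vecMul]
    rfl

theorem diagonalAt_eq_rowOp (m : Fin n) (u : Rˣ) :
    diagonalAt m u = rowOp m (Pi.single m (u : R)) (by simp) := by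
  have h := (isRowReplace_diagonalAt_mul m u 1).eq (isRowReplace_rowOp m _ (by simp) 1)
  rw [mul_one, mul_one] at h
  exact Units.ext h

variable {Q : Type*} [CommGroup Q] (k : GL (Fin n) R →* Q)

/-- An elementary matrix is a commutator of itself with a diagonal matrix if `R` has more than two
elements. -/
theorem map_rowOp_eq_one (hR : ∃ u : R, u ≠ 0 ∧ u ≠ 1) (m : Fin n) (c : Fin n → R) (hc : c m = 0) :
    k (rowOp m (Pi.single m 1 + c) (by simp [hc])) = 1 := by
  obtain ⟨u, hu, hu1⟩ := hR
  have hu' : u - 1 ≠ 0 := sub_ne_zero.2 hu1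
  set c' : Fin n → R := (u - 1)⁻¹ • c with hc'
  have hc'm : c' m = 0 := by simp [c', hc]
  have huc : u • c' = c + c' := by
    have : (u - 1) • c' = c := by rw [hc', smul_smul, mul_inv_cancel₀ hu', one_smul]
    rw [← this, sub_smul, one_smul, sub_add_cancel]
  set d : GL (Fin n) R := diagonalAt m (Units.mk0 u hu)
  set T := fun (c : Fin n → R) (hc : c m = 0) =>
    rowOp m (Pi.single m 1 + c) (show (Pi.single m 1 + c : Fin n → R) m ≠ 0 by simp [hc])
  have hT : ∀ c hc (A : GL (Fin n) R), (T c hc * A).1 m = A.1 m + c ᵥ* A.1 := fun c hc A => by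
    rw [(isRowReplace_rowOp m _ _ A).row_self, add_vecMul, single_one_vecMul]
    rfl
  have hT' : ∀ c hc (A : GL (Fin n) R) i, i ≠ m → (T c hc * A).1 i = A.1 i := fun c hc A =>
    (isRowReplace_rowOp m _ _ A).row_of_ne
  have hvec : ∀ (c : Fin n → R), c m = 0 → ∀ A B : GL (Fin n) R, (∀ i ≠ m, A.1 i = B.1 i) →
      c ᵥ* A.1 = c ᵥ* B.1 := fun c hc A B h => by
    rw [vecMul_eq_sum, vecMul_eq_sum]
    refine Finset.sum_congr rfl fun i _ => ?_
    by_cases hi : i = m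
    · rw [hi, hc, zero_smul, zero_smul]
    · rw [h i hi]
  have hd := isRowReplace_diagonalAt_mul m (Units.mk0 u hu)
  -- conjugation by `d` multiplies the off-diagonal entries by `u`, and `u • c' = c + c'`
  have h : d * T c' hc'm = T c hc * T c' hc'm * d := by
    refine Units.ext (funext fun i => ?_)
    by_cases hi : i = m
    · subst hi
      rw [(hd _).row_self, mul_assoc, hT c hc, hT c' hc'm, single_vecMul]
      have h1 : d.1 i = Pi.single i u := by
        have := (hd 1).row_self
        rwa [mul_one, Units.val_one, vecMul_one] at this
      have h2 : c ᵥ* (T c' hc'm * d).1 = c := by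
        rw [hvec c hc _ 1 fun j hj => ?_, Units.val_one, vecMul_one]
        rw [hT' _ hc'm _ _ hj]
        have := (hd 1).row_of_ne j hj
        rwa [mul_one] at this
      have h3 : c' ᵥ* d.1 = c' := by
        rw [hvec c' hc'm _ 1 fun j hj => ?_, Units.val_one, vecMul_one]
        have := (hd 1).row_of_ne j hj
        rwa [mul_one] at this
      have h4 : (T c' hc'm).1.row i = Pi.single i 1 + c' := by
        have := hT c' hc'm 1
        rw [mul_one, Units.val_one, vecMul_one] at this
        refine this.trans ?_
        rw [one_row_eq]
      rw [h1, h2, h3, h4, Units.val_mk0, smul_add, huc, ← Pi.single_smul, smul_eq_mul, mul_one]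
      abel
    · rw [(hd _).row_of_ne i hi, mul_assoc, hT' _ hc _ _ hi, hT' _ hc'm _ _ hi]
      have h1 := hT' c' hc'm 1 i hi
      have h2 := (hd 1).row_of_ne i hi
      rw [mul_one] at h1 h2
      exact h1.trans h2.symm
  have h2 := congrArg k h
  simp only [map_mul] at h2
  rw [mul_comm (k d), mul_assoc] at h2
  have h3 := mul_right_cancel ((mul_assoc _ _ _).trans h2.symm)
  exact mul_eq_right.1 h3

/-- A row operation is the product of a diagonal matrix and an elementary matrix. -/
theorem map_rowOp (hR : ∃ u : R, u ≠ 0 ∧ u ≠ 1) (m : Fin n) (b : Fin n → R) (hb : b m ≠ 0) :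
    k (rowOp m b hb) = k (diagonalAt m (Units.mk0 (b m) hb)) := by
  set c := (b m)⁻¹ • Function.update b m 0 with hc
  have hcm : c m = 0 := by simp [hc]
  have h : rowOp m b hb = diagonalAt m (Units.mk0 (b m) hb) *
      rowOp m (Pi.single m 1 + c) (by simp [hcm]) := by
    have h1 := isRowReplace_rowOp m (Pi.single m 1 + c) (by simp [hcm]) 1
    have h2 := isRowReplace_diagonalAt_mul m (Units.mk0 (b m) hb)
      (rowOp m (Pi.single m 1 + c) (by simp [hcm]))
    have h3 := isRowReplace_rowOp m b hb 1
    rw [mul_one] at h1 h3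
    refine Units.ext (funext fun i => ?_)
    by_cases hi : i = m
    · subst hi
      rw [h3.row_self, h2.row_self, single_vecMul, row, h1.row_self, Units.val_one, vecMul_one,
        vecMul_one, hc, Units.val_mk0, smul_add, smul_smul, mul_inv_cancel₀ hb, one_smul]
      ext j
      by_cases hj : j = i
      · subst hj
        simp
      · simp [hj]
    · rw [h3.row_of_ne i hi, h2.row_of_ne i hi, h1.row_of_ne i hi]
  rw [h, map_mul, map_rowOp_eq_one k hR m c hcm, mul_one]

/-- Diagonal matrices with one nontrivial entry are conjugate under a permutation of rows. -/
theorem map_diagonalAt_eq (m m' : Fin n) (u : Rˣ) :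
    k (diagonalAt m u) = k (diagonalAt m' u) := by
  set P : Matrix (Fin n) (Fin n) R := (1 : Matrix (Fin n) (Fin n) R).submatrix (Equiv.swap m m') id
  have hP : ∀ A : Matrix (Fin n) (Fin n) R, P * A = A.submatrix (Equiv.swap m m') id := fun A => by
    ext i j
    simp [P, mul_apply, one_apply]
  have hPP : P * P = 1 := by
    rw [hP]
    ext i j
    change (1 : Matrix (Fin n) (Fin n) R) (Equiv.swap m m' (Equiv.swap m m' i)) j = _
    rw [Equiv.swap_apply_self]
  set p : GL (Fin n) R := ⟨P, P, hPP, hPP⟩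
  have h : p * diagonalAt m u = diagonalAt m' u * p := by
    refine Units.ext ?_
    rw [Units.val_mul]
    change P * _ = _
    rw [hP]
    have h1 := isRowReplace_diagonalAt_mul m u 1
    have h2 := isRowReplace_diagonalAt_mul m' u p
    rw [mul_one] at h1
    refine funext fun i => ?_
    change (diagonalAt m u : GL (Fin n) R).1 (Equiv.swap m m' i) = _
    by_cases hi : i = m'
    · subst hi
      rw [Equiv.swap_apply_right, h1.row_self, h2.row_self, single_vecMul, single_vecMul,
        Units.val_one]
      ext j
      simp [p, P, row, one_apply]
    · rw [h1.row_of_ne _ (by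
        rw [Ne, Equiv.swap_apply_eq_iff, Equiv.swap_apply_left]; exact hi), h2.row_of_ne i hi]
      rfl
  have h2 := congrArg k h
  rw [map_mul, map_mul, mul_comm] at h2
  exact mul_right_cancel h2

variable (R) in
/-- The abelianization of the general linear group in positive dimension, through the Dieudonné
determinant. -/
noncomputable def abelianizationGLEquiv (hR : ∃ u : R, u ≠ 0 ∧ u ≠ 1) (n : ℕ) (hn : 1 ≤ n) :
    Abelianization (GL (Fin n) R) ≃* Abelianization Rˣ :=
  have m : Fin n := ⟨0, hn⟩
  have h1 : (Abelianization.lift (dieudonneHom R n)).comp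
      (Abelianization.map (diagonalAt m)) = MonoidHom.id _ := by
    ext u
    change dieudonne n (diagonalAt m u : GL (Fin n) R).1 = _
    rw [diagonalAt_eq_rowOp, dieudonne_rowOp, Pi.single_eq_same, unitClass_coe]
    rfl
  have h2 : Function.Surjective (Abelianization.map (diagonalAt (R := R) m)) := by
    intro y
    obtain ⟨A, rfl⟩ := QuotientGroup.mk_surjective y
    refine mem_of_rowOp_mem ((Abelianization.map (diagonalAt (R := R) m)).range.comap
      Abelianization.of) (fun i b hb => ?_) A
    rw [Subgroup.mem_comap, map_rowOp _ hR, map_diagonalAt_eq _ i m]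
    exact ⟨Abelianization.of (Units.mk0 (b i) hb), rfl⟩
  (MulEquiv.ofBijective (Abelianization.map (diagonalAt m))
    ⟨Function.LeftInverse.injective (DFunLike.congr_fun h1), h2⟩).symm

end GeneralLinear

/-! ### The abelianization of the group of definable automorphisms -/

section Characters

variable [Infinite M] {n d : ℕ}

open Matrix

theorem transitionProd_eq_one {L : Type*} [CommGroup L] (c : affineGroup R M d →* L)
    {f : DefinableAut R M n} (hf : f ∈ thinSupport R M n d) : transitionProd c f = 1 := by
  rw [transitionProd]
  refine finprod_eq_one_of_forall_eq_one fun P => ?_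
  rw [transition_eq_one, map_one]
  exact not_not.2 (smul_frame_of_mem_thinSupport hf _)

theorem flatPerm_eq_one {f : DefinableAut R M n} (hf : f ∈ thinSupport R M n d) :
    flatPerm d f = 1 := by
  ext P : 1
  exact smul_eq_of_notMem_movedFlats (not_not.2 (smul_frame_of_mem_thinSupport hf _))

variable (R M) in
theorem exists_levelCharacter (hd : d ≤ n) :
    ∃ ψ : DefinableAut R M n →* Abelianization (GL (Fin d) R) × ℤˣ,
      ∀ f ∈ thinSupport R M n (d + 1),
        ψ f = (transitionProd affineAb f, finitarySign (flatPerm d f)) := by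
  refine IsInvariantHom.exists_extension (d := d + 1) (by omega) ⟨fun f hf g hg => ?_,
    fun f hf w => ?_⟩
  · rw [(isInvariantHom_transitionProd affineAb).map_mul f hf g hg,
      isInvariantHom_sign.map_mul f hf g hg]
    rfl
  · rw [(isInvariantHom_transitionProd affineAb).map_conj f hf w,
      isInvariantHom_sign.map_conj f hf w]

open Classical in
variable (R M) in
/-- A chosen extension to all definable automorphisms of the two basic characters of those whose
support has dimension at most `d`, for `d ≤ n`. -/
noncomputable def levelCharacter (n d : ℕ) :
    DefinableAut R M n →* Abelianization (GL (Fin d) R) × ℤˣ :=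
  if hd : d ≤ n then (exists_levelCharacter R M hd).choose else 1

theorem levelCharacter_apply (hd : d ≤ n) {f : DefinableAut R M n}
    (hf : f ∈ thinSupport R M n (d + 1)) :
    levelCharacter R M n d f = (transitionProd affineAb f, finitarySign (flatPerm d f)) := by
  rw [levelCharacter, dif_pos hd]
  exact (exists_levelCharacter R M hd).choose_spec f hf

theorem levelCharacter_eq_one (hd : d ≤ n) {f : DefinableAut R M n}
    (hf : f ∈ thinSupport R M n d) : levelCharacter R M n d f = 1 := by
  rw [levelCharacter_apply hd (thinSupport_mono (Nat.le_succ d) hf), transitionProd_eq_one _ hf,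
    flatPerm_eq_one hf, finitarySign_one]
  rfl

/-- As `M` is infinite, there are two parallel flats of every dimension below `n`. -/
theorem exists_frames_flat_ne (hd : d < n) : ∃ β γ : Frame R M d n, β.flat ≠ γ.flat := by
  obtain ⟨m, m', h⟩ := exists_pair_ne M
  exact ⟨parallelFrame hd.le m, parallelFrame hd.le m', fun h' =>
    h (toFlat_parallelFrame_injective (R := R) hd (Frame.toFlat_eq_iff.2 h'))⟩

theorem exists_levelCharacter_fst_eq (hd : d ≤ n) (y : Abelianization (GL (Fin d) R)) :
    ∃ f ∈ thinSupport R M n (d + 1), levelCharacter R M n d f = (y, 1) := by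
  obtain ⟨a, rfl⟩ := affineAb_surjective (M := M) y
  refine ⟨_, supportedOn_mem (parallelFrame hd 0) a, ?_⟩
  rw [levelCharacter_apply hd (supportedOn_mem _ a), transitionProd_supportedOn,
    flatPerm_supportedOn, finitarySign_one]

theorem exists_levelCharacter_eq (hd : d < n) (y : Abelianization (GL (Fin d) R) × ℤˣ) :
    ∃ f ∈ thinSupport R M n (d + 1), levelCharacter R M n d f = y := by
  classical
  obtain ⟨y, ε⟩ := y
  obtain ⟨f, hf, hfy⟩ := exists_levelCharacter_fst_eq (M := M) hd.le y
  obtain ⟨β, γ, hne⟩ := exists_frames_flat_ne (R := R) (M := M) hd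
  rcases Int.units_eq_one_or ε with rfl | rfl
  · exact ⟨f, hf, hfy⟩
  · refine ⟨f * swap β γ, mul_mem hf (swap_mem β γ), ?_⟩
    rw [map_mul, hfy, levelCharacter_apply hd.le (swap_mem β γ), transitionProd_swap _ hne,
      flatPerm_swap hne, finitarySign_swap fun h => hne (Frame.toFlat_eq_iff.1 h)]
    simp

/-- In top dimension there is only one flat, and the sign is trivial. -/
theorem levelCharacter_self_snd (f : DefinableAut R M n) : (levelCharacter R M n n f).2 = 1 := by
  rw [levelCharacter_apply le_rfl (by rw [thinSupport_eq_top (Nat.lt_succ_self n)]; trivial)]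
  have : flatPerm n f = 1 := by
    ext P : 1
    refine Subtype.ext ?_
    rw [← (flatPerm n f P).toFlat_frame, ← ((1 : Equiv.Perm (Flat R M n n)) P).toFlat_frame]
    exact (flat_eq_univ _).trans (flat_eq_univ _).symm
  rw [this, finitarySign_one]

theorem map_eq_one_of_levelCharacter (hR : ∃ u : R, u ≠ 0 ∧ u ≠ 1) {Q : Type*} [CommGroup Q]
    (π : DefinableAut R M n →* Q) (hd : d ≤ n) (hπ : ∀ f ∈ thinSupport R M n d, π f = 1)
    {f : DefinableAut R M n} (hf : f ∈ thinSupport R M n (d + 1))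
    (hψ : levelCharacter R M n d f = 1) : π f = 1 := by
  rw [levelCharacter_apply hd hf, Prod.mk_eq_one] at hψ
  exact map_eq_one_of_characters affineAb hπ
    (fun τ a ha => map_eq_one_of_affineAb_eq_one hR (π.comp (supportedOn τ)) ha) hf hψ.1 hψ.2

/-- The level characters together separate the points of the abelianization: if they all vanish at
`f`, then `f` can be replaced, within its class modulo commutators, by elements of smaller and smaller
support. -/
theorem of_eq_one_of_levelCharacter (hR : ∃ u : R, u ≠ 0 ∧ u ≠ 1) :
    ∀ d ≤ n + 1, ∀ f ∈ thinSupport R M n d, (∀ j < d, levelCharacter R M n j f = 1) →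
      Abelianization.of f = 1 := by
  intro d
  induction d with
  | zero =>
    intro _ f hf _
    rw [thinSupport_zero, Subgroup.mem_bot] at hf
    rw [hf, map_one]
  | succ d ih =>
    intro hd f hf hψ
    have h := map_eq_one_of_levelCharacter hR ((QuotientGroup.mk'
      ((thinSupport R M n d).map Abelianization.of)).comp Abelianization.of) (d := d) (by omega)
      (fun g hg => (QuotientGroup.eq_one_iff _).2 (Subgroup.mem_map_of_mem _ hg)) hf
      (hψ d (Nat.lt_succ_self d))
    obtain ⟨g, hg, hgf⟩ := (QuotientGroup.eq_one_iff _).1 h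
    rw [← hgf]
    refine ih (by omega) g hg fun j hj => ?_
    have h2 := congrArg (Abelianization.lift (levelCharacter R M n j)) hgf
    rw [Abelianization.lift_apply_of, Abelianization.lift_apply_of,
      hψ j (by omega)] at h2
    exact h2

/-- The values of the level characters can be prescribed independently, starting from the top: an
element whose support has dimension at most `d` is not seen by the characters of higher level. -/
theorem exists_forall_levelCharacter_eq (y : Abelianization (GL (Fin n) R))
    (z : ∀ i : Fin n, Abelianization (GL (Fin i) R) × ℤˣ) :
    ∃ f : DefinableAut R M n, (levelCharacter R M n n f).1 = y ∧
      ∀ i : Fin n, levelCharacter R M n i f = z i := by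
  suffices h : ∀ k : ℕ, ∃ f : DefinableAut R M n, (levelCharacter R M n n f).1 = y ∧
      ∀ i : Fin n, n ≤ i + k → levelCharacter R M n i f = z i by
    obtain ⟨f, hf, hf'⟩ := h n
    exact ⟨f, hf, fun i => hf' i (by omega)⟩
  intro k
  induction k with
  | zero =>
    obtain ⟨f, -, hf⟩ := exists_levelCharacter_fst_eq (M := M) (le_refl n) y
    exact ⟨f, by rw [hf], fun i hi => by omega⟩
  | succ k ih =>
    obtain ⟨f, hf, hfz⟩ := ih
    by_cases hk : k < n
    swap
    · exact ⟨f, hf, fun i _ => hfz i (by omega)⟩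
    set m : Fin n := ⟨n - 1 - k, by omega⟩
    have hm : (m : ℕ) = n - 1 - k := rfl
    obtain ⟨g, hg, hgz⟩ := exists_levelCharacter_eq (M := M) m.2
      (z m * (levelCharacter R M n m f)⁻¹)
    have hg1 : ∀ i, (m : ℕ) < i → i ≤ n → levelCharacter R M n i g = 1 := fun i hi hin =>
      levelCharacter_eq_one hin (thinSupport_mono hi hg)
    refine ⟨g * f, by rw [map_mul, hg1 n m.2 le_rfl, one_mul, hf], fun i hi => ?_⟩
    by_cases him : i = m
    · rw [him, map_mul, hgz, inv_mul_cancel_right]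
    · have him' : (i : ℕ) ≠ m := fun h => him (Fin.ext h)
      rw [map_mul, hg1 i (by omega) i.2.le, one_mul, hfz i (by omega)]

variable (R M n) in
/-- The abelianization of the group of definable automorphisms. -/
noncomputable def abelianizationEquiv (hR : ∃ u : R, u ≠ 0 ∧ u ≠ 1) :
    Abelianization (DefinableAut R M n) ≃*
      Abelianization (GL (Fin n) R) × ∀ i : Fin n, Abelianization (GL (Fin i) R) × ℤˣ :=
  MulEquiv.ofBijective (Abelianization.lift
    (((MonoidHom.fst _ _).comp (levelCharacter R M n n)).prod
      (MonoidHom.pi fun i : Fin n => levelCharacter R M n i))) <| by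
    constructor
    · rw [injective_iff_map_eq_one]
      intro y hy
      obtain ⟨f, rfl⟩ := QuotientGroup.mk_surjective y
      have h1 : (levelCharacter R M n n f).1 = 1 := congrArg Prod.fst hy
      have h2 : ∀ i : Fin n, levelCharacter R M n i f = 1 := congrFun (congrArg Prod.snd hy)
      refine of_eq_one_of_levelCharacter hR (n + 1) le_rfl f
        (by rw [thinSupport_eq_top (Nat.lt_succ_self n)]; trivial) fun j hj => ?_
      rcases Nat.lt_succ_iff_lt_or_eq.1 hj with hj | rfl
      · exact h2 ⟨j, hj⟩
      · exact Prod.ext h1 (levelCharacter_self_snd f)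
    · rintro ⟨y, z⟩
      obtain ⟨f, hf, hfz⟩ := exists_forall_levelCharacter_eq (M := M) y z
      exact ⟨Abelianization.of f, Prod.ext hf (funext hfz)⟩

end Characters

/-! ### Additive form -/

/-- The group of signs, written additively. -/
def signEquiv : Additive ℤˣ ≃+ ZMod 2 where
  toFun ε := if ε.toMul = 1 then 0 else 1
  invFun z := Additive.ofMul (if z = 0 then 1 else -1)
  left_inv := by decide
  right_inv := by decide
  map_add' := by decide

theorem exists_ne_zero_ne_one (hR : Nat.card R ≠ 2) : ∃ u : R, u ≠ 0 ∧ u ≠ 1 := by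
  by_contra! h
  refine hR (Nat.card_eq_two_iff.2 ⟨0, 1, zero_ne_one, Set.eq_univ_of_forall fun x => ?_⟩)
  by_cases hx : x = 0
  · exact .inl hx
  · exact .inr (h x hx)

variable (R M) in
/-- The first isomorphism, in additive notation. -/
noncomputable def additiveAbelianizationEquiv [Infinite M] (hR : ∃ u : R, u ≠ 0 ∧ u ≠ 1) (n : ℕ) :
    Additive (Abelianization (DefinableAut R M n)) ≃+
      Additive (Abelianization (Matrix.GeneralLinearGroup (Fin n) R)) ×
        DirectSum (Fin n) (fun i =>
          Additive (Abelianization (Matrix.GeneralLinearGroup (Fin (i : ℕ)) R)) × ZMod 2) :=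
  (MulEquiv.toAdditive (abelianizationEquiv R M n hR)).trans <|
    AddEquiv.trans
      { toFun := fun p => (Additive.ofMul p.toMul.1, fun i =>
          (Additive.ofMul (p.toMul.2 i).1, signEquiv (Additive.ofMul (p.toMul.2 i).2)))
        invFun := fun q => Additive.ofMul (q.1.toMul, fun i =>
          ((q.2 i).1.toMul, (signEquiv.symm (q.2 i).2).toMul))
        left_inv := fun p => by simp
        right_inv := fun q => by simp
        map_add' := fun p q => by
          simp only [toMul_add, Prod.fst_mul, Prod.snd_mul, Pi.mul_apply, ofMul_mul, map_add]
          rfl }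
      ((AddEquiv.refl _).prodCongr (DirectSum.addEquivProd _).symm)

variable (R) in
/-- The second isomorphism: the general linear groups are replaced by the unit group by means of
the Dieudonné determinant, and the trivial group `GL_0` is dropped. -/
noncomputable def directSumGLEquiv (hR : ∃ u : R, u ≠ 0 ∧ u ≠ 1) (n : ℕ) (hn : 1 ≤ n) :
    DirectSum (Fin n) (fun i =>
        Additive (Abelianization (Matrix.GeneralLinearGroup (Fin (i : ℕ)) R)) × ZMod 2) ≃+
      DirectSum (Finset.Icc 1 (n - 1)) (fun _ => Additive (Abelianization Rˣ) × ZMod 2) × ZMod 2 :=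
  have hlt : ∀ j : Finset.Icc 1 (n - 1), 1 ≤ j.1 ∧ j.1 < n := fun j => by
    have := Finset.mem_Icc.1 j.2
    omega
  let e : ∀ j (_ : 1 ≤ j), Additive (Abelianization (Matrix.GeneralLinearGroup (Fin j) R)) × ZMod 2 ≃+
      Additive (Abelianization Rˣ) × ZMod 2 := fun j hj =>
    (MulEquiv.toAdditive (abelianizationGLEquiv R hR j hj)).prodCongr (AddEquiv.refl _)
  let φ : (∀ i : Fin n, Additive (Abelianization (Matrix.GeneralLinearGroup (Fin (i : ℕ)) R)) ×
      ZMod 2) →+ (Finset.Icc 1 (n - 1) → Additive (Abelianization Rˣ) × ZMod 2) × ZMod 2 :=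
    { toFun := fun f => (fun j => e j.1 (hlt j).1 (f ⟨j.1, (hlt j).2⟩), (f ⟨0, hn⟩).2)
      map_zero' := by
        refine Prod.ext (funext fun j => ?_) rfl
        exact map_zero (e j.1 (hlt j).1)
      map_add' := fun f g => by
        refine Prod.ext (funext fun j => ?_) rfl
        exact map_add (e j.1 (hlt j).1) _ _ }
  have hφ : Function.Bijective φ := by
    constructor
    · intro f g hfg
      have h1 := congrFun (congrArg Prod.fst hfg)
      have h2 : (φ f).2 = (φ g).2 := congrArg Prod.snd hfg
      ext1 ⟨i, hi⟩
      rcases Nat.eq_zero_or_pos i with rfl | hi0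
      · refine Prod.ext ?_ h2
        refine Additive.toMul.injective ?_
        obtain ⟨a, ha⟩ := QuotientGroup.mk_surjective (f ⟨0, hi⟩).1.toMul
        obtain ⟨b, hb⟩ := QuotientGroup.mk_surjective (g ⟨0, hi⟩).1.toMul
        rw [← ha, ← hb, Units.ext (Subsingleton.elim a.1 b.1)]
      · exact (e i hi0).injective (h1 ⟨i, Finset.mem_Icc.2 ⟨hi0, by omega⟩⟩)
    · rintro ⟨g, z⟩
      refine ⟨fun i => if h : 1 ≤ i.1 then
        (e i.1 h).symm (g ⟨i.1, Finset.mem_Icc.2 ⟨h, by omega⟩⟩) else (0, z), ?_⟩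
      refine Prod.ext (funext fun j => ?_) ?_
      · change e j.1 (hlt j).1 (dite _ _ _) = _
        rw [dif_pos (hlt j).1, AddEquiv.apply_symm_apply]
      · change (dite _ _ _ : _ × ZMod 2).2 = _
        rw [dif_neg (by simp)]
  ((DirectSum.addEquivProd _).trans (AddEquiv.ofBijective φ hφ)).trans
    ((DirectSum.addEquivProd _).symm.prodCongr (AddEquiv.refl _))

end DefAut

theorem mainTheorem7 (R : Type u) (M : Type v) [DivisionRing R] [AddCommGroup M]
    [Module Rᵐᵒᵖ M] [Infinite M] (hR : Nat.card R ≠ 2) (n : ℕ) (hn : 1 ≤ n) :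
    Nonempty
      (Additive (Abelianization (definableAut (rightModuleLanguage R) M n)) ≃+
        Additive (Abelianization (Matrix.GeneralLinearGroup (Fin n) R)) ×
          DirectSum (Fin n) (fun i =>
            Additive (Abelianization (Matrix.GeneralLinearGroup (Fin (i : ℕ)) R)) × ZMod 2)) ∧
    Nonempty
      ((Additive (Abelianization (Matrix.GeneralLinearGroup (Fin n) R)) ×
          DirectSum (Fin n) (fun i =>
            Additive (Abelianization (Matrix.GeneralLinearGroup (Fin (i : ℕ)) R)) × ZMod 2)) ≃+
        Additive (Abelianization Rˣ) ×
          DirectSum (Finset.Icc 1 (n - 1)) (fun _ =>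
            Additive (Abelianization Rˣ) × ZMod 2) × ZMod 2) := by
  have hu := DefAut.exists_ne_zero_ne_one hR
  exact ⟨⟨DefAut.additiveAbelianizationEquiv R M hu n⟩,
    ⟨(MulEquiv.toAdditive (DefAut.abelianizationGLEquiv R hu n hn)).prodCongr
      (DefAut.directSumGLEquiv R hu n hn)⟩⟩
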